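/- Let $b\in\mathbb C$ with $\Re b>0$ and $\Im b\ge 0$, let $q=e^{\mathsf i\pi b^2}$, and let $$\varphi_b(z)=\exp\Bigl(-\tfrac14\int_{\mathbb R+\mathsf i\varepsilon}\frac{e^{-2\mathsf i zy}\,dy}{\sinh(yb)\sinh(y/b)\,y}\Bigr),\qquad |\Im z|<\tfrac12\Re(b+b^{-1}),$$ be the non-compact quantum dilogarithm, where $\varepsilon>0$ is so small that $y=0$ is the only singularity of the integrand in $0\le\Im y\le\varepsilon$. Put $\bar\varphi_b=1/\varphi_b$. Let $N\ge1$, let $\mathcal H$ be a complex Hilbert space, and let $\mathsf r_j$, $j\in\mathbb Z$, be self-adjoint operators in $\mathcal H$ with $\mathsf r_{j+2N}=\mathsf r_j$ and $$[\mathsf r_m,\mathsf r_n]=\begin{cases}(-1)^m(1+\delta_{N,1})(2\pi\mathsf i)^{-1},& n\equiv m\pm1\pmod{2N},\\ 0,&\text{otherwise,}\end{cases}$$ in the sense of Weyl: $e^{\mathsf i s\mathsf r_m}e^{\mathsf i t\mathsf r_n}=e^{-st[\mathsf r_m,\mathsf r_n]}e^{\mathsf i t\mathsf r_n}e^{\mathsf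 i s\mathsf r_m}$ for all $s,t\in\mathbb R$, where $[\mathsf r_m,\mathsf r_n]$ denotes the scalar above. Let $\mathsf G$ be a bounded operator in $\mathcal H$ with bounded inverse such that $\mathsf G\mathsf r_j=(-1)^j\mathsf r_{j-1}\mathsf G$ for all $j\in\mathbb Z$ (with equality of domains), and let $$\mathsf U_{lc}=\mathsf G\prod_{j=1}^N\bar\varphi_b(\mathsf r_{2j}).$$ Then $\mathsf U_{lc}$ is a bounded operator with bounded inverse, and the (in general unbounded) operators $$\mathsf w_{j,t}=\mathsf U_{lc}^{\,t}\,e^{2\pi b\,\mathsf r_{j+t}}\,\mathsf U_{lc}^{-t},\qquad j,t\in\mathbb Z,\ j+t\equiv1\pmod 2,$$ satisfy the $2N$-periodic quantum discrete Liouville equation: $\mathsf w_{m+2N,t}=\mathsf w_{m,t}$ whenever $m+t$ is odd, and $$\mathsf w_{m,t+1}\,\mathsf w_{m,t-1}=(1+q\,\mathsf w_{m+1,t})(1+q^{1+2\delta_{N,1}}\,\mathsf w_{m-1,t})$$ whenever $m+t$ is even. The last equation is understood up to closure: both products, taken on their natural domains, are densely defined and closable, and they have the same closure (in particular they agree wherever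 both are defined). -/

import Mathlib

open Complex

noncomputable section

namespace QLiouville

variable {H : Type*} [NormedAddCommGroup H] [InnerProductSpace ℂ H]

/-! ### Unbounded operators -/

/-- The product `A B` of two partially defined operators on its natural domain
`{x ∈ Dom B | B x ∈ Dom A}`. -/
def opMul (A B : H →ₗ.[ℂ] H) : H →ₗ.[ℂ] H :=
  A.comp (B.domRestrict ((A.domain.comap B.toFun).map B.domain.subtype)) (by
    rintro ⟨x, hx, hxB⟩
    obtain ⟨y, hy, rfl⟩ := hx
    have h : B.domRestrict ((A.domain.comap B.toFun).map B.domain.subtype)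
        ⟨B.domain.subtype y, ⟨⟨y, hy, rfl⟩, hxB⟩⟩ = B y := LinearPMap.domRestrict_apply rfl
    rw [h]
    exact hy)

/-- A bounded operator, regarded as an everywhere defined operator. -/
def ofBounded (T : H →L[ℂ] H) : H →ₗ.[ℂ] H := (T : H →ₗ[ℂ] H).toPMap ⊤

/-- The identity operator. -/
def opOne : H →ₗ.[ℂ] H := ofBounded (ContinuousLinearMap.id ℂ H)

/-- The operator `1 + c A`, with domain `Dom A`. -/
def oneAdd (c : ℂ) (A : H →ₗ.[ℂ] H) : H →ₗ.[ℂ] H := opOne + c • A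

/-- `A ^ n` for a natural number `n`. -/
def opPow (A : H →ₗ.[ℂ] H) : ℕ → (H →ₗ.[ℂ] H)
  | 0 => opOne
  | n + 1 => opMul A (opPow A n)

/-- `A ^ t` for an integer `t`. -/
def opZPow (A : H →ₗ.[ℂ] H) : ℤ → (H →ₗ.[ℂ] H)
  | Int.ofNat n => opPow A n
  | Int.negSucc n => opPow A.inverse (n + 1)

/-- Equality of unbounded operators up to closure: both operators are densely defined and closable,
and they have the same closure. In particular they agree wherever both are defined. -/
def EqClosure (A B : H →ₗ.[ℂ] H) : Prop :=
  Dense (A.domain : Set H) ∧ Dense (B.domain : Set H) ∧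
    A.IsClosable ∧ B.IsClosable ∧ A.closure = B.closure

/-! ### Functions of a self-adjoint operator -/

/-- `R = (A + i)⁻¹` as an everywhere defined bounded operator. -/
def IsResolvent (A : H →ₗ.[ℂ] H) (R : H →L[ℂ] H) : Prop :=
  (∀ v : H, ∃ h : R v ∈ A.domain, A ⟨R v, h⟩ + I • R v = v) ∧
    ∀ x : A.domain, R (A x + I • (x : H)) = x

open Classical in
/-- The bounded operator `(A + i)⁻¹`; it exists for every self-adjoint `A`. -/
def opResolvent (A : H →ₗ.[ℂ] H) : H →L[ℂ] H :=
  if h : ∃ R : H →L[ℂ] H, IsResolvent A R then h.choose else 0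

variable [CompleteSpace H]

open Classical in
/-- `g(A)` for a self-adjoint operator `A` and a continuous compactly supported function `g` on
the line, obtained from the continuous functional calculus of the bounded normal operator
`R = (A + i)⁻¹`: the point `x` of the spectrum of `A` corresponds to the point `w = (x + i)⁻¹` of
the spectrum of `R`, so that `x = Re (w⁻¹)`, and the point `w = 0` corresponds to `x = ∞`. -/
def ccCalc (A : H →ₗ.[ℂ] H) (g : ℝ → ℂ) : H →L[ℂ] H :=
  cfc (fun w : ℂ => if w = 0 then 0 else g (w⁻¹).re) (opResolvent A)

/-- The graph of `f(A)`: it consists of all pairs `(x, y)` with `g(A) y = (g f)(A) x` for every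
continuous compactly supported `g`. -/
def calcGraph (A : H →ₗ.[ℂ] H) (f : ℝ → ℂ) : Submodule ℂ (H × H) where
  carrier := {p | ∀ g : ℝ → ℂ, Continuous g → HasCompactSupport g →
    ccCalc A g p.2 = ccCalc A (fun x => g x * f x) p.1}
  zero_mem' := by
    intro g _ _
    simp
  add_mem' := by
    intro p p' hp hp' g hg hs
    simp only [Prod.snd_add, Prod.fst_add, map_add, hp g hg hs, hp' g hg hs]
  smul_mem' := by
    intro c p hp g hg hs
    simp only [Prod.smul_snd, Prod.smul_fst, map_smul, hp g hg hs]

/-- The (in general unbounded) operator `f(A) = ∫ f(x) dE(x)`, for `f` continuous and `A`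
self-adjoint with spectral measure `E`. If `1_K ≤ g ≤ 1`, with `K` growing to the whole line, then
`g(A) y` tends to `y`, so `(x, y)` is in `calcGraph A f` exactly if `∫ |f|² d⟨x, E x⟩ < ∞` and
`y = f(A) x`. -/
def opFun (A : H →ₗ.[ℂ] H) (f : ℝ → ℂ) : H →ₗ.[ℂ] H := (calcGraph A f).toLinearPMap

/-! ### The non-compact quantum dilogarithm -/

/-- The height of the integration contour. It is positive, so that the singularity at `0` lies
below the contour, and smaller than the imaginary part of every other singularity of the integrand
in the upper half plane: these are the points `π i k b` and `π i k b⁻¹` with `k ≥ 1`. -/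
def contourHeight (b : ℂ) : ℝ := min b.re (b⁻¹).re

/-- The non-compact quantum dilogarithm
`φ_b(z) = exp (-1/4 ∫ e^{-2izy} / (sinh(yb) sinh(y/b) y) dy)` in the strip
`|Im z| < Re (b + b⁻¹) / 2`, with the contour of integration `y = x + i ε`, `x ∈ ℝ`. -/
def qdilog (b z : ℂ) : ℂ :=
  exp (-(1 / 4) * ∫ x : ℝ,
    exp (-2 * I * z * (x + contourHeight b * I)) /
      (sinh ((x + contourHeight b * I) * b) * sinh ((x + contourHeight b * I) / b) *
        (x + contourHeight b * I)))

/-! ### The algebra of observables and the evolution operator -/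

/-- `1 + δ_{N,1}` -/
def onePlusDelta (N : ℕ) : ℕ := if N = 1 then 2 else 1

open Classical in
/-- The value of the commutator `[r_m, r_n]`. -/
def commValue (N : ℕ) (m n : ℤ) : ℂ :=
  if n ≡ m + 1 [ZMOD 2 * N] ∨ n ≡ m - 1 [ZMOD 2 * N] then
    (-1) ^ m * onePlusDelta N * (2 * Real.pi * I)⁻¹
  else 0

/-- The unitary operator `e^{i s A}`. -/
def unitaryGroup (A : H →ₗ.[ℂ] H) (s : ℝ) : H →ₗ.[ℂ] H :=
  opFun A (fun x => exp (I * s * x))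

/-- Self-adjoint generators `r_j`, `2N`-periodic in `j`, whose commutators are the scalars
`[r_m, r_n] = commValue N m n`, in the sense of Weyl:
`e^{i s r_m} e^{i t r_n} = e^{[i s r_m, i t r_n]} e^{i t r_n} e^{i s r_m}`. -/
structure IsObservableFamily (N : ℕ) (r : ℤ → (H →ₗ.[ℂ] H)) : Prop where
  selfAdjoint : ∀ j, IsSelfAdjoint (r j)
  periodic : ∀ j, r (j + 2 * N) = r j
  weyl : ∀ (m n : ℤ) (s t : ℝ),
    opMul (unitaryGroup (r m) s) (unitaryGroup (r n) t) =
      exp ((I * s) * (I * t) * commValue N m n) •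
        opMul (unitaryGroup (r n) t) (unitaryGroup (r m) s)

/-- The system of linear equations `G r_j = (-1)^j r_{j-1} G`, including equality of domains. -/
def IsShiftFlip (r : ℤ → (H →ₗ.[ℂ] H)) (G : H ≃L[ℂ] H) : Prop :=
  ∀ j : ℤ, opMul (ofBounded (G : H →L[ℂ] H)) (r j) =
    ((-1 : ℂ) ^ j) • opMul (r (j - 1)) (ofBounded (G : H →L[ℂ] H))

/-- The light-cone evolution operator `U = G φ̄_b(r_2) φ̄_b(r_4) ⋯ φ̄_b(r_{2N})`, `φ̄_b = 1 / φ_b`. -/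
def evol (b : ℂ) (N : ℕ) (r : ℤ → (H →ₗ.[ℂ] H)) (G : H ≃L[ℂ] H) : H →ₗ.[ℂ] H :=
  opMul (ofBounded (G : H →L[ℂ] H))
    (((List.range N).map fun k : ℕ =>
      opFun (r (2 * (k + 1))) (fun x : ℝ => (qdilog b x)⁻¹)).foldr opMul opOne)

/-- The field variable `w_{j,t} = U^t e^{2πb r_{j+t}} U^{-t}`. -/
def field (b : ℂ) (N : ℕ) (r : ℤ → (H →ₗ.[ℂ] H)) (G : H ≃L[ℂ] H) (j t : ℤ) : H →ₗ.[ℂ] H :=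
  opMul (opZPow (evol b N r G) t)
    (opMul (opFun (r (j + t)) (fun x : ℝ => exp (2 * Real.pi * b * x)))
      (opZPow (evol b N r G) (-t)))

/-- `q = e^{iπb²}` -/
def qParam (b : ℂ) : ℂ := exp (I * Real.pi * b ^ 2)

end QLiouville

end

/-! Fix an even n = m + t and write p = r_{n+1}, P = ∏ φ̄_b(r_{2j}), so that U = G P. Conjugation by
Λ = U^t G removes the time dependence. Indeed G⁻¹ r_{n-1} G = r_n, G⁻¹ r_{n+1} G = r_{n+2} and G⁻¹
r_n G = -r_{n+1}, while P commutes with every r_j of even index. Hence the left side of the equation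
becomes P e^{2πbp} P⁻¹ e^{-2πbp} (`mem_graph_commutator_iff`), and the right side becomes (1 + q
e^{2πb r_{n+2}})(1 + q^{1+2δ} e^{2πb r_n}) (`mem_graph_product_iff`).

Only the factors of P belonging to the neighbours r_n and r_{n+2} fail to commute with p, and for
both [p, x] = i(1+δ)/(2π). So e^{2πbp} f(x) = f(x + i(1+δ)b) e^{2πbp} formally, and the commutator
reduces to products of φ_b(x + ib)/φ_b(x) = 1 + q e^{2πbx} (`qdilog_add_half`). For N > 1 the two
neighbours contribute one factor each. For N = 1 they coincide, the shift is 2ib, and the single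
quotient is (1 + q e^{2πbx})(1 + q³ e^{2πbx}).

Three things turn this into a proof. The first is complex analysis of φ_b: boundedness of φ_b and
1/φ_b on the line, exponential growth in smaller strips, and the functional equation. The second is
the rule for moving e^{ap} past f(x) when a is complex: f is written as a Fourier integral, the Weyl
relation moves each e^{itx} across, and the factors e^{-ct} so produced are those of the analytic
continuation of f (`WeylPair.mem_of_shiftPair`). The third is the treatment of domains. Since φ_b
has no decay, it is multiplied by narrow Gaussians in frequency space, that is, by e^{-sx²} with s =
1/(k+1). This gives bounded operators L_k → 1 and M_k = L_k X, where X is the expected product. The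
pairs (v, y) with L_k y = M_k v for all k form a closed graph (`regGraph`). Both sides have graphs
contained in it, and both closures contain every (L_k v, M_k v), so each side is dense in that one
closed graph (`eqClosure_of_regularization`). -/

noncomputable section
-- Complex analysis of the non-compact quantum dilogarithm.
namespace QLiouville

open MeasureTheory Filter Topology Set

/-! ### Contour integrals over horizontal lines -/

/-- The closed horizontal strip `c₁ ≤ Im z ≤ c₂`. -/
def closedStrip (c₁ c₂ : ℝ) : Set ℂ := {z | c₁ ≤ z.im ∧ z.im ≤ c₂}

/-- Cauchy's theorem on the rectangle with sides Re z = ±R, whose vertical sides contribute at most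
B(R)(c₂ - c₁) each. The integrals stay truncated, so decay like 1/R, without integrability along the
lines, is enough. -/
theorem tendsto_integral_sub_of_strip {f : ℂ → ℂ} {c₁ c₂ : ℝ} (hc : c₁ ≤ c₂)
    (hf : DifferentiableOn ℂ f (closedStrip c₁ c₂)) {B : ℝ → ℝ} (hB : Tendsto B atTop (𝓝 0))
    (hfB : ∀ R > 0, ∀ z ∈ closedStrip c₁ c₂, |z.re| = R → ‖f z‖ ≤ B R) :
    Tendsto (fun R : ℝ => (∫ x : ℝ in (-R)..R, f (x + c₁ * I)) - ∫ x : ℝ in (-R)..R, f (x + c₂ * I))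
      atTop (𝓝 0) := by
  have hlim : Tendsto (fun R : ℝ => 2 * (B R * (c₂ - c₁))) atTop (𝓝 0) := by
    simpa using (hB.mul_const (c₂ - c₁)).const_mul 2
  refine squeeze_zero_norm' ?_ hlim
  filter_upwards [eventually_gt_atTop 0] with R hR
  have key := Complex.integral_boundary_rect_eq_zero_of_differentiableOn f
    ((-R : ℝ) + c₁ * I) ((R : ℝ) + c₂ * I) (hf.mono ?_)
  · simp only [add_re, ofReal_re, mul_re, I_re, mul_zero, ofReal_im, I_im, mul_one, sub_self,
      add_zero, add_im, mul_im, zero_add] at key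
    have h1 : ∀ s : ℝ, |s| = R → ‖I • ∫ y : ℝ in c₁..c₂, f (s + y * I)‖ ≤ B R * (c₂ - c₁) := by
      intro s hs
      rw [norm_smul, norm_I, one_mul]
      have := intervalIntegral.norm_integral_le_of_norm_le_const (a := c₁) (b := c₂) (C := B R)
        (f := fun y : ℝ => f (s + y * I)) (fun y hy => by
          rw [uIoc_of_le hc] at hy
          exact hfB R hR _ ⟨by simpa using hy.1.le, by simpa using hy.2⟩ (by simpa using hs))
      rwa [abs_of_nonneg (sub_nonneg.2 hc)] at this
    have h2 := h1 R (abs_of_pos hR)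
    have h3 := h1 (-R) (by rw [abs_neg, abs_of_pos hR])
    have : (∫ x : ℝ in (-R)..R, f (x + c₁ * I)) - (∫ x : ℝ in (-R)..R, f (x + c₂ * I)) =
        (I • ∫ y : ℝ in c₁..c₂, f ((-R : ℝ) + y * I)) - I • ∫ y : ℝ in c₁..c₂, f (R + y * I) := by
      linear_combination key
    rw [this]
    refine (norm_sub_le _ _).trans ?_
    linarith
  · intro z hz
    rw [mem_reProdIm] at hz
    have := hz.2
    simp only [add_im, ofReal_im, mul_im, ofReal_re, I_im, mul_one, I_re, mul_zero, add_zero,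
      zero_add] at this
    rw [uIcc_of_le hc] at this
    exact this

theorem integrable_exp_neg_mul_abs {δ : ℝ} (hδ : 0 < δ) :
    Integrable (fun x : ℝ => Real.exp (-δ * |x|)) := by
  have h1 : IntegrableOn (fun x : ℝ => Real.exp (-δ * |x|)) (Ioi 0) := by
    refine (integrableOn_exp_mul_Ioi (neg_neg_of_pos hδ) 0).congr_fun (fun x hx => ?_)
      measurableSet_Ioi
    simp only [abs_of_pos (mem_Ioi.1 hx)]
  have h2 : IntegrableOn (fun x : ℝ => Real.exp (-δ * |x|)) (Iic 0) := by
    refine (integrableOn_exp_mul_Iic hδ 0).congr_fun (fun x hx => ?_) measurableSet_Iic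
    simp only [abs_of_nonpos (mem_Iic.1 hx), neg_mul_neg]
  rw [← integrableOn_univ, ← Iic_union_Ioi (a := (0 : ℝ))]
  exact h2.union h1

theorem tendsto_mul_exp_neg_mul {δ : ℝ} (hδ : 0 < δ) (C : ℝ) :
    Tendsto (fun R : ℝ => C * Real.exp (-δ * R)) atTop (𝓝 0) := by
  have : Tendsto (fun R : ℝ => -δ * R) atTop atBot :=
    (tendsto_const_mul_atBot_of_neg (neg_neg_of_pos hδ)).2 tendsto_id
  simpa using (Real.tendsto_exp_atBot.comp this).const_mul C

theorem continuous_horizontal (c : ℝ) : Continuous (fun x : ℝ => (x : ℂ) + c * I) := by fun_prop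

theorem horizontal_mem {c c₁ c₂ : ℝ} (h₁ : c₁ ≤ c) (h₂ : c ≤ c₂) (x : ℝ) :
    (x : ℂ) + c * I ∈ closedStrip c₁ c₂ := ⟨by simpa using h₁, by simpa using h₂⟩

theorem integrable_horizontal {f : ℂ → ℂ} {c c₁ c₂ : ℝ} (h₁ : c₁ ≤ c) (h₂ : c ≤ c₂)
    (hf : ContinuousOn f (closedStrip c₁ c₂)) {C δ : ℝ} (hδ : 0 < δ)
    (hb : ∀ z ∈ closedStrip c₁ c₂, ‖f z‖ ≤ C * Real.exp (-δ * |z.re|)) :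
    Integrable (fun x : ℝ => f (x + c * I)) := by
  refine ((integrable_exp_neg_mul_abs hδ).const_mul C).mono' ?_ (.of_forall fun x => ?_)
  · exact (hf.comp_continuous (continuous_horizontal c)
      (horizontal_mem h₁ h₂)).aestronglyMeasurable
  · simpa using hb _ (horizontal_mem h₁ h₂ x)

theorem integral_horizontal_eq {f : ℂ → ℂ} {c₁ c₂ : ℝ} (hc : c₁ ≤ c₂)
    (hf : DifferentiableOn ℂ f (closedStrip c₁ c₂)) {C δ : ℝ} (hδ : 0 < δ)
    (hb : ∀ z ∈ closedStrip c₁ c₂, ‖f z‖ ≤ C * Real.exp (-δ * |z.re|)) :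
    ∫ x : ℝ, f (x + c₁ * I) = ∫ x : ℝ, f (x + c₂ * I) := by
  have h0 := tendsto_integral_sub_of_strip hc hf (tendsto_mul_exp_neg_mul hδ C)
    (fun R _ z hz h => by simpa [h] using hb z hz)
  have h1 := intervalIntegral_tendsto_integral
    (integrable_horizontal le_rfl hc hf.continuousOn hδ hb) tendsto_neg_atTop_atBot tendsto_id
  have h2 := intervalIntegral_tendsto_integral
    (integrable_horizontal hc le_rfl hf.continuousOn hδ hb) tendsto_neg_atTop_atBot tendsto_id
  exact sub_eq_zero.1 (tendsto_nhds_unique (h1.sub h2) h0)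

/-- The difference of the two reciprocals is 2ic/(x² + c²), an arctangent integrand, although
neither reciprocal is integrable by itself. -/
theorem tendsto_integral_inv_sub_inv {c : ℝ} (hc : 0 < c) :
    Tendsto (fun R : ℝ => ∫ x : ℝ in (-R)..R, ((x + (-c : ℝ) * I)⁻¹ - (x + c * I : ℂ)⁻¹)) atTop
      (𝓝 (2 * Real.pi * I)) := by
  have hne : ∀ x : ℝ, (x : ℂ) + c * I ≠ 0 := fun x h => by
    simpa [hc.ne'] using congrArg Complex.im h
  have hne' : ∀ x : ℝ, (x : ℂ) + (-c : ℝ) * I ≠ 0 := fun x h => by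
    simpa [hc.ne'] using congrArg Complex.im h
  have h : ∀ x : ℝ, ((x + (-c : ℝ) * I)⁻¹ - (x + c * I : ℂ)⁻¹) =
      (2 * I / c) * ((1 + (x / c) ^ 2)⁻¹ : ℝ) := by
    intro x
    have h1 := hne x
    have h2 := hne' x
    have hc' : (c : ℂ) ≠ 0 := by exact_mod_cast hc.ne'
    have h3 : (1 + ((x : ℂ) / c) ^ 2) = (x + c * I) * (x + (-c : ℝ) * I) / c ^ 2 := by
      field_simp
      push_cast
      linear_combination (c ^ 2 : ℂ) * I_sq
    push_cast at h2 h3 ⊢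
    rw [h3]
    rw [inv_sub_inv h2 h1, inv_div]
    field_simp
    ring
  simp_rw [h]
  have hi : Integrable (fun x : ℝ => (1 + (x / c) ^ 2)⁻¹) :=
    integrable_inv_one_add_sq.comp_div hc.ne'
  have hv : ∫ x : ℝ, (2 * I / c) * ((1 + (x / c) ^ 2)⁻¹ : ℝ) = 2 * Real.pi * I := by
    rw [integral_const_mul, integral_complex_ofReal,
      Measure.integral_comp_div (fun x => (1 + x ^ 2)⁻¹) c,
      integral_univ_inv_one_add_sq, abs_of_pos hc]
    have hc' : (c : ℂ) ≠ 0 := by exact_mod_cast hc.ne'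
    push_cast [smul_eq_mul]
    field_simp
  rw [← hv]
  exact intervalIntegral_tendsto_integral (hi.ofReal.const_mul (2 * I / c))
    tendsto_neg_atTop_atBot tendsto_id

/-- The residue theorem for a simple pole at `0` and two horizontal lines. -/
theorem integral_horizontal_sub_of_pole {k : ℂ → ℂ} {c : ℝ} (hc : 0 < c)
    (hk : DifferentiableOn ℂ k (closedStrip (-c) c)) {C δ : ℝ} (hδ : 0 < δ)
    (hb : ∀ z ∈ closedStrip (-c) c, ‖k z‖ ≤ C * Real.exp (-δ * |z.re|)) :
    (∫ x : ℝ, k (x + (-c : ℝ) * I) / (x + (-c : ℝ) * I)) - (∫ x : ℝ, k (x + c * I) / (x + c * I)) =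
      2 * Real.pi * I * k 0 := by
  have hcc : -c ≤ c := by linarith
  have hC : 0 ≤ C := by simpa using (norm_nonneg _).trans (hb 0 ⟨by simp [hc.le], by simp [hc.le]⟩)
  have hnhds : closedStrip (-c) c ∈ 𝓝 (0 : ℂ) := by
    have : IsOpen {z : ℂ | -c < z.im ∧ z.im < c} :=
      (isOpen_lt continuous_const continuous_im).inter (isOpen_lt continuous_im continuous_const)
    exact mem_of_superset (this.mem_nhds ⟨by simp [hc], by simp [hc]⟩) fun z hz => ⟨hz.1.le, hz.2.le⟩
  -- Subtracting k(0)/z removes the pole; the remainder (k(z) - k(0))/z is analytic across 0 but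
  -- decays only like 1/R.
  have hg := (Complex.differentiableOn_dslope hnhds).2 hk
  have hgv : ∀ z : ℂ, z ≠ 0 → dslope k 0 z = (k z - k 0) / z := fun z hz => by
    rw [dslope_of_ne _ hz, slope_def_field, sub_zero]
  have hne : ∀ (s : ℝ) (x : ℝ), s ≠ 0 → (x : ℂ) + s * I ≠ 0 := fun s x hs h => by
    simpa [hs] using congrArg Complex.im h
  have hB : Tendsto (fun R : ℝ => (C + ‖k 0‖) * R⁻¹) atTop (𝓝 0) := by
    simpa using tendsto_inv_atTop_zero.const_mul (C + ‖k 0‖)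
  have h0 := tendsto_integral_sub_of_strip hcc hg hB (by
    intro R hR z hz hzR
    have hzR' : R ≤ ‖z‖ := hzR ▸ abs_re_le_norm z
    have hz0 : z ≠ 0 := norm_pos_iff.1 (hR.trans_le hzR')
    rw [hgv z hz0, norm_div, div_eq_mul_inv]
    gcongr
    refine (norm_sub_le _ _).trans (add_le_add_left ((hb z hz).trans ?_) _)
    refine mul_le_of_le_one_right hC (Real.exp_le_one_iff.2 ?_)
    nlinarith [abs_nonneg z.re])
  have hint : ∀ s : ℝ, s ≠ 0 → -c ≤ s → s ≤ c →
      Integrable (fun x : ℝ => k (x + s * I) / (x + s * I)) := by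
    intro s hs h1 h2
    refine ((integrable_horizontal h1 h2 hk.continuousOn hδ hb).norm.mul_const |s|⁻¹).mono'
      ?_ (.of_forall fun x => ?_)
    · exact ((hk.continuousOn.comp_continuous (continuous_horizontal s) (horizontal_mem h1 h2)).div
        (continuous_horizontal s) fun x => hne s x hs).aestronglyMeasurable
    · rw [norm_div, div_eq_mul_inv]
      gcongr
      simpa using abs_im_le_norm ((x : ℂ) + s * I)
  have hm := hint (-c) (neg_ne_zero.2 hc.ne') le_rfl hcc
  have hp := hint c hc.ne' hcc le_rfl
  have h1 := intervalIntegral_tendsto_integral hm tendsto_neg_atTop_atBot tendsto_id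
  have h2 := intervalIntegral_tendsto_integral hp tendsto_neg_atTop_atBot tendsto_id
  have h3 := (tendsto_integral_inv_sub_inv hc).mul_const (k 0)
  have h4 := (h1.sub h2).sub h3
  rw [← sub_eq_zero]
  refine tendsto_nhds_unique h4 (h0.congr fun R => ?_)
  have hi : ∀ s : ℝ, s ≠ 0 →
      IntervalIntegrable (fun x : ℝ => (x + s * I : ℂ)⁻¹) volume (-R) R := fun s hs =>
    ((continuous_horizontal s).inv₀ fun x => hne s x hs).intervalIntegrable _ _
  have e : ∀ s : ℝ, s ≠ 0 → Integrable (fun x : ℝ => k (x + s * I) / (x + s * I)) →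
      ∫ x : ℝ in (-R)..R, dslope k 0 (x + s * I) =
      (∫ x : ℝ in (-R)..R, k (x + s * I) / (x + s * I)) -
        (∫ x : ℝ in (-R)..R, (x + s * I : ℂ)⁻¹) * k 0 := by
    intro s hs his
    rw [← intervalIntegral.integral_mul_const, ← intervalIntegral.integral_sub
      his.intervalIntegrable ((hi s hs).mul_const _)]
    refine intervalIntegral.integral_congr fun x _ => ?_
    simp only [hgv _ (hne s x hs)]
    rw [sub_div, div_eq_mul_inv (k 0), mul_comm (k 0)]
  rw [e (-c) (neg_ne_zero.2 hc.ne') hm, e c hc.ne' hp, intervalIntegral.integral_sub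
    (hi (-c) (neg_ne_zero.2 hc.ne')) (hi c hc.ne')]
  simp only [id]
  ring

/-! ### The kernel of the quantum dilogarithm -/

theorem exp_le_norm_sinh {w : ℂ} (hw : 1 ≤ |w.re|) : Real.exp |w.re| / 4 ≤ ‖sinh w‖ := by
  have h0 : Real.exp |w.re| - Real.exp (-|w.re|) ≤ ‖exp w - exp (-w)‖ := by
    rcases le_total 0 w.re with h | h
    · have := norm_sub_norm_le (exp w) (exp (-w))
      simpa [norm_exp, abs_of_nonneg h] using this
    · have := norm_sub_norm_le (exp (-w)) (exp w)
      rw [norm_sub_rev] at this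
      simpa [norm_exp, abs_of_nonpos h] using this
  have h1 : Real.exp (-|w.re|) ≤ Real.exp |w.re| / 2 := by
    have h2 : 2 ≤ Real.exp |w.re| := by
      have := Real.add_one_le_exp |w.re|
      linarith
    have h3 : Real.exp (-|w.re|) ≤ 1 := Real.exp_le_one_iff.2 (by linarith)
    linarith
  have h3 : ‖sinh w‖ = ‖exp w - exp (-w)‖ / 2 := by
    rw [sinh, norm_div]; simp
  rw [h3]
  linarith

theorem sinh_eq_zero_iff {w : ℂ} : sinh w = 0 ↔ ∃ k : ℤ, w = k * Real.pi * I := by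
  have h : sinh w = 0 ↔ sin (w * I) = 0 := by
    rw [sin_mul_I]; simp
  rw [h, sin_eq_zero_iff]
  constructor
  · rintro ⟨k, hk⟩
    refine ⟨-k, ?_⟩
    push_cast
    linear_combination (-I) * hk + w * I_sq
  · rintro ⟨k, rfl⟩
    refine ⟨-k, ?_⟩
    push_cast
    linear_combination (k * Real.pi : ℂ) * I_sq

/-- The entire function `sinh w / w`. -/
def sinhc : ℂ → ℂ := dslope sinh 0

theorem sinhc_zero : sinhc 0 = 1 := by
  rw [sinhc, dslope_same, Complex.deriv_sinh, cosh_zero]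

theorem mul_sinhc (w : ℂ) : w * sinhc w = sinh w := by
  have := sub_smul_dslope sinh 0 w
  simpa [sinhc, smul_eq_mul] using this

theorem differentiable_sinhc : Differentiable ℂ sinhc :=
  differentiableOn_univ.1 ((differentiableOn_dslope univ_mem).2 differentiable_sinh.differentiableOn)

/-- The zeros of sinh(yc) are y = iπk/c, with imaginary part kπ Re(1/c), so the first nonzero ones
lie on the boundary of the strip. -/
theorem sinh_mul_ne_zero {c y : ℂ} (hc : 0 < (c⁻¹).re) (hy : |y.im| < Real.pi * (c⁻¹).re)
    (hy0 : y ≠ 0) : sinh (y * c) ≠ 0 := by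
  have hc0 : c ≠ 0 := by rintro rfl; simp at hc
  rw [Ne, sinh_eq_zero_iff]
  rintro ⟨k, hk⟩
  have h1 : y = k * Real.pi * I * c⁻¹ := by rw [← hk]; field_simp
  have h2 : y.im = k * (Real.pi * (c⁻¹).re) := by
    rw [h1, mul_im]
    simp [mul_assoc]
  have h3 : k ≠ 0 := by
    rintro rfl
    exact hy0 (by simpa using h1)
  have h4 : (1 : ℝ) ≤ |(k : ℝ)| := by
    exact_mod_cast Int.one_le_abs h3
  have h5 : 0 < Real.pi * (c⁻¹).re := mul_pos Real.pi_pos hc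
  rw [h2, abs_mul, abs_of_pos h5] at hy
  nlinarith [Real.pi_pos, mul_pos Real.pi_pos hc]

theorem sinhc_mul_ne_zero {c y : ℂ} (hc : 0 < (c⁻¹).re) (hy : |y.im| < Real.pi * (c⁻¹).re) :
    sinhc (y * c) ≠ 0 := by
  intro h
  by_cases hy0 : y = 0
  · simp [hy0, sinhc_zero] at h
  · exact sinh_mul_ne_zero hc hy hy0 (by rw [← mul_sinhc, h, mul_zero])

theorem mem_closedStrip_neg {L : ℝ} {z : ℂ} : z ∈ closedStrip (-L) L ↔ |z.im| ≤ L := abs_le.symm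

theorem exists_bound_of_tail {K : ℂ → ℂ} {c₁ c₂ X C δ : ℝ}
    (hK : ContinuousOn K (closedStrip c₁ c₂))
    (h : ∀ z ∈ closedStrip c₁ c₂, X ≤ |z.re| → ‖K z‖ ≤ C * Real.exp (-δ * |z.re|)) :
    ∃ C' : ℝ, 0 ≤ C' ∧ ∀ z ∈ closedStrip c₁ c₂, ‖K z‖ ≤ C' * Real.exp (-δ * |z.re|) := by
  have hcomp : IsCompact (Icc (-X) X ×ℂ Icc c₁ c₂) := isCompact_Icc.reProdIm isCompact_Icc
  have hcont : ContinuousOn (fun z => K z * Real.exp (δ * |z.re|)) (Icc (-X) X ×ℂ Icc c₁ c₂) :=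
    (hK.mono fun z hz => hz.2).mul (by fun_prop)
  obtain ⟨M, hM⟩ := hcomp.exists_bound_of_continuousOn hcont
  refine ⟨max 0 (max M C), le_max_left _ _, fun z hz => ?_⟩
  rcases le_total X |z.re| with hX | hX
  · exact (h z hz hX).trans (by gcongr; exact (le_max_right _ _).trans (le_max_right _ _))
  · have h1 := hM z ⟨abs_le.1 hX, hz⟩
    rw [norm_mul, norm_real, Real.norm_of_nonneg (Real.exp_pos _).le] at h1
    have h2 : ‖K z‖ ≤ M * Real.exp (-δ * |z.re|) := by
      rw [neg_mul, Real.exp_neg, ← div_eq_mul_inv, le_div_iff₀ (Real.exp_pos _)]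
      exact h1
    exact h2.trans (by gcongr; exact (le_max_left _ _).trans (le_max_right _ _))

/-- A linear factor is absorbed into an arbitrarily small exponential rate; this is why the decay
bounds below hold only for rates strictly below the optimal one. -/
theorem le_exp_mul_abs {η : ℝ} (hη : 0 < η) {L : ℝ} (hL : 0 ≤ L) (x : ℝ) :
    |x| + L ≤ (η⁻¹ + L) * Real.exp (η * |x|) := by
  have h1 := Real.add_one_le_exp (η * |x|)
  have h2 : 1 ≤ Real.exp (η * |x|) := Real.one_le_exp (by positivity)
  have h3 : |x| = η⁻¹ * (η * |x|) := by field_simp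
  have h4 : η⁻¹ * (η * |x|) ≤ η⁻¹ * Real.exp (η * |x|) := by gcongr; linarith
  nlinarith

/-- Here 1/sinhc(w) = w/sinh(w): the hyperbolic sine gives decay at rate Re c for large |Re z|, and
the factor w costs the margin Re c - δ. The compact middle part is covered by continuity. -/
theorem exists_bound_inv_sinhc {c : ℂ} (hc : 0 < c.re) (hc' : 0 < (c⁻¹).re) {L δ : ℝ}
    (hL : 0 ≤ L) (hL' : L < Real.pi * (c⁻¹).re) (hδ : δ < c.re) :
    ∃ C : ℝ, 0 ≤ C ∧ ∀ z ∈ closedStrip (-L) L,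
      ‖(sinhc (z * c))⁻¹‖ ≤ C * Real.exp (-δ * |z.re|) := by
  have hη : 0 < c.re - δ := by linarith
  refine exists_bound_of_tail (X := (1 + L * |c.im|) / c.re)
    (C := ((c.re - δ)⁻¹ + L) * ‖c‖ * 4 * Real.exp (L * |c.im|)) ?_ ?_
  · refine ContinuousOn.inv₀ ?_ fun z hz =>
      sinhc_mul_ne_zero hc' ((mem_closedStrip_neg.1 hz).trans_lt hL')
    exact (differentiable_sinhc.continuous.comp (by fun_prop)).continuousOn
  · intro z hz hX
    rw [div_le_iff₀ hc] at hX
    have hz' := mem_closedStrip_neg.1 hz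
    have h1 : |z.re| * c.re - L * |c.im| ≤ |(z * c).re| := by
      rw [mul_re]
      have h2 := abs_sub_abs_le_abs_sub (z.re * c.re) (z.im * c.im)
      rw [abs_mul, abs_mul, abs_of_pos hc] at h2
      have h3 : |z.im| * |c.im| ≤ L * |c.im| := by gcongr
      linarith
    have h4 := exp_le_norm_sinh (w := z * c) (by linarith)
    have h5 : Real.exp (|z.re| * c.re - L * |c.im|) / 4 ≤ ‖sinh (z * c)‖ :=
      le_trans (by gcongr) h4
    have hs : 0 < ‖sinh (z * c)‖ := lt_of_lt_of_le (by positivity) h5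
    have h6 : ‖(sinhc (z * c))⁻¹‖ = ‖z‖ * ‖c‖ * ‖sinh (z * c)‖⁻¹ := by
      have h7 : ‖z * c‖ * ‖sinhc (z * c)‖ = ‖sinh (z * c)‖ := by rw [← norm_mul, mul_sinhc]
      have h8 : ‖sinhc (z * c)‖ ≠ 0 := by
        intro h; rw [h, mul_zero] at h7; exact hs.ne h7
      rw [norm_inv, ← h7, ← norm_mul z c]
      have h9 : ‖z * c‖ ≠ 0 := by
        intro h; rw [h, zero_mul] at h7; exact hs.ne h7
      field_simp
    have h7 : ‖z‖ ≤ ((c.re - δ)⁻¹ + L) * Real.exp ((c.re - δ) * |z.re|) :=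
      ((norm_le_abs_re_add_abs_im z).trans (by gcongr)).trans (le_exp_mul_abs hη hL _)
    have h8 : ‖sinh (z * c)‖⁻¹ ≤ 4 * Real.exp (L * |c.im|) * Real.exp (-c.re * |z.re|) := by
      refine (inv_anti₀ (by positivity) h5).trans (le_of_eq ?_)
      rw [inv_div, div_eq_mul_inv, ← Real.exp_neg, mul_assoc, ← Real.exp_add]
      ring_nf
    rw [h6]
    calc ‖z‖ * ‖c‖ * ‖sinh (z * c)‖⁻¹
        ≤ (((c.re - δ)⁻¹ + L) * Real.exp ((c.re - δ) * |z.re|)) * ‖c‖ *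
          (4 * Real.exp (L * |c.im|) * Real.exp (-c.re * |z.re|)) := by gcongr
      _ = ((c.re - δ)⁻¹ + L) * ‖c‖ * 4 * Real.exp (L * |c.im|) *
          (Real.exp ((c.re - δ) * |z.re|) * Real.exp (-c.re * |z.re|)) := by ring
      _ = _ := by rw [← Real.exp_add]; ring_nf

/-! ### Fourier–Laplace integrals over a horizontal line -/

/-- The integral of `e^{-2izy} K(y)` over the line `Im y = ε`. -/
def lineIntegral (ε : ℝ) (K : ℂ → ℂ) (z : ℂ) : ℂ :=
  ∫ x : ℝ, exp (-2 * I * z * (x + ε * I)) * K (x + ε * I)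

theorem norm_exp_phase (z y : ℂ) :
    ‖exp (-2 * I * z * y)‖ = Real.exp (2 * (z.re * y.im + z.im * y.re)) := by
  rw [norm_exp]
  congr 1
  simp [mul_re, mul_im]
  ring

/-- A kernel, continuous and exponentially decaying on the line `Im y = ε`. -/
structure LineKernel (ε δ : ℝ) (K : ℂ → ℂ) : Prop where
  cont : Continuous fun x : ℝ => K (x + ε * I)
  bound : ∃ C : ℝ, 0 ≤ C ∧ ∀ x : ℝ, ‖K (x + ε * I)‖ ≤ C * Real.exp (-δ * |x|)

theorem norm_phase_le {ε τ : ℝ} {z : ℂ} (hz : |z.im| ≤ τ) (x : ℝ) :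
    ‖exp (-2 * I * z * (x + ε * I))‖ ≤ Real.exp (2 * ε * z.re) * Real.exp (2 * τ * |x|) := by
  rw [norm_exp_phase, ← Real.exp_add]
  refine Real.exp_le_exp.2 ?_
  have h : z.im * x ≤ τ * |x| := by
    refine (le_abs_self _).trans ?_
    rw [abs_mul]
    gcongr
  simp only [add_im, ofReal_im, mul_im, ofReal_re, I_im, mul_one, I_re, mul_zero, add_zero,
    zero_add, add_re, mul_re, sub_self]
  linarith

theorem LineKernel.integrable {ε δ : ℝ} {K : ℂ → ℂ} (hK : LineKernel ε δ K) {z : ℂ}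
    (hz : 2 * |z.im| < δ) :
    Integrable fun x : ℝ => exp (-2 * I * z * (x + ε * I)) * K (x + ε * I) := by
  obtain ⟨C, hC, hb⟩ := hK.bound
  refine ((integrable_exp_neg_mul_abs (sub_pos.2 hz)).const_mul
    (Real.exp (2 * ε * z.re) * C)).mono' ?_ (.of_forall fun x => ?_)
  · exact (Continuous.mul (by fun_prop) hK.cont).aestronglyMeasurable
  · rw [norm_mul]
    refine (mul_le_mul (norm_phase_le le_rfl x) (hb x) (norm_nonneg _) (by positivity)).trans
      (le_of_eq ?_)
    rw [show -(δ - 2 * |z.im|) * |x| = 2 * |z.im| * |x| + -δ * |x| by ring, Real.exp_add]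
    ring

theorem LineKernel.norm_lineIntegral_le {ε δ τ : ℝ} {K : ℂ → ℂ} (hK : LineKernel ε δ K)
    (hτ : 2 * τ < δ) :
    ∃ C : ℝ, 0 ≤ C ∧ ∀ z : ℂ, |z.im| ≤ τ → ‖lineIntegral ε K z‖ ≤ C * Real.exp (2 * ε * z.re) := by
  obtain ⟨C, hC, hb⟩ := hK.bound
  refine ⟨C * ∫ x : ℝ, Real.exp (-(δ - 2 * τ) * |x|),
    mul_nonneg hC (integral_nonneg fun x => (Real.exp_pos _).le), fun z hz => ?_⟩
  rw [lineIntegral]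
  refine (norm_integral_le_of_norm_le ((integrable_exp_neg_mul_abs (sub_pos.2 hτ)).const_mul
    (Real.exp (2 * ε * z.re) * C)) (.of_forall fun x => ?_)).trans (le_of_eq ?_)
  · rw [norm_mul]
    refine (mul_le_mul (norm_phase_le hz x) (hb x) (norm_nonneg _) (by positivity)).trans
      (le_of_eq ?_)
    rw [show -(δ - 2 * τ) * |x| = 2 * τ * |x| + -δ * |x| by ring, Real.exp_add]
    ring
  · rw [integral_const_mul]; ring

theorem LineKernel.mul_id {ε δ δ' : ℝ} {K : ℂ → ℂ} (hK : LineKernel ε δ K) (hδ : δ' < δ) (c : ℂ) :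
    LineKernel ε δ' fun y => c * y * K y := by
  obtain ⟨C, hC, hb⟩ := hK.bound
  refine ⟨Continuous.mul (by fun_prop) hK.cont,
    ‖c‖ * ((δ - δ')⁻¹ + |ε|) * C, ?_, fun x => ?_⟩
  · have := sub_pos.2 hδ
    positivity
  · rw [norm_mul, norm_mul]
    have h1 : ‖(x : ℂ) + ε * I‖ ≤ ((δ - δ')⁻¹ + |ε|) * Real.exp ((δ - δ') * |x|) := by
      refine le_trans ?_ (le_exp_mul_abs (sub_pos.2 hδ) (abs_nonneg ε) x)
      simpa using norm_le_abs_re_add_abs_im ((x : ℂ) + ε * I)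
    calc _ ≤ ‖c‖ * (((δ - δ')⁻¹ + |ε|) * Real.exp ((δ - δ') * |x|)) *
          (C * Real.exp (-δ * |x|)) := by gcongr; exact hb x
      _ = ‖c‖ * ((δ - δ')⁻¹ + |ε|) * C *
          (Real.exp ((δ - δ') * |x|) * Real.exp (-δ * |x|)) := by ring
      _ = _ := by rw [← Real.exp_add]; ring_nf

/-- Differentiation under the integral sign. The room between 2|Im z| and δ is divided into a
neighbourhood of z where the phase is bounded uniformly, a loss for the extra factor y, and a
positive rate left for the dominating function. -/
theorem LineKernel.hasDerivAt {ε δ : ℝ} {K : ℂ → ℂ} (hK : LineKernel ε δ K) {z : ℂ}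
    (hz : 2 * |z.im| < δ) :
    HasDerivAt (lineIntegral ε K) (lineIntegral ε (fun y => -2 * I * y * K y) z) z := by
  obtain ⟨τ, h1, h2⟩ : ∃ τ, |z.im| < τ ∧ 2 * τ < δ :=
    ⟨(|z.im| + δ / 2) / 2, by linarith, by linarith⟩
  obtain ⟨δ', h3, h4⟩ := exists_between h2
  obtain ⟨C, hC, hb⟩ := (hK.mul_id h4 (-2 * I)).bound
  set s : Set ℂ := {w | |w.im| < τ ∧ |w.re| < |z.re| + 1} with hs
  have hs_nhds : s ∈ 𝓝 z :=
    ((isOpen_lt continuous_im.abs continuous_const).inter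
      (isOpen_lt continuous_re.abs continuous_const)).mem_nhds ⟨h1, by simp⟩
  refine (hasDerivAt_integral_of_dominated_loc_of_deriv_le
    (F := fun w x => exp (-2 * I * w * (x + ε * I)) * K (x + ε * I))
    (F' := fun w x => exp (-2 * I * w * (x + ε * I)) * (-2 * I * (x + ε * I) * K (x + ε * I)))
    (bound := fun x => (Real.exp (2 * |ε| * (|z.re| + 1)) * C) * Real.exp (-(δ' - 2 * τ) * |x|))
    hs_nhds (.of_forall fun w => ?_) (hK.integrable hz) ?_ (.of_forall fun x w hw => ?_)
    ((integrable_exp_neg_mul_abs (sub_pos.2 h3)).const_mul _) (.of_forall fun x w _ => ?_)).2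
  · exact (Continuous.mul (by fun_prop) hK.cont).aestronglyMeasurable
  · exact (Continuous.mul (by fun_prop) (hK.mul_id h4 (-2 * I)).cont).aestronglyMeasurable
  · rw [norm_mul]
    refine (mul_le_mul (norm_phase_le hw.1.le x) (hb x) (norm_nonneg _) (by positivity)).trans ?_
    have h5 : Real.exp (2 * ε * w.re) ≤ Real.exp (2 * |ε| * (|z.re| + 1)) := by
      refine Real.exp_le_exp.2 ?_
      have : ε * w.re ≤ |ε| * (|z.re| + 1) := by
        refine (le_abs_self _).trans ?_
        rw [abs_mul]
        gcongr
        exact hw.2.le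
      linarith
    calc _ ≤ Real.exp (2 * |ε| * (|z.re| + 1)) * Real.exp (2 * τ * |x|) *
          (C * Real.exp (-δ' * |x|)) := by gcongr
      _ = (Real.exp (2 * |ε| * (|z.re| + 1)) * C) *
          (Real.exp (2 * τ * |x|) * Real.exp (-δ' * |x|)) := by ring
      _ = _ := by rw [← Real.exp_add]; ring_nf
  · have h6 : HasDerivAt (fun w : ℂ => -2 * I * w * (x + ε * I)) (-2 * I * (x + ε * I)) w := by
      simpa using ((hasDerivAt_id w).const_mul (-2 * I)).mul_const ((x : ℂ) + ε * I)
    exact (h6.cexp.mul_const (K (x + ε * I))).congr_deriv (by ring)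

/-! ### The quantum dilogarithm -/

section Dilogarithm

variable {b : ℂ}

theorem inv_re_pos (hb : 0 < b.re) : 0 < (b⁻¹).re := by
  rw [inv_re]
  have : b ≠ 0 := by rintro rfl; simp at hb
  exact div_pos hb (normSq_pos.2 this)

theorem contourHeight_pos (hb : 0 < b.re) : 0 < contourHeight b := lt_min hb (inv_re_pos hb)

theorem contourHeight_le_re (b : ℂ) : contourHeight b ≤ b.re := min_le_left _ _

theorem contourHeight_le_inv_re (b : ℂ) : contourHeight b ≤ (b⁻¹).re := min_le_right _ _

theorem lt_pi_mul {s : ℝ} (hs : 0 < s) : s < Real.pi * s := by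
  nlinarith [Real.pi_gt_three]

/-- The function `y² / (sinh (y b) sinh (y / b))`, regular at `y = 0`. -/
def regKernel (b y : ℂ) : ℂ := (sinhc (y * b))⁻¹ * (sinhc (y * b⁻¹))⁻¹

theorem sinhc_neg (w : ℂ) : sinhc (-w) = sinhc w := by
  by_cases hw : w = 0
  · simp [hw]
  · have h1 := mul_sinhc w
    have h2 := mul_sinhc (-w)
    rw [sinh_neg, ← h1] at h2
    have : w * (sinhc (-w) - sinhc w) = 0 := by linear_combination -h2
    exact sub_eq_zero.1 ((mul_eq_zero.1 this).resolve_left hw)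

theorem regKernel_neg (b y : ℂ) : regKernel b (-y) = regKernel b y := by
  simp only [regKernel, neg_mul, sinhc_neg]

theorem regKernel_zero (b : ℂ) : regKernel b 0 = 1 := by simp [regKernel, sinhc_zero]

theorem differentiableOn_inv_sinhc {c : ℂ} (hc : 0 < (c⁻¹).re) {L : ℝ}
    (hL : L < Real.pi * (c⁻¹).re) :
    DifferentiableOn ℂ (fun y => (sinhc (y * c))⁻¹) (closedStrip (-L) L) :=
  (differentiable_sinhc.comp (differentiable_id.mul_const c)).differentiableOn.inv fun _ hy =>
    sinhc_mul_ne_zero hc ((mem_closedStrip_neg.1 hy).trans_lt hL)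

theorem differentiableOn_regKernel (hb : 0 < b.re) :
    DifferentiableOn ℂ (regKernel b) (closedStrip (-contourHeight b) (contourHeight b)) := by
  refine (differentiableOn_inv_sinhc (inv_re_pos hb) ?_).mul
    (differentiableOn_inv_sinhc (c := b⁻¹) (by rwa [inv_inv]) ?_)
  · exact (contourHeight_le_inv_re b).trans_lt (lt_pi_mul (inv_re_pos hb))
  · rw [inv_inv]
    exact (contourHeight_le_re b).trans_lt (lt_pi_mul hb)

theorem exists_bound_regKernel (hb : 0 < b.re) {δ : ℝ} (hδ : δ < b.re + (b⁻¹).re) :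
    ∃ C : ℝ, 0 ≤ C ∧ ∀ z ∈ closedStrip (-contourHeight b) (contourHeight b),
      ‖regKernel b z‖ ≤ C * Real.exp (-δ * |z.re|) := by
  set η := (b.re + (b⁻¹).re - δ) / 2 with hη
  have hε := (contourHeight_pos hb).le
  obtain ⟨C₁, h1, h1'⟩ := exists_bound_inv_sinhc hb (inv_re_pos hb) hε
    ((contourHeight_le_inv_re b).trans_lt (lt_pi_mul (inv_re_pos hb)))
    (show b.re - η < b.re by linarith)
  obtain ⟨C₂, h2, h2'⟩ := exists_bound_inv_sinhc (c := b⁻¹) (inv_re_pos hb) (by rwa [inv_inv]) hε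
    (by rw [inv_inv]; exact (contourHeight_le_re b).trans_lt (lt_pi_mul hb))
    (show (b⁻¹).re - η < (b⁻¹).re by linarith)
  refine ⟨C₁ * C₂, by positivity, fun z hz => ?_⟩
  rw [regKernel, norm_mul]
  refine (mul_le_mul (h1' z hz) (h2' z hz) (norm_nonneg _) (by positivity)).trans (le_of_eq ?_)
  rw [mul_mul_mul_comm, ← Real.exp_add]
  congr 2
  rw [hη]
  ring

theorem horizontal_ne_zero {s : ℝ} (hs : s ≠ 0) (x : ℝ) : (x : ℂ) + s * I ≠ 0 := fun h => by
  simpa [hs] using congrArg Complex.im h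

/-- The kernel `1 / (sinh (y b) sinh (y / b) y)`. -/
def dilogKernel (b y : ℂ) : ℂ := regKernel b y / y ^ 3

theorem lineKernel_dilogKernel (hb : 0 < b.re) {δ : ℝ} (hδ : δ < b.re + (b⁻¹).re) :
    LineKernel (contourHeight b) δ (dilogKernel b) := by
  have hε := contourHeight_pos hb
  have hmem := horizontal_mem (c := contourHeight b) (c₁ := -contourHeight b) (by linarith) le_rfl
  obtain ⟨C, hC, h⟩ := exists_bound_regKernel hb hδ
  refine ⟨?_, C * (contourHeight b ^ 3)⁻¹, by positivity, fun x => ?_⟩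
  · exact ((differentiableOn_regKernel hb).continuousOn.comp_continuous
      (continuous_horizontal _) hmem).div (by fun_prop) fun x =>
        pow_ne_zero _ (horizontal_ne_zero hε.ne' x)
  · have h1 := h _ (hmem x)
    have h2 : contourHeight b ≤ ‖(x : ℂ) + contourHeight b * I‖ := by
      refine le_trans ?_ (abs_im_le_norm _)
      simp [le_abs_self]
    rw [dilogKernel, norm_div, norm_pow, div_eq_mul_inv]
    simp only [add_re, ofReal_re, mul_re, I_re, mul_zero, ofReal_im, I_im, mul_one, sub_self,
      add_zero] at h1
    calc _ ≤ C * Real.exp (-δ * |x|) * (contourHeight b ^ 3)⁻¹ := by gcongr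
      _ = _ := by ring

/-- The integral in the exponent of the quantum dilogarithm. -/
def dilogExponent (b z : ℂ) : ℂ := lineIntegral (contourHeight b) (dilogKernel b) z

theorem qdilog_eq (hb : 0 < b.re) (z : ℂ) : qdilog b z = exp (-(1 / 4) * dilogExponent b z) := by
  have hb0 : b ≠ 0 := by rintro rfl; simp at hb
  rw [qdilog, dilogExponent, lineIntegral]
  congr 2
  refine integral_congr_ae (.of_forall fun x => ?_)
  simp only
  set y : ℂ := x + contourHeight b * I
  rw [div_eq_mul_inv _ b, ← mul_sinhc (y * b), ← mul_sinhc (y * b⁻¹), dilogKernel, regKernel,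
    div_eq_mul_inv, div_eq_mul_inv, ← mul_inv, ← mul_inv]
  congr 2
  field_simp

theorem qdilog_ne_zero (hb : 0 < b.re) (z : ℂ) : qdilog b z ≠ 0 := by
  rw [qdilog_eq hb]
  exact exp_ne_zero _

/-- The first derivative of the exponent. -/
def dilogExponent₁ (b z : ℂ) : ℂ :=
  lineIntegral (contourHeight b) (fun y => -2 * I * y * dilogKernel b y) z

/-- The second derivative of the exponent. -/
def dilogExponent₂ (b z : ℂ) : ℂ :=
  lineIntegral (contourHeight b) (fun y => -2 * I * y * (-2 * I * y * dilogKernel b y)) z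

theorem hasDerivAt_dilogExponent (hb : 0 < b.re) {z : ℂ} (hz : 2 * |z.im| < b.re + (b⁻¹).re) :
    HasDerivAt (dilogExponent b) (dilogExponent₁ b z) z := by
  obtain ⟨δ, h1, h2⟩ := exists_between hz
  exact (lineKernel_dilogKernel hb h2).hasDerivAt h1

theorem hasDerivAt_dilogExponent₁ (hb : 0 < b.re) {z : ℂ} (hz : 2 * |z.im| < b.re + (b⁻¹).re) :
    HasDerivAt (dilogExponent₁ b) (dilogExponent₂ b z) z := by
  obtain ⟨δ, h1, h2⟩ := exists_between hz
  obtain ⟨δ', h3, h4⟩ := exists_between h2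
  exact ((lineKernel_dilogKernel hb h4).mul_id h3 (-2 * I)).hasDerivAt h1

theorem differentiableAt_qdilog (hb : 0 < b.re) {z : ℂ} (hz : 2 * |z.im| < b.re + (b⁻¹).re) :
    DifferentiableAt ℂ (qdilog b) z := by
  have : qdilog b = fun z => exp (-(1 / 4) * dilogExponent b z) := funext (qdilog_eq hb)
  rw [this]
  exact ((hasDerivAt_dilogExponent hb hz).differentiableAt.const_mul _).cexp

theorem norm_phase_le_of_mem {L : ℝ} {z y : ℂ} (hy : y ∈ closedStrip (-L) L) :
    ‖exp (-2 * I * z * y)‖ ≤ Real.exp (2 * L * |z.re|) * Real.exp (2 * |z.im| * |y.re|) := by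
  rw [norm_exp_phase, ← Real.exp_add]
  refine Real.exp_le_exp.2 ?_
  have h1 : z.re * y.im ≤ L * |z.re| := by
    refine (le_abs_self _).trans ?_
    rw [abs_mul, mul_comm]
    gcongr
    exact mem_closedStrip_neg.1 hy
  have h2 : z.im * y.re ≤ |z.im| * |y.re| := (le_abs_self _).trans (abs_mul _ _).le
  linarith

/-! #### The inversion relation -/

/-- Two z-derivatives bring down (-2iy)² = -4y² and lower the triple pole of the kernel at 0 to a
simple one. This is why the inversion relation is first proved for the second derivative. -/
theorem kernel_reduce {y : ℂ} (hy : y ≠ 0) (r : ℂ) :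
    -2 * I * y * (-2 * I * y * (r / y ^ 3)) = -4 * (r / y) := by
  have h : r / y ^ 3 * (y * y) = r / y := by field_simp
  linear_combination (4 * I ^ 2) * h + 4 * (r / y) * I_sq

/-- As `regKernel` is even, the substitution y ↦ -y turns the integral for -z into the integral for
z over the contour below 0. The sum is then a contour difference around a simple pole, 4 · 2πi times
the residue 1. -/
theorem dilogExponent₂_add_neg (hb : 0 < b.re) {z : ℂ} (hz : 2 * |z.im| < b.re + (b⁻¹).re) :
    dilogExponent₂ b z + dilogExponent₂ b (-z) = 8 * Real.pi * I := by
  have hε := contourHeight_pos hb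
  obtain ⟨δ, h1, h2⟩ := exists_between hz
  obtain ⟨C, hC, hbd⟩ := exists_bound_regKernel hb h2
  set k : ℂ → ℂ := fun y => exp (-2 * I * z * y) * regKernel b y with hk
  have key := integral_horizontal_sub_of_pole (k := k) hε
    (DifferentiableOn.mul (by fun_prop) (differentiableOn_regKernel hb)) (sub_pos.2 h1)
    (C := Real.exp (2 * contourHeight b * |z.re|) * C) (fun y hy => by
      rw [hk, norm_mul]
      refine (mul_le_mul (norm_phase_le_of_mem hy) (hbd y hy) (norm_nonneg _)
        (by positivity)).trans (le_of_eq ?_)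
      rw [mul_mul_mul_comm, ← Real.exp_add]
      ring_nf)
  have hk0 : k 0 = 1 := by simp [hk, regKernel_zero]
  have e1 : dilogExponent₂ b z =
      -4 * ∫ x : ℝ, k (x + contourHeight b * I) / (x + contourHeight b * I) := by
    rw [dilogExponent₂, lineIntegral, ← integral_const_mul]
    refine integral_congr_ae (.of_forall fun x => ?_)
    have hne := horizontal_ne_zero hε.ne' x
    simp only [hk, dilogKernel]
    rw [kernel_reduce hne]
    ring
  have e2 : dilogExponent₂ b (-z) = 4 * ∫ x : ℝ, k (x + (-contourHeight b : ℝ) * I) /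
      (x + (-contourHeight b : ℝ) * I) := by
    rw [dilogExponent₂, lineIntegral, ← integral_const_mul, ← integral_neg_eq_self]
    refine integral_congr_ae (.of_forall fun x => ?_)
    have hne := horizontal_ne_zero (neg_ne_zero.2 hε.ne') x
    simp only [hk, dilogKernel]
    have hy : ((-x : ℝ) : ℂ) + contourHeight b * I = -(x + (-contourHeight b : ℝ) * I) := by
      push_cast; ring
    rw [hy, regKernel_neg]
    set y : ℂ := x + (-contourHeight b : ℝ) * I
    rw [show -2 * I * -z * -y = -2 * I * z * y by ring, kernel_reduce (neg_ne_zero.2 hne)]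
    ring_nf
  rw [e1, e2]
  rw [hk0] at key
  linear_combination 4 * key

theorem isOpen_symmetric_strip (s : ℝ) : IsOpen {z : ℂ | 2 * |z.im| < s} :=
  isOpen_lt (continuous_const.mul continuous_im.abs) continuous_const

theorem isPreconnected_symmetric_strip (s : ℝ) : IsPreconnected {z : ℂ | 2 * |z.im| < s} := by
  have : {z : ℂ | 2 * |z.im| < s} = imLm ⁻¹' Ioo (-(s / 2)) (s / 2) := by
    ext z
    simp only [mem_ofPred_eq, mem_preimage, mem_Ioo, imLm_coe, ← abs_lt]
    constructor <;> intro h <;> linarith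
  rw [this]
  exact ((convex_Ioo _ _).linear_preimage imLm).isPreconnected

theorem dilogExponent₁_sub_neg (hb : 0 < b.re) {z : ℂ} (hz : 2 * |z.im| < b.re + (b⁻¹).re) :
    dilogExponent₁ b z - dilogExponent₁ b (-z) = 8 * Real.pi * I * z := by
  have hd : ∀ w ∈ {z : ℂ | 2 * |z.im| < b.re + (b⁻¹).re}, HasDerivAt
      (fun w => dilogExponent₁ b w - dilogExponent₁ b (-w) - 8 * Real.pi * I * w) 0 w := by
    intro w hw
    have h1 := hasDerivAt_dilogExponent₁ hb hw
    have h2 := (hasDerivAt_dilogExponent₁ hb (z := -w) (by simpa using hw)).comp w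
      (hasDerivAt_neg w)
    refine ((h1.sub h2).sub ((hasDerivAt_id w).const_mul (8 * Real.pi * I))).congr_deriv ?_
    linear_combination dilogExponent₂_add_neg hb hw
  have h0 := (isOpen_symmetric_strip _).is_const_of_deriv_eq_zero
    (isPreconnected_symmetric_strip _) (fun w hw => (hd w hw).differentiableAt.differentiableWithinAt)
    (fun w hw => (hd w hw).deriv) hz (y := 0)
    (by simpa using add_pos hb (inv_re_pos hb))
  simp only [neg_zero, sub_self, mul_zero] at h0
  exact sub_eq_zero.1 h0

/-- Second integration of the relation for the second derivative; the constant is fixed at z = 0. It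
yields φ_b(z) φ_b(-z) = φ_b(0)² e^{-πiz²} after exponentiation. -/
theorem dilogExponent_add_neg (hb : 0 < b.re) {z : ℂ} (hz : 2 * |z.im| < b.re + (b⁻¹).re) :
    dilogExponent b z + dilogExponent b (-z) = 4 * Real.pi * I * z ^ 2 + 2 * dilogExponent b 0 := by
  have hd : ∀ w ∈ {z : ℂ | 2 * |z.im| < b.re + (b⁻¹).re}, HasDerivAt
      (fun w => dilogExponent b w + dilogExponent b (-w) - 4 * Real.pi * I * w ^ 2) 0 w := by
    intro w hw
    have h1 := hasDerivAt_dilogExponent hb hw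
    have h2 := (hasDerivAt_dilogExponent hb (z := -w) (by simpa using hw)).comp w
      (hasDerivAt_neg w)
    refine ((h1.add h2).sub ((hasDerivAt_pow 2 w).const_mul (4 * Real.pi * I))).congr_deriv ?_
    have := dilogExponent₁_sub_neg hb hw
    push_cast
    linear_combination this
  have h0 := (isOpen_symmetric_strip _).is_const_of_deriv_eq_zero
    (isPreconnected_symmetric_strip _) (fun w hw => (hd w hw).differentiableAt.differentiableWithinAt)
    (fun w hw => (hd w hw).deriv) hz (y := 0)
    (by simpa using add_pos hb (inv_re_pos hb))
  simp only [neg_zero] at h0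
  linear_combination h0

/-- For Re z ≤ 0 the raised contour contributes e^{2ε Re z} ≤ 1. For Re z ≥ 0 the inversion relation
reflects z to -z, at the price of Re(4πiz²) = -8π Im z Re z, which grows linearly in the strip and
vanishes on the real line. -/
theorem exists_dilogExponent_re_le (hb : 0 < b.re) {τ : ℝ} (hτ : 2 * τ < b.re + (b⁻¹).re) :
    ∃ M : ℝ, ∀ z : ℂ, |z.im| ≤ τ → |(dilogExponent b z).re| ≤ M + 8 * Real.pi * τ * |z.re| := by
  obtain ⟨δ, h1, h2⟩ := exists_between hτ
  obtain ⟨C, hC, hbd⟩ := (lineKernel_dilogKernel hb h2).norm_lineIntegral_le h1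
  have hneg : ∀ z : ℂ, |z.im| ≤ τ → z.re ≤ 0 → |(dilogExponent b z).re| ≤ C := by
    intro z hz hz0
    refine (abs_re_le_norm _).trans ((hbd z hz).trans (mul_le_of_le_one_right hC ?_))
    refine Real.exp_le_one_iff.2 ?_
    nlinarith [contourHeight_pos hb]
  refine ⟨C + 2 * ‖dilogExponent b 0‖, fun z hz => ?_⟩
  have hτ0 := (abs_nonneg _).trans hz
  have hp := Real.pi_pos
  have hn := norm_nonneg (dilogExponent b 0)
  rcases le_total z.re 0 with h | h
  · have := hneg z hz h
    have : 0 ≤ 8 * Real.pi * τ * |z.re| := by positivity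
    linarith
  · have h3 := hneg (-z) (by simpa using hz) (by simpa using h)
    have h4 := dilogExponent_add_neg hb (z := z) (by linarith)
    have h5 := congrArg Complex.re h4
    have h6 : (4 * Real.pi * I * z ^ 2 : ℂ).re = -(8 * Real.pi * (z.im * z.re)) := by
      rw [pow_two]
      simp [mul_re, mul_im]
      ring
    rw [add_re, add_re, h6] at h5
    have h7 : (2 * dilogExponent b 0).re = 2 * (dilogExponent b 0).re := by simp
    rw [h7] at h5
    have h8 : |z.im * z.re| ≤ τ * |z.re| := by rw [abs_mul]; gcongr
    have h9 := abs_re_le_norm (dilogExponent b 0)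
    have h10 : |8 * Real.pi * (z.im * z.re)| ≤ 8 * Real.pi * (τ * |z.re|) := by
      rw [abs_mul, abs_of_pos (by positivity : 0 < 8 * Real.pi)]; gcongr
    rw [abs_le] at h3 h9 h10 ⊢
    constructor <;> linarith

theorem norm_qdilog (hb : 0 < b.re) (z : ℂ) :
    ‖qdilog b z‖ = Real.exp (-(1 / 4) * (dilogExponent b z).re) := by
  rw [qdilog_eq hb, norm_exp]
  congr 1
  simp

theorem exists_norm_qdilog_le (hb : 0 < b.re) {τ : ℝ} (hτ : 2 * τ < b.re + (b⁻¹).re) :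
    ∃ C A : ℝ, 0 ≤ C ∧ ∀ z : ℂ, |z.im| ≤ τ → ‖qdilog b z‖ ≤ C * Real.exp (A * |z.re|) := by
  obtain ⟨M, hM⟩ := exists_dilogExponent_re_le hb hτ
  refine ⟨Real.exp (M / 4), 2 * Real.pi * τ, (Real.exp_pos _).le, fun z hz => ?_⟩
  rw [norm_qdilog hb, ← Real.exp_add]
  refine Real.exp_le_exp.2 ?_
  have := (abs_le.1 (hM z hz)).1
  linarith

theorem exists_norm_qdilog_ofReal_le (hb : 0 < b.re) :
    ∃ C : ℝ, ∀ x : ℝ, ‖qdilog b x‖ ≤ C ∧ ‖(qdilog b x)⁻¹‖ ≤ C := by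
  obtain ⟨M, hM⟩ := exists_dilogExponent_re_le hb (τ := 0)
    (by simpa using add_pos hb (inv_re_pos hb))
  refine ⟨Real.exp (M / 4), fun x => ?_⟩
  have := abs_le.1 (hM x (by simp))
  simp only [mul_zero, zero_mul, add_zero] at this
  rw [norm_inv, norm_qdilog hb, ← Real.exp_neg]
  exact ⟨Real.exp_le_exp.2 (by linarith), Real.exp_le_exp.2 (by linarith)⟩

theorem continuous_qdilog_ofReal (hb : 0 < b.re) : Continuous fun x : ℝ => qdilog b x :=
  continuous_iff_continuousAt.2 fun x =>
    (differentiableAt_qdilog hb (by simpa using add_pos hb (inv_re_pos hb))).continuousAt.comp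
      continuous_ofReal.continuousAt

end Dilogarithm

/-! #### The functional equation -/

section Dilogarithm

variable {b : ℂ}

theorem exists_bound_inv_sinhc_phase (hb : 0 < b.re) {L : ℝ} (hL : 0 ≤ L) (hL' : L < Real.pi * b.re)
    (x : ℝ) :
    ∃ C : ℝ, 0 ≤ C ∧ ∀ y ∈ closedStrip (-L) L,
      ‖exp (-2 * I * x * y) * (b * (sinhc (y * b⁻¹))⁻¹)‖ ≤
        C * Real.exp (-((b⁻¹).re / 2) * |y.re|) := by
  obtain ⟨C, hC, h⟩ := exists_bound_inv_sinhc (c := b⁻¹) (δ := (b⁻¹).re / 2) (inv_re_pos hb)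
    (by rwa [inv_inv]) hL (by rwa [inv_inv]) (by linarith [inv_re_pos hb])
  refine ⟨Real.exp (2 * L * |x|) * (‖b‖ * C), by positivity, fun y hy => ?_⟩
  rw [norm_mul, norm_mul]
  have h1 := norm_phase_le_of_mem (z := x) hy
  simp only [ofReal_re, ofReal_im, abs_zero, mul_zero, zero_mul, Real.exp_zero, mul_one] at h1
  calc _ ≤ Real.exp (2 * L * |x|) * (‖b‖ * (C * Real.exp (-((b⁻¹).re / 2) * |y.re|))) := by
        gcongr
        exact h y hy
    _ = _ := by ring

/-- The Fourier transform of `1 / sinh (y / b)` along the contour. -/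
theorem fourier_inv_sinh (hb : 0 < b.re) (x : ℝ) :
    (1 + exp (2 * Real.pi * b * x)) *
      ∫ s : ℝ, exp (-2 * I * x * (s + contourHeight b * I)) *
        (b * (sinhc ((s + contourHeight b * I) * b⁻¹))⁻¹) / (s + contourHeight b * I) =
      -2 * Real.pi * I * b * exp (2 * Real.pi * b * x) := by
  have hb0 : b ≠ 0 := by rintro rfl; simp at hb
  have hε := contourHeight_pos hb
  have hpi := Real.pi_gt_three
  have hpb : 0 < Real.pi * b.re := mul_pos Real.pi_pos hb
  -- With this height the lines Im y = c and Im y = -c differ by the translation by iπb, up to a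
  -- real shift. Under y ↦ y + iπb, sinh(y/b) changes sign and e^{-2ixy} is multiplied by e^{2πbx}.
  -- Together with the residue at 0 this gives a linear equation for the integral.
  set c : ℝ := Real.pi * b.re / 2 with hc
  have hc0 : 0 < c := by positivity
  have hcpi : c < Real.pi * b.re := by linarith
  have hεc : contourHeight b ≤ c := (contourHeight_le_re b).trans (by rw [hc]; nlinarith)
  obtain ⟨C, hC, hbd⟩ := exists_bound_inv_sinhc_phase hb hc0.le hcpi x
  set k : ℂ → ℂ := fun y => exp (-2 * I * x * y) * (b * (sinhc (y * b⁻¹))⁻¹) with hk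
  have hkd : DifferentiableOn ℂ k (closedStrip (-c) c) :=
    DifferentiableOn.mul (by fun_prop) ((differentiableOn_inv_sinhc (c := b⁻¹)
      (by rwa [inv_inv]) (by rwa [inv_inv])).const_mul b)
  have hδ : 0 < (b⁻¹).re / 2 := by linarith [inv_re_pos hb]
  have hsub : closedStrip (contourHeight b) c ⊆ closedStrip (-c) c := fun z hz =>
    ⟨by linarith [hz.1], hz.2⟩
  have hne0 : ∀ z ∈ closedStrip (contourHeight b) c, z ≠ 0 := by
    rintro z hz rfl
    have := hz.1
    simp at this
    linarith
  have e1 : ∫ s : ℝ, k (s + contourHeight b * I) / (s + contourHeight b * I) =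
      ∫ s : ℝ, k (s + c * I) / (s + c * I) := by
    refine integral_horizontal_eq (f := fun y => k y / y) hεc
      ((hkd.mono hsub).div differentiableOn_id hne0) hδ (C := C * (contourHeight b)⁻¹)
      fun z hz => ?_
    rw [norm_div, div_eq_mul_inv]
    have h1 : contourHeight b ≤ ‖z‖ := (hz.1.trans (le_abs_self _)).trans (abs_im_le_norm z)
    calc _ ≤ C * Real.exp (-((b⁻¹).re / 2) * |z.re|) * (contourHeight b)⁻¹ := by
          gcongr
          exact hbd z (hsub hz)
      _ = _ := by ring
  have e2 := integral_horizontal_sub_of_pole hc0 hkd hδ hbd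
  have hk0 : k 0 = b := by simp [hk, sinhc_zero]
  have hform : ∀ y : ℂ, k y / y = exp (-2 * I * x * y) / sinh (y * b⁻¹) := by
    intro y
    rw [← mul_sinhc (y * b⁻¹)]
    simp only [hk]
    by_cases hy : y = 0
    · simp [hy]
    · by_cases hs : sinhc (y * b⁻¹) = 0
      · simp [hs]
      · field_simp
  have e3 : ∫ s : ℝ, k (s + c * I) / (s + c * I) =
      -exp (2 * Real.pi * b * x) * ∫ s : ℝ, k (s + (-c : ℝ) * I) / (s + (-c : ℝ) * I) := by
    -- For complex b the translation by iπb has the real part -π Im b, which is absorbed by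
    -- translation invariance on the line.
    rw [← integral_add_right_eq_self (fun s : ℝ => k (s + c * I) / (s + c * I)) (-Real.pi * b.im),
      ← integral_const_mul]
    refine integral_congr_ae (.of_forall fun s => ?_)
    simp only
    rw [hform, hform]
    have h1 : ((s + -Real.pi * b.im : ℝ) : ℂ) + c * I = (s + (-c : ℝ) * I) + Real.pi * b * I := by
      apply Complex.ext
      · simp
      · simp [hc]; ring
    rw [h1]
    set u : ℂ := s + (-c : ℝ) * I
    have h2 : (u + Real.pi * b * I) * b⁻¹ = u * b⁻¹ + Real.pi * I := by field_simp
    have h3 : sinh (u * b⁻¹ + Real.pi * I) = -sinh (u * b⁻¹) := by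
      rw [sinh_add, cosh_mul_I, sinh_mul_I, cos_pi, sin_pi]; ring
    rw [h2, h3, show -2 * I * x * (u + Real.pi * b * I) = 2 * Real.pi * b * x + -2 * I * x * u by
      linear_combination (-2 * x * Real.pi * b : ℂ) * I_sq, exp_add]
    ring
  change (1 + exp (2 * Real.pi * b * x)) *
    ∫ s : ℝ, k (s + contourHeight b * I) / (s + contourHeight b * I) = _
  rw [e1]
  rw [hk0] at e2
  linear_combination e3 - exp (2 * Real.pi * b * x) * e2

/-- If e^{2πbx} = -1, its modulus e^{2π x Re b} is 1, which forces x = 0, where the sum is 2. -/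
theorem one_add_exp_ne_zero (hb : 0 < b.re) (x : ℝ) : 1 + exp (2 * Real.pi * b * x) ≠ 0 := by
  intro h
  have h1 : exp (2 * Real.pi * b * x) = -1 := by linear_combination h
  have h2 := congrArg norm h1
  rw [norm_exp, norm_neg, norm_one, Real.exp_eq_one_iff] at h2
  have h3 : (2 * Real.pi * b * x : ℂ).re = 2 * Real.pi * b.re * x := by simp
  rw [h3] at h2
  have hx : x = 0 := by
    have : 2 * Real.pi * b.re ≠ 0 := by positivity
    exact (mul_eq_zero.1 h2).resolve_left this
  rw [hx] at h
  norm_num at h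

theorem abs_im_ofReal_add_half (hb : 0 < b.re) (x : ℝ) :
    |((x : ℂ) + I * b / 2).im| = b.re / 2 ∧ |((x : ℂ) - I * b / 2).im| = b.re / 2 := by
  have h : (I * b / 2 : ℂ).im = b.re / 2 := by
    rw [show (I * b / 2 : ℂ) = (1 / 2 : ℝ) * (I * b) by push_cast; ring, im_ofReal_mul]
    simp
    ring
  rw [add_im, sub_im, h, ofReal_im, zero_add, zero_sub, abs_neg, abs_of_pos (by linarith)]
  exact ⟨rfl, rfl⟩

/-- The two phases differ by e^{yb} - e^{-yb} = 2 sinh(yb), which cancels one hyperbolic sine of the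
kernel. What remains is the Fourier integral of 1/sinh(y/b), which is explicit. -/
theorem dilogExponent₁_sub (hb : 0 < b.re) (x : ℝ) :
    dilogExponent₁ b (x + I * b / 2) - dilogExponent₁ b (x - I * b / 2) =
      -8 * Real.pi * b * exp (2 * Real.pi * b * x) / (1 + exp (2 * Real.pi * b * x)) := by
  have hb0 : b ≠ 0 := by rintro rfl; simp at hb
  have hσ : b.re < b.re + (b⁻¹).re := by linarith [inv_re_pos hb]
  obtain ⟨δ, h1, h2⟩ := exists_between hσ
  obtain ⟨δ', h3, h4⟩ := exists_between h2
  have hK := (lineKernel_dilogKernel hb h4).mul_id h3 (-2 * I)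
  obtain ⟨hp, hm⟩ := abs_im_ofReal_add_half hb x
  have h5 := fourier_inv_sinh hb x
  rw [eq_div_iff (one_add_exp_ne_zero hb x), dilogExponent₁, dilogExponent₁, lineIntegral,
    lineIntegral, ← integral_sub (hK.integrable (by rw [hp]; linarith))
    (hK.integrable (by rw [hm]; linarith))]
  have h6 : ∀ s : ℝ, exp (-2 * I * (x + I * b / 2) * (s + contourHeight b * I)) *
        (-2 * I * (s + contourHeight b * I) * dilogKernel b (s + contourHeight b * I)) -
      exp (-2 * I * (x - I * b / 2) * (s + contourHeight b * I)) *
        (-2 * I * (s + contourHeight b * I) * dilogKernel b (s + contourHeight b * I)) =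
      -4 * I * (exp (-2 * I * x * (s + contourHeight b * I)) *
        (b * (sinhc ((s + contourHeight b * I) * b⁻¹))⁻¹) / (s + contourHeight b * I)) := by
    intro s
    have hne := horizontal_ne_zero (contourHeight_pos hb).ne' s
    have hyim : |((s : ℂ) + contourHeight b * I).im| = contourHeight b := by
      simp [abs_of_pos (contourHeight_pos hb)]
    set y : ℂ := s + contourHeight b * I
    have hs : sinhc (y * b) ≠ 0 := sinhc_mul_ne_zero (inv_re_pos hb) (by
      rw [hyim]
      exact (contourHeight_le_inv_re b).trans_lt (lt_pi_mul (inv_re_pos hb)))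
    have e1 : exp (-2 * I * (x + I * b / 2) * y) = exp (-2 * I * x * y) * exp (y * b) := by
      rw [← exp_add]
      congr 1
      linear_combination (-b * y) * I_sq
    have e2 : exp (-2 * I * (x - I * b / 2) * y) = exp (-2 * I * x * y) * exp (-(y * b)) := by
      rw [← exp_add]
      congr 1
      linear_combination (b * y) * I_sq
    have e3 : exp (y * b) - exp (-(y * b)) = 2 * (y * b * sinhc (y * b)) := by
      rw [mul_sinhc, sinh]; ring
    have e4 : dilogKernel b y * (y * b * sinhc (y * b)) * y =
        b * (sinhc (y * b⁻¹))⁻¹ / y := by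
      rw [dilogKernel, regKernel]
      field_simp
    rw [e1, e2]
    linear_combination (exp (-2 * I * x * y) * (-2 * I * y * dilogKernel b y)) * e3 +
      (-4 * I * exp (-2 * I * x * y)) * e4
  simp_rw [h6]
  rw [integral_const_mul]
  linear_combination (-4 * I) * h5 + (8 * Real.pi * b * exp (2 * Real.pi * b * x)) * I_sq

theorem tendsto_dilogExponent_atBot (hb : 0 < b.re) {c : ℂ} (hc : 2 * |c.im| < b.re + (b⁻¹).re) :
    Tendsto (fun x : ℝ => dilogExponent b (x + c)) atBot (𝓝 0) := by
  obtain ⟨δ, h1, h2⟩ := exists_between hc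
  obtain ⟨C, hC, hbd⟩ := (lineKernel_dilogKernel hb h2).norm_lineIntegral_le h1
  have hlim : Tendsto (fun x : ℝ => C * Real.exp (2 * contourHeight b * (x + c.re))) atBot (𝓝 0) := by
    have h3 : Tendsto (fun x : ℝ => 2 * contourHeight b * (x + c.re)) atBot atBot :=
      (tendsto_const_mul_atBot_of_pos (by linarith [contourHeight_pos hb])).2
        (tendsto_atBot_add_const_right _ _ tendsto_id)
    simpa using (Real.tendsto_exp_atBot.comp h3).const_mul C
  refine squeeze_zero_norm (fun x => ?_) hlim
  simpa [dilogExponent] using hbd (x + c) (by simp)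

/-- The quotient of φ_b(x + ib/2)/φ_b(x - ib/2) by 1 + e^{2πbx} has zero derivative on the real
line, and tends to 1 as x → -∞ because the exponents decay there. -/
theorem qdilog_add_half (hb : 0 < b.re) (x : ℝ) :
    qdilog b (x + I * b / 2) = (1 + exp (2 * Real.pi * b * x)) * qdilog b (x - I * b / 2) := by
  have hσ : 2 * (b.re / 2) < b.re + (b⁻¹).re := by linarith [inv_re_pos hb]
  set D : ℝ → ℂ := fun x => dilogExponent b (x + I * b / 2) - dilogExponent b (x - I * b / 2) with hD
  set e : ℝ → ℂ := fun x => 1 + exp (2 * Real.pi * b * x) with he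
  have hD' : ∀ x : ℝ, HasDerivAt D
      (-8 * Real.pi * b * exp (2 * Real.pi * b * x) / (1 + exp (2 * Real.pi * b * x))) x := by
    intro x
    obtain ⟨hp, hm⟩ := abs_im_ofReal_add_half hb x
    rw [← dilogExponent₁_sub hb x]
    have h1 := (hasDerivAt_dilogExponent hb (z := x + I * b / 2) (by rw [hp]; exact hσ)).comp
      (x : ℂ) ((hasDerivAt_id (x : ℂ)).add_const (I * b / 2))
    have h2 := (hasDerivAt_dilogExponent hb (z := x - I * b / 2) (by rw [hm]; exact hσ)).comp
      (x : ℂ) ((hasDerivAt_id (x : ℂ)).sub_const (I * b / 2))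
    exact ((h1.sub h2).comp_ofReal).congr_deriv (by simp)
  have he' : ∀ x : ℝ, HasDerivAt e (2 * Real.pi * b * exp (2 * Real.pi * b * x)) x := by
    intro x
    have h1 : HasDerivAt (fun w : ℂ => 2 * Real.pi * b * w) (2 * Real.pi * b) (x : ℂ) := by
      simpa using (hasDerivAt_id (x : ℂ)).const_mul (2 * Real.pi * b)
    exact ((h1.cexp.const_add 1).comp_ofReal).congr_deriv (by ring)
  have hQ : ∀ x : ℝ, HasDerivAt (fun x => exp (-(1 / 4) * D x) / e x) 0 x := by
    intro x
    have hne := one_add_exp_ne_zero hb x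
    refine ((((hD' x).const_mul (-(1 / 4))).cexp).div (he' x) hne).congr_deriv ?_
    rw [div_eq_zero_iff]
    left
    have h1 := div_mul_cancel₀ (-8 * Real.pi * b * exp (2 * Real.pi * b * x)) hne
    simp only [he]
    linear_combination (-(1 / 4) * exp (-(1 / 4) * D x)) * h1
  have hconst : ∀ y : ℝ, exp (-(1 / 4) * D y) / e y = exp (-(1 / 4) * D x) / e x := fun y =>
    is_const_of_deriv_eq_zero (fun x => (hQ x).differentiableAt) (fun x => (hQ x).deriv) y x
  have hDlim : Tendsto D atBot (𝓝 0) := by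
    have h1 := tendsto_dilogExponent_atBot hb (c := I * b / 2) (by
      have := (abs_im_ofReal_add_half hb 0).1
      simp only [ofReal_zero, zero_add] at this
      rw [this]; exact hσ)
    have h2 := tendsto_dilogExponent_atBot hb (c := -(I * b / 2)) (by
      have := (abs_im_ofReal_add_half hb 0).2
      simp only [ofReal_zero, zero_sub] at this
      rw [this]; exact hσ)
    simpa [hD, sub_eq_add_neg] using h1.sub h2
  have helim : Tendsto e atBot (𝓝 1) := by
    have h1 : Tendsto (fun x : ℝ => exp (2 * Real.pi * b * x)) atBot (𝓝 0) := by
      rw [tendsto_zero_iff_norm_tendsto_zero]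
      have h2 : ∀ x : ℝ, ‖exp (2 * Real.pi * b * x)‖ = Real.exp (2 * Real.pi * b.re * x) := by
        intro x
        rw [norm_exp]
        simp
      simp_rw [h2]
      exact Real.tendsto_exp_atBot.comp
        ((tendsto_const_mul_atBot_of_pos (by positivity)).2 tendsto_id)
    simpa using h1.const_add 1
  have hlim : Tendsto (fun y => exp (-(1 / 4) * D y) / e y) atBot (𝓝 1) := by
    have h1 := ((hDlim.const_mul (-(1 / 4))).cexp).div helim one_ne_zero
    rwa [mul_zero, exp_zero, div_one] at h1
  have hone : exp (-(1 / 4) * D x) / e x = 1 :=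
    tendsto_nhds_unique (tendsto_const_nhds.congr fun y => (hconst y).symm) hlim
  rw [div_eq_one_iff_eq (one_add_exp_ne_zero hb x)] at hone
  rw [qdilog_eq hb, qdilog_eq hb, ← hone, ← exp_add]
  congr 1
  simp only [hD]
  ring

end Dilogarithm

end QLiouville

end

/-! ### Analytic continuation through Fourier transforms, and Gaussian damping of the dilogarithm.
-/

noncomputable section
namespace QLiouville

open MeasureTheory Filter Topology Set
open scoped FourierTransform

/-! ### Fourier transforms of functions analytic in a strip -/

/-- Analyticity and exponential decay in the open strip `c₁ < Im z < c₂`. -/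
structure StripDecay (f : ℂ → ℂ) (c₁ c₂ : ℝ) : Prop where
  diff : ∀ z : ℂ, c₁ < z.im → z.im < c₂ → DifferentiableAt ℂ f z
  bound : ∃ C : ℝ, ∀ z : ℂ, c₁ < z.im → z.im < c₂ → ‖f z‖ ≤ C * Real.exp (-|z.re|)

/-- Analyticity and at most exponential growth in the open strip `c₁ < Im z < c₂`. -/
structure StripGrowth (f : ℂ → ℂ) (c₁ c₂ : ℝ) : Prop where
  diff : ∀ z : ℂ, c₁ < z.im → z.im < c₂ → DifferentiableAt ℂ f z
  bound : ∃ C A : ℝ, 0 ≤ C ∧ 0 ≤ A ∧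
    ∀ z : ℂ, c₁ < z.im → z.im < c₂ → ‖f z‖ ≤ C * Real.exp (A * |z.re|)

theorem StripDecay.mono {f : ℂ → ℂ} {c₁ c₂ d₁ d₂ : ℝ} (hf : StripDecay f c₁ c₂) (h₁ : c₁ ≤ d₁)
    (h₂ : d₂ ≤ c₂) : StripDecay f d₁ d₂ := by
  obtain ⟨hd, C, hC⟩ := hf
  exact ⟨fun z h h' => hd z (h₁.trans_lt h) (h'.trans_le h₂),
    C, fun z h h' => hC z (h₁.trans_lt h) (h'.trans_le h₂)⟩

theorem StripGrowth.mul {f g : ℂ → ℂ} {c₁ c₂ : ℝ} (hf : StripGrowth f c₁ c₂)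
    (hg : StripGrowth g c₁ c₂) : StripGrowth (fun z => f z * g z) c₁ c₂ := by
  obtain ⟨hd, C, A, hC, hA, h⟩ := hf
  obtain ⟨hd', C', A', hC', hA', h'⟩ := hg
  refine ⟨fun z h1 h2 => (hd z h1 h2).mul (hd' z h1 h2), C * C', A + A', by positivity,
    by positivity, fun z h1 h2 => ?_⟩
  rw [norm_mul]
  refine (mul_le_mul (h z h1 h2) (h' z h1 h2) (norm_nonneg _) (by positivity)).trans (le_of_eq ?_)
  rw [add_mul, Real.exp_add]
  ring

theorem integral_strip_eq {f : ℂ → ℂ} {c₁ c₂ : ℝ} (hf : DifferentiableOn ℂ f (closedStrip c₁ c₂))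
    {C : ℝ} (hb : ∀ z ∈ closedStrip c₁ c₂, ‖f z‖ ≤ C * Real.exp (-|z.re|)) {s t : ℝ}
    (hs : s ∈ Icc c₁ c₂) (ht : t ∈ Icc c₁ c₂) :
    ∫ x : ℝ, f (x + s * I) = ∫ x : ℝ, f (x + t * I) := by
  wlog h : s ≤ t generalizing s t
  · exact (this ht hs (le_of_not_ge h)).symm
  have hsub : closedStrip s t ⊆ closedStrip c₁ c₂ := fun z hz =>
    ⟨hs.1.trans hz.1, hz.2.trans ht.2⟩
  exact integral_horizontal_eq h (hf.mono hsub) one_pos fun z hz => by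
    simpa using hb z (hsub hz)

/-- The complex shift ic has imaginary part Re c, handled by moving the contour inside the strip,
and real part -Im c, handled by translation of the real line. -/
theorem StripDecay.fourier_shift {f : ℂ → ℂ} {c₁ c₂ : ℝ} (hf : StripDecay f c₁ c₂) (h₁ : c₁ < 0)
    (h₂ : 0 < c₂) {c : ℂ} (hc₁ : c₁ < c.re) (hc₂ : c.re < c₂) (ξ : ℝ) :
    𝓕 (fun x : ℝ => f (x + I * c)) ξ = exp (-2 * Real.pi * c * ξ) * 𝓕 (fun x : ℝ => f x) ξ := by
  obtain ⟨hd, C, hC⟩ := hf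
  set u : ℂ → ℂ := fun z => exp (-2 * Real.pi * I * ξ * z) * f z with hu
  obtain ⟨d₁, h3, h4⟩ := exists_between (lt_min h₁ hc₁)
  obtain ⟨d₂, h5, h6⟩ := exists_between (max_lt h₂ hc₂)
  rw [lt_min_iff] at h4
  rw [max_lt_iff] at h5
  have hC0 : 0 ≤ C := by simpa using (norm_nonneg _).trans (hC 0 h₁ h₂)
  set L := max |d₁| |d₂|
  have key := integral_strip_eq (f := u) (c₁ := d₁) (c₂ := d₂) (s := 0) (t := c.re)
    (C := Real.exp (2 * Real.pi * |ξ| * L) * C)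
    (fun z hz => (DifferentiableAt.mul (by fun_prop)
      (hd z (h3.trans_le hz.1) (hz.2.trans_lt h6))).differentiableWithinAt)
    (fun z hz => by
      rw [hu, norm_mul, mul_assoc (Real.exp _)]
      refine mul_le_mul ?_ (hC z (h3.trans_le hz.1) (hz.2.trans_lt h6)) (norm_nonneg _)
        (Real.exp_pos _).le
      rw [norm_exp]
      refine Real.exp_le_exp.2 ?_
      have e : (-2 * Real.pi * I * ξ * z : ℂ).re = 2 * Real.pi * (ξ * z.im) := by
        simp [mul_re, mul_im]; ring
      rw [e, mul_assoc (2 * Real.pi) |ξ| L]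
      refine mul_le_mul_of_nonneg_left ?_ (by positivity : 0 ≤ 2 * Real.pi)
      refine (le_abs_self _).trans ?_
      rw [abs_mul]
      gcongr
      exact abs_le_max_abs_abs hz.1 hz.2)
    ⟨h4.1.le, h5.1.le⟩ ⟨h4.2.le, h5.2.le⟩
  rw [← integral_add_right_eq_self (fun x : ℝ => u (x + c.re * I)) (-c.im)] at key
  rw [Real.fourier_real_eq_integral_exp_smul, Real.fourier_real_eq_integral_exp_smul,
    ← integral_const_mul]
  have e1 : ∀ x : ℝ, ((x + -c.im : ℝ) : ℂ) + c.re * I = x + I * c := fun x => by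
    apply Complex.ext <;> simp
  calc _ = ∫ x : ℝ, exp (-2 * Real.pi * c * ξ) * u (((x + -c.im : ℝ) : ℂ) + c.re * I) := by
        refine integral_congr_ae (.of_forall fun x => ?_)
        simp only [hu, e1, smul_eq_mul]
        rw [← mul_assoc, ← exp_add]
        congr 2
        push_cast
        linear_combination (2 * Real.pi * ξ * c) * I_sq
    _ = exp (-2 * Real.pi * c * ξ) * ∫ x : ℝ, u (x + (0 : ℝ) * I) := by
        rw [integral_const_mul, key]
    _ = _ := by
        rw [← integral_const_mul]
        refine integral_congr_ae (.of_forall fun x => ?_)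
        simp only [hu, smul_eq_mul, ofReal_zero, zero_mul, add_zero]
        congr 3
        push_cast
        ring

theorem continuous_fourier_of_integrable {f : ℝ → ℂ} (hf : Integrable f) : Continuous (𝓕 f) :=
  VectorFourier.fourierIntegral_continuous Real.continuous_fourierChar continuous_inner hf

/-- Continuous bounded functions to which the Fourier inversion formula applies. -/
structure FourierNice (f : ℝ → ℂ) : Prop where
  cont : Continuous f
  bdd : ∃ C : ℝ, ∀ x, ‖f x‖ ≤ C
  int : Integrable f
  int_fourier : Integrable (𝓕 f)

/-- Shifting the contour by ±δ/2, with the sign chosen according to ξ, bounds the Fourier transform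
by a multiple of e^{-πδ|ξ|}. -/
theorem StripDecay.fourierNice {f : ℂ → ℂ} {δ : ℝ} (hδ : 0 < δ) (hf : StripDecay f (-δ) δ) :
    FourierNice fun x : ℝ => f x := by
  have hf' := hf
  obtain ⟨hd, C, hC⟩ := hf
  have hC0 : 0 ≤ C := by simpa using (norm_nonneg _).trans (hC 0 (by simpa) (by simpa))
  have hint : Integrable fun x : ℝ => C * Real.exp (-|x|) := by
    simpa using (integrable_exp_neg_mul_abs one_pos).const_mul C
  have hcont : Continuous fun x : ℝ => f x := continuous_iff_continuousAt.2 fun x =>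
    (hd x (by simpa) (by simpa)).continuousAt.comp continuous_ofReal.continuousAt
  have hi : Integrable fun x : ℝ => f x :=
    hint.mono' hcont.aestronglyMeasurable
      (.of_forall fun x => by simpa using hC x (by simpa) (by simpa))
  have hcf : Continuous (𝓕 fun x : ℝ => f x) := continuous_fourier_of_integrable hi
  refine ⟨hcont, ⟨C, fun x => ?_⟩, hi, ?_⟩
  · refine (hC x (by simpa) (by simpa)).trans (mul_le_of_le_one_right hC0 ?_)
    simp
  · have hbd : ∀ (c : ℝ) (ξ : ℝ), |c| < δ →
        ‖𝓕 (fun x : ℝ => f x) ξ‖ ≤ Real.exp (2 * Real.pi * c * ξ) * ∫ x : ℝ, C * Real.exp (-|x|) := by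
      intro c ξ hc
      have h1 := hf'.fourier_shift (neg_lt_zero.2 hδ) hδ (c := c)
        (by simpa using (abs_lt.1 hc).1) (by simpa using (abs_lt.1 hc).2) ξ
      have h2 : 𝓕 (fun x : ℝ => f x) ξ =
          exp (2 * Real.pi * c * ξ) * 𝓕 (fun x : ℝ => f (x + I * c)) ξ := by
        rw [h1, ← mul_assoc, ← exp_add]
        simp
      rw [h2, norm_mul, norm_exp]
      have h3 : (2 * Real.pi * c * ξ : ℂ).re = 2 * Real.pi * c * ξ := by
        norm_cast
      rw [h3, Real.fourier_real_eq_integral_exp_smul]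
      gcongr
      refine norm_integral_le_of_norm_le hint (.of_forall fun x => ?_)
      rw [norm_smul, norm_exp_ofReal_mul_I, one_mul]
      have him : ((x : ℂ) + I * c).im = c := by simp
      have hre : ((x : ℂ) + I * c).re = x := by simp
      have := hC (x + I * c) (by rw [him]; exact (abs_lt.1 hc).1) (by rw [him]; exact (abs_lt.1 hc).2)
      rwa [hre] at this
    refine ((integrable_exp_neg_mul_abs (δ := Real.pi * δ) (by positivity)).mul_const
      (∫ x : ℝ, C * Real.exp (-|x|))).mono' hcf.aestronglyMeasurable (.of_forall fun ξ => ?_)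
    have hδ2 : |δ / 2| < δ := by rw [abs_of_pos (by linarith)]; linarith
    rcases le_total 0 ξ with h | h
    · refine (hbd (-(δ / 2)) ξ (by rwa [abs_neg])).trans (le_of_eq ?_)
      rw [abs_of_nonneg h]
      ring_nf
    · refine (hbd (δ / 2) ξ hδ2).trans (le_of_eq ?_)
      rw [abs_of_nonpos h]
      ring_nf

theorem FourierNice.continuous_fourier {f : ℝ → ℂ} (hf : FourierNice f) : Continuous (𝓕 f) :=
  continuous_fourier_of_integrable hf.int

theorem FourierNice.inversion {f : ℝ → ℂ} (hf : FourierNice f) (x : ℝ) :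
    f x = ∫ ξ : ℝ, 𝓕 f ξ * exp (I * (2 * Real.pi * ξ : ℝ) * x) := by
  have h := congrFun (hf.cont.fourierInv_fourier_eq hf.int hf.int_fourier) x
  rw [Real.fourierInv_eq'] at h
  rw [← h]
  refine integral_congr_ae (.of_forall fun ξ => ?_)
  simp only [smul_eq_mul]
  rw [mul_comm]
  congr 2
  simp
  ring

/-- The function `g` is `x ↦ f (x + i c)` in the sense of Fourier transforms. -/
structure ShiftPair (c : ℂ) (f g : ℝ → ℂ) : Prop where
  left : FourierNice f
  right : FourierNice g
  fourier_eq : ∀ ξ : ℝ, 𝓕 g ξ = exp (-2 * Real.pi * c * ξ) * 𝓕 f ξ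

theorem ShiftPair.trans {c d : ℂ} {f g h : ℝ → ℂ} (h₁ : ShiftPair c f g) (h₂ : ShiftPair d g h) :
    ShiftPair (c + d) f h :=
  ⟨h₁.left, h₂.right, fun ξ => by
    rw [h₂.fourier_eq, h₁.fourier_eq, ← mul_assoc, ← exp_add]
    ring_nf⟩

theorem StripDecay.shiftPair {f g : ℂ → ℂ} {c : ℂ} (hc : 0 ≤ c.re) {δ : ℝ} (hδ : 0 < δ)
    (hf : StripDecay f (-δ) (c.re + δ)) (hg : StripDecay g (-δ) δ)
    (h : ∀ x : ℝ, f (x + I * c) = g x) : ShiftPair c (fun x : ℝ => f x) (fun x : ℝ => g x) := by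
  refine ⟨(hf.mono le_rfl (by linarith)).fourierNice hδ, hg.fourierNice hδ, fun ξ => ?_⟩
  rw [← hf.fourier_shift (by linarith) (by linarith) (by linarith) (by linarith) ξ]
  simp_rw [h]

/-! ### Gaussian regularization of the quantum dilogarithm -/

/-- The Gaussian `e^{-s z²}`. -/
def gauss (s : ℝ) (z : ℂ) : ℂ := exp (-s * z ^ 2)

/-- In a horizontal strip |e^{-s(z-d)²}| is e^{-s(Re z - Re d)²} up to a constant, and completing
the square shows that this beats e^{(A+1)|Re z|}. -/
theorem StripGrowth.mul_gauss {f : ℂ → ℂ} {c₁ c₂ : ℝ} (hf : StripGrowth f c₁ c₂) {s : ℝ}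
    (hs : 0 < s) (d : ℂ) : StripDecay (fun z => f z * gauss s (z - d)) c₁ c₂ := by
  obtain ⟨hd, C, A, hC, hA, h⟩ := hf
  set L := max |c₁| |c₂| + |d.im|
  refine ⟨fun z h1 h2 => (hd z h1 h2).mul (by unfold gauss; fun_prop),
    C * Real.exp (s * L ^ 2 + (A + 1) ^ 2 / (4 * s) + (A + 1) * |d.re|), fun z h1 h2 => ?_⟩
  rw [norm_mul, gauss, norm_exp]
  refine (mul_le_mul_of_nonneg_right (h z h1 h2) (Real.exp_pos _).le).trans ?_
  rw [mul_assoc, mul_assoc, ← Real.exp_add, ← Real.exp_add]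
  refine mul_le_mul_of_nonneg_left (Real.exp_le_exp.2 ?_) hC
  have e : (-s * (z - d) ^ 2 : ℂ).re = -s * ((z.re - d.re) ^ 2 - (z.im - d.im) ^ 2) := by
    rw [neg_mul, neg_re, re_ofReal_mul, pow_two, mul_re, sub_re, sub_im]
    ring
  rw [e]
  have h3 : |z.im - d.im| ≤ L :=
    (abs_sub _ _).trans (add_le_add (abs_le_max_abs_abs h1.le h2.le) le_rfl)
  have h4 : (z.im - d.im) ^ 2 ≤ L ^ 2 := by
    rw [← sq_abs]
    gcongr
  have h5 : |z.re| ≤ |z.re - d.re| + |d.re| := by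
    simpa using abs_add_le (z.re - d.re) d.re
  have h6 : (A + 1) * |z.re - d.re| - s * |z.re - d.re| ^ 2 ≤ (A + 1) ^ 2 / (4 * s) := by
    rw [le_div_iff₀ (by positivity)]
    nlinarith [sq_nonneg ((A + 1) - 2 * s * |z.re - d.re|)]
  rw [sq_abs] at h6
  have h7 : s * (z.im - d.im) ^ 2 ≤ s * L ^ 2 := by gcongr
  have h8 : (A + 1) * |z.re| ≤ (A + 1) * (|z.re - d.re| + |d.re|) := by gcongr
  linarith

theorem stripGrowth_const (u : ℂ) (c₁ c₂ : ℝ) : StripGrowth (fun _ => u) c₁ c₂ :=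
  ⟨fun _ _ _ => differentiableAt_const _, ‖u‖, 0, norm_nonneg _, le_rfl, fun _ _ _ => by simp⟩

theorem stripGrowth_one_add_exp (u a : ℂ) (c₁ c₂ : ℝ) :
    StripGrowth (fun z => 1 + u * exp (a * z)) c₁ c₂ := by
  refine ⟨fun z _ _ => by fun_prop,
    1 + ‖u‖ * Real.exp (|a.im| * max |c₁| |c₂|), |a.re|, by positivity, abs_nonneg _,
    fun z h1 h2 => ?_⟩
  have h3 : ‖exp (a * z)‖ ≤ Real.exp (|a.im| * max |c₁| |c₂|) * Real.exp (|a.re| * |z.re|) := by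
    rw [norm_exp, ← Real.exp_add]
    refine Real.exp_le_exp.2 ?_
    rw [mul_re, add_comm, ← abs_mul]
    have h4 : -(a.im * z.im) ≤ |a.im| * max |c₁| |c₂| := by
      refine (neg_le_abs _).trans ?_
      rw [abs_mul]
      gcongr
      exact abs_le_max_abs_abs h1.le h2.le
    linarith [le_abs_self (a.re * z.re)]
  have h5 : 1 ≤ Real.exp (|a.re| * |z.re|) := Real.one_le_exp (by positivity)
  refine (norm_add_le _ _).trans ?_
  rw [norm_one, norm_mul, add_mul, one_mul]
  refine add_le_add h5 ?_
  rw [mul_assoc]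
  gcongr

theorem stripGrowth_qdilog {b : ℂ} (hb : 0 < b.re) {d : ℂ} {c₁ c₂ τ : ℝ}
    (hτ : 2 * τ < b.re + (b⁻¹).re) (h₁ : -τ ≤ c₁ + d.im) (h₂ : c₂ + d.im ≤ τ) :
    StripGrowth (fun z => qdilog b (z + d)) c₁ c₂ := by
  obtain ⟨C, A, hC, h⟩ := exists_norm_qdilog_le hb hτ
  have him : ∀ z : ℂ, c₁ < z.im → z.im < c₂ → |(z + d).im| ≤ τ := fun z h1 h2 => by
    rw [add_im, abs_le]; constructor <;> linarith
  refine ⟨fun z h1 h2 => ?_, C * Real.exp (|A| * |d.re|), |A|, by positivity, abs_nonneg _,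
    fun z h1 h2 => ?_⟩
  · have h3 : DifferentiableAt ℂ (qdilog b) (z + d) :=
      differentiableAt_qdilog hb (by linarith [him z h1 h2])
    exact DifferentiableAt.comp (g := qdilog b) (f := fun z => z + d) z h3
      (differentiableAt_id.add_const d)
  · refine (h _ (him z h1 h2)).trans ?_
    rw [mul_assoc, ← Real.exp_add]
    refine mul_le_mul_of_nonneg_left (Real.exp_le_exp.2 ?_) hC
    rw [← mul_add, add_comm |d.re|]
    refine mul_le_mul (le_abs_self A) ?_ (abs_nonneg _) (abs_nonneg _)
    rw [add_re]
    exact abs_add_le _ _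

theorem shiftPair_gauss {s : ℝ} (hs : 0 < s) {c : ℂ} (hc : 0 ≤ c.re) :
    ShiftPair c (fun x : ℝ => gauss s (x - I * c)) (fun x : ℝ => gauss s x) := by
  have h1 := (stripGrowth_const 1 (-1) (c.re + 1)).mul_gauss hs (I * c)
  have h2 := (stripGrowth_const 1 (-1) 1).mul_gauss hs 0
  simp only [one_mul, sub_zero] at h1 h2
  exact StripDecay.shiftPair hc one_pos h1 h2 fun x => by simp

theorem half_mul_re (b : ℂ) : (b / 2).re = b.re / 2 ∧ (I * b / 2).im = b.re / 2 := by
  constructor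
  · rw [show b / 2 = (1 / 2 : ℝ) * b by push_cast; ring, re_ofReal_mul]; ring
  · rw [show (I * b / 2 : ℂ) = (1 / 2 : ℝ) * (I * b) by push_cast; ring, im_ofReal_mul]
    simp
    ring

/-- A shift by ib may leave the strip where φ_b is controlled, so it is made in two halves. After
the first, the functional equation replaces φ_b(x + ib/2) by (1 + e^{2πbx}) φ_b(x - ib/2), which can
be shifted by ib/2 again. The prefactor P and the centre d allow the lemma to be iterated. -/
theorem shiftPair_qdilog {b : ℂ} (hb : 0 < b.re) {P : ℂ → ℂ}
    (hP : ∀ c₁ c₂ : ℝ, StripGrowth P c₁ c₂)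
    (hP₁ : ∀ c₁ c₂ : ℝ, StripGrowth (fun z => P (z + I * b / 2)) c₁ c₂)
    (hP₂ : ∀ c₁ c₂ : ℝ, StripGrowth (fun z => P (z + I * b)) c₁ c₂)
    {s : ℝ} (hs : 0 < s) (d : ℂ) :
    ShiftPair b (fun x : ℝ => P x * qdilog b x * gauss s (x - (d + I * b)))
      (fun x : ℝ => P (x + I * b) * (1 + qParam b * exp (2 * Real.pi * b * x)) * qdilog b x *
        gauss s (x - d)) := by
  have hβ := inv_re_pos hb
  obtain ⟨hre, him⟩ := half_mul_re b
  -- Leaves a margin δ beyond both ends of each half shift, while Re b / 2 + δ remains below the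
  -- half width Re(b + 1/b)/2.
  set δ := (b⁻¹).re / 4 with hδ
  have hδ0 : 0 < δ := by linarith
  have hτ : 2 * (b.re / 2 + δ) < b.re + (b⁻¹).re := by linarith
  have g0 := stripGrowth_qdilog hb (d := 0) (c₁ := -δ) (c₂ := b.re / 2 + δ) hτ
    (by simp; linarith) (by simp)
  have g1 := stripGrowth_qdilog hb (d := -(I * b / 2)) (c₁ := -δ) (c₂ := b.re / 2 + δ) hτ
    (by rw [neg_im, him]; linarith) (by rw [neg_im, him]; linarith)
  have g2 := stripGrowth_qdilog hb (d := 0) (c₁ := -δ) (c₂ := δ) hτ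
    (by simp; linarith) (by simp; linarith)
  simp only [add_zero] at g0 g2
  have f0 := ((hP (-δ) (b.re / 2 + δ)).mul g0).mul_gauss hs (d + I * b)
  have f1 := (((hP₁ (-δ) (b.re / 2 + δ)).mul
    (stripGrowth_one_add_exp 1 (2 * Real.pi * b) _ _)).mul g1).mul_gauss hs (d + I * b / 2)
  have f2 := (((hP₂ (-δ) δ).mul
    (stripGrowth_one_add_exp (qParam b) (2 * Real.pi * b) _ _)).mul g2).mul_gauss hs d
  rw [← hre] at f0 f1
  have s1 := StripDecay.shiftPair (c := b / 2) (by rw [hre]; linarith) hδ0 f0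
    (f1.mono le_rfl (by rw [hre]; linarith)) fun x => by
      have h1 := qdilog_add_half hb x
      rw [show (x : ℂ) + I * (b / 2) = x + I * b / 2 by ring, h1, one_mul,
        show (x : ℂ) + I * b / 2 - (d + I * b) = x - (d + I * b / 2) by ring, ← sub_eq_add_neg]
      ring
  have s2 := StripDecay.shiftPair (c := b / 2) (by rw [hre]; linarith) hδ0 f1 f2
    fun x => by
      have h2 : 1 * exp (2 * Real.pi * b * (x + I * (b / 2))) =
          qParam b * exp (2 * Real.pi * b * x) := by
        rw [qParam, ← exp_add, one_mul]
        congr 1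
        ring
      rw [h2, show (x : ℂ) + I * (b / 2) + I * b / 2 = x + I * b by ring,
        show (x : ℂ) + I * (b / 2) + -(I * b / 2) = x by ring,
        show (x : ℂ) + I * (b / 2) - (d + I * b / 2) = x - d by ring]
  have := s1.trans s2
  rwa [add_halves] at this

theorem shiftPair_qdilog_one {b : ℂ} (hb : 0 < b.re) {s : ℝ} (hs : 0 < s) :
    ShiftPair b (fun x : ℝ => qdilog b x * gauss s (x - I * b))
      (fun x : ℝ => (1 + qParam b * exp (2 * Real.pi * b * x)) * qdilog b x * gauss s x) := by
  have := shiftPair_qdilog hb (P := fun _ => 1) (stripGrowth_const 1) (stripGrowth_const 1)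
    (stripGrowth_const 1) hs 0
  simpa only [one_mul, zero_add, sub_zero] using this

/-- Two shifts by ib. The second one also moves the factor 1 + q e^{2πbx} produced by the first, and
e^{2πb·ib} = q² turns its q into q³. -/
theorem shiftPair_qdilog_two {b : ℂ} (hb : 0 < b.re) {s : ℝ} (hs : 0 < s) :
    ShiftPair (2 * b) (fun x : ℝ => qdilog b x * gauss s (x - I * (2 * b)))
      (fun x : ℝ => (1 + qParam b * exp (2 * Real.pi * b * x)) *
        (1 + qParam b ^ 3 * exp (2 * Real.pi * b * x)) * qdilog b x * gauss s x) := by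
  have h1 := shiftPair_qdilog hb (P := fun _ => 1) (stripGrowth_const 1) (stripGrowth_const 1)
    (stripGrowth_const 1) hs (I * b)
  have hshift : ∀ w : ℂ, (fun z => 1 + qParam b * exp (2 * Real.pi * b * (z + w))) =
      fun z => 1 + (qParam b * exp (2 * Real.pi * b * w)) * exp (2 * Real.pi * b * z) := fun w => by
    funext z
    rw [mul_add, exp_add]
    ring
  have h2 := shiftPair_qdilog hb (P := fun z => 1 + qParam b * exp (2 * Real.pi * b * z))
    (stripGrowth_one_add_exp _ _) (by rw [hshift]; exact stripGrowth_one_add_exp _ _)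
    (by rw [hshift]; exact stripGrowth_one_add_exp _ _) hs 0
  simp only [one_mul, zero_add, sub_zero] at h1 h2
  have h3 := h1.trans h2
  rw [← two_mul] at h3
  have e1 : (2 * (I * b) : ℂ) = I * (2 * b) := by ring
  have e2 : ∀ x : ℝ, qParam b * exp (2 * Real.pi * b * (x + I * b)) =
      qParam b ^ 3 * exp (2 * Real.pi * b * x) := fun x => by
    rw [qParam, ← exp_nat_mul, ← exp_add, ← exp_add]
    congr 1
    push_cast
    ring
  convert h3 using 2 with x x
  · rw [← two_mul, e1]
  · rw [e2]; ring

end QLiouville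

end

/-! ### Functional calculus of a self-adjoint operator through its resolvent. -/

noncomputable section
namespace QLiouville

open MeasureTheory Filter Topology Set
open scoped InnerProductSpace

variable {H : Type*} [NormedAddCommGroup H] [InnerProductSpace ℂ H] [CompleteSpace H]

/-! ### The resolvents of a self-adjoint operator -/

/-- A closed subspace on which `L` is bounded below with dense image is parametrized by `L`. -/
theorem exists_section_of_bounded_below {g : Submodule ℂ (H × H)} (hg : IsClosed (g : Set (H × H)))
    (L : H × H →L[ℂ] H) {K : NNReal} (hK : ∀ p ∈ g, ‖p‖ ≤ K * ‖L p‖)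
    (hd : Dense (L '' (g : Set (H × H)))) :
    ∃ S : H →L[ℂ] H × H, (∀ v, S v ∈ g ∧ L (S v) = v) ∧ ∀ p ∈ g, S (L p) = p := by
  have : CompleteSpace g := hg.completeSpace_coe
  set L' : g →L[ℂ] H := L.comp g.subtypeL with hL'
  have hanti : AntilipschitzWith K L' := L'.antilipschitz_of_bound fun p => hK p p.2
  have hrange : range L' = L '' (g : Set (H × H)) := by
    ext v
    simp [hL']
  have hcl : IsClosed (range L') := hanti.isClosed_range L'.uniformContinuous
  have hsurj : Function.Surjective L' := by
    rw [← range_eq_univ, ← hcl.closure_eq, hrange]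
    exact hd.closure_eq
  set e := ContinuousLinearEquiv.ofBijective L' (LinearMap.ker_eq_bot.2 hanti.injective)
    (LinearMap.range_eq_top.2 hsurj)
  have he : ∀ p, e p = L' p := fun p => rfl
  refine ⟨g.subtypeL.comp (e.symm : H →L[ℂ] g), fun v => ⟨(e.symm v).2, ?_⟩, fun p hp => ?_⟩
  · have := e.apply_symm_apply v
    rwa [he] at this
  · have h1 : L p = e ⟨p, hp⟩ := rfl
    simp [h1]

theorem inner_apply_eq {A : H →ₗ.[ℂ] H} (hA : IsSelfAdjoint A) {x y x' y' : H}
    (h : (x, y) ∈ A.graph) (h' : (x', y') ∈ A.graph) : ⟪y, x'⟫_ℂ = ⟪x, y'⟫_ℂ := by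
  have h0 := LinearPMap.adjoint_isFormalAdjoint hA.dense_domain
  rw [LinearPMap.isSelfAdjoint_def.1 hA] at h0
  rw [LinearPMap.mem_graph_iff] at h h'
  obtain ⟨u, rfl, rfl⟩ := h
  obtain ⟨u', rfl, rfl⟩ := h'
  exact h0 u u'

/-- `R = (A + c)⁻¹` in terms of the graph of `A`. -/
structure IsShiftedInverse (A : H →ₗ.[ℂ] H) (c : ℂ) (R : H →L[ℂ] H) : Prop where
  mem : ∀ v, (R v, v - c • R v) ∈ A.graph
  apply_add : ∀ x y, (x, y) ∈ A.graph → R (y + c • x) = x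

/-- For c = ±i the cross terms cancel by symmetry, so ‖(A + c)x‖² = ‖Ax‖² + ‖x‖² and A + c is
bounded below on its closed graph. The range is dense because a vector orthogonal to it is an
eigenvector of A* = A with a non-real eigenvalue. -/
theorem exists_isShiftedInverse {A : H →ₗ.[ℂ] H} (hA : IsSelfAdjoint A) {c : ℂ}
    (hc : starRingEnd ℂ c = -c) (hc1 : ‖c‖ = 1) : ∃ R : H →L[ℂ] H, IsShiftedInverse A c R := by
  have hsq : ∀ p ∈ A.graph, ‖p.2 + c • p.1‖ ^ 2 = ‖p.2‖ ^ 2 + ‖p.1‖ ^ 2 := by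
    rintro ⟨x, y⟩ hp
    have h1 := inner_apply_eq hA hp hp
    have h2 : RCLike.re ⟪y, c • x⟫_ℂ = 0 := by
      have h3 : starRingEnd ℂ ⟪y, c • x⟫_ℂ = -⟪y, c • x⟫_ℂ := by
        rw [inner_conj_symm, inner_smul_left, inner_smul_right, hc, h1]
        ring
      have h4 := congrArg Complex.re h3
      rw [conj_re, neg_re] at h4
      change (⟪y, c • x⟫_ℂ).re = 0
      linarith
    rw [norm_add_sq (𝕜 := ℂ), h2, norm_smul, hc1]
    ring
  have hc0 : c ≠ 0 := norm_ne_zero_iff.1 (by rw [hc1]; exact one_ne_zero)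
  set L : H × H →L[ℂ] H := ContinuousLinearMap.snd ℂ H H + c • ContinuousLinearMap.fst ℂ H H
  have hL : ∀ p, L p = p.2 + c • p.1 := fun p => rfl
  obtain ⟨S, hS, hS'⟩ := exists_section_of_bounded_below (g := A.graph) (K := 1) hA.isClosed L
    (fun p hp => by
      have h := hsq p hp
      rw [NNReal.coe_one, one_mul, hL]
      refine max_le ?_ ?_ <;> refine le_of_sq_le_sq ?_ (norm_nonneg _) <;> rw [h] <;>
        nlinarith [sq_nonneg ‖p.1‖, sq_nonneg ‖p.2‖])
    (by
      have hM : Dense ((A.graph.map (L : H × H →ₗ[ℂ] H) : Submodule ℂ H) : Set H) := by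
        rw [Submodule.dense_iff_topologicalClosure_eq_top,
          Submodule.topologicalClosure_eq_top_iff, Submodule.eq_bot_iff]
        intro y hy
        rw [Submodule.mem_orthogonal'] at hy
        have hy' : ∀ x : A.domain, ⟪c • y, x⟫_ℂ = ⟪y, A x⟫_ℂ := by
          intro x
          have := hy (A x + c • (x : H)) ⟨((x : H), A x), A.mem_graph x, rfl⟩
          rw [inner_add_right, inner_smul_right] at this
          rw [inner_smul_left, hc]
          linear_combination -this
        have hdom := LinearPMap.mem_adjoint_domain_of_exists (T := A) y ⟨c • y, hy'⟩
        have hval := LinearPMap.adjoint_apply_eq hA.dense_domain ⟨y, hdom⟩ hy'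
        have hgr : (y, c • y) ∈ A.graph := by
          have : (y, c • y) ∈ (LinearPMap.adjoint A).graph :=
            hval ▸ LinearPMap.mem_graph _ (⟨y, hdom⟩ : (LinearPMap.adjoint A).domain)
          rwa [LinearPMap.isSelfAdjoint_def.1 hA] at this
        -- Since Ay = cy, the vector (A + c)y = 2cy lies in the range and is therefore orthogonal to
        -- y, which leaves y = 0.
        have := hy (c • y + c • y) ⟨(y, c • y), hgr, rfl⟩
        rw [← two_smul ℂ, inner_smul_right, inner_smul_right] at this
        simpa [hc0] using this
      simpa using hM)
  refine ⟨(ContinuousLinearMap.fst ℂ H H).comp S, fun v => ?_, fun x y h => ?_⟩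
  · obtain ⟨h1, h2⟩ := hS v
    rw [hL] at h2
    have : S v = ((S v).1, v - c • (S v).1) := Prod.ext rfl (eq_sub_of_add_eq h2)
    rw [this] at h1
    exact h1
  · have := hS' (x, y) h
    rw [hL] at this
    simp [this]

omit [CompleteSpace H] in
theorem isResolvent_iff {A : H →ₗ.[ℂ] H} {R : H →L[ℂ] H} :
    IsResolvent A R ↔ IsShiftedInverse A I R := by
  constructor
  · rintro ⟨h1, h2⟩
    refine ⟨fun v => ?_, fun x y h => ?_⟩
    · obtain ⟨hd, h⟩ := h1 v
      rw [LinearPMap.mem_graph_iff]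
      exact ⟨⟨R v, hd⟩, rfl, eq_sub_of_add_eq h⟩
    · rw [LinearPMap.mem_graph_iff] at h
      obtain ⟨u, rfl, rfl⟩ := h
      exact h2 u
  · rintro ⟨h1, h2⟩
    refine ⟨fun v => ?_, fun x => h2 _ _ (A.mem_graph x)⟩
    have h := h1 v
    rw [LinearPMap.mem_graph_iff] at h
    obtain ⟨u, hu, hu'⟩ := h
    simp only at hu hu'
    refine ⟨hu ▸ u.2, ?_⟩
    have h3 : (⟨R v, hu ▸ u.2⟩ : A.domain) = u := Subtype.ext hu.symm
    rw [h3, hu', sub_add_cancel]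

section Calculus

variable {A : H →ₗ.[ℂ] H}

theorem isShiftedInverse_opResolvent (hA : IsSelfAdjoint A) : IsShiftedInverse A I (opResolvent A) := by
  have h : ∃ R : H →L[ℂ] H, IsResolvent A R := by
    obtain ⟨R, hR⟩ := exists_isShiftedInverse hA (c := I) conj_I norm_I
    exact ⟨R, isResolvent_iff.2 hR⟩
  rw [opResolvent, dif_pos h]
  exact isResolvent_iff.1 h.choose_spec

theorem isShiftedInverse_star_opResolvent (hA : IsSelfAdjoint A) : IsShiftedInverse A (-I) (star (opResolvent A)) := by
  obtain ⟨R', hR'⟩ := exists_isShiftedInverse hA (c := -I) (by simp) (by simp)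
  have hR := isShiftedInverse_opResolvent hA
  have : R' = star (opResolvent A) := by
    rw [ContinuousLinearMap.star_eq_adjoint, ContinuousLinearMap.eq_adjoint_iff]
    intro u v
    have h1 := inner_apply_eq hA (hR'.mem u) (hR.mem v)
    rw [inner_sub_left, inner_sub_right, inner_smul_left, inner_smul_right, map_neg, conj_I,
      neg_neg] at h1
    linear_combination -h1
  rwa [this] at hR'

/-- The resolvent identity at i and -i; compared with its mirror image below it shows that R
commutes with R*. -/
theorem opResolvent_sub_star (hA : IsSelfAdjoint A) :
    opResolvent A - star (opResolvent A) = (-2 * I) • (star (opResolvent A) * opResolvent A) := by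
  have hR := isShiftedInverse_opResolvent hA
  have hR' := isShiftedInverse_star_opResolvent hA
  ext v
  have h1 := hR'.apply_add _ _ (hR.mem v)
  have h2 : v - I • opResolvent A v + (-I) • opResolvent A v = v - (2 * I) • opResolvent A v := by
    module
  rw [h2, map_sub, map_smul] at h1
  change opResolvent A v - star (opResolvent A) v =
    (-2 * I) • star (opResolvent A) (opResolvent A v)
  nth_rw 1 [← h1]
  module

theorem opResolvent_sub_star' (hA : IsSelfAdjoint A) :
    opResolvent A - star (opResolvent A) = (-2 * I) • (opResolvent A * star (opResolvent A)) := by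
  have hR := isShiftedInverse_opResolvent hA
  have hR' := isShiftedInverse_star_opResolvent hA
  ext v
  have h1 := hR.apply_add _ _ (hR'.mem v)
  have h2 : v - (-I) • star (opResolvent A) v + I • star (opResolvent A) v =
      v + (2 * I) • star (opResolvent A) v := by
    module
  rw [h2, map_add, map_smul] at h1
  change opResolvent A v - star (opResolvent A) v =
    (-2 * I) • opResolvent A (star (opResolvent A) v)
  nth_rw 1 [← h1]
  module

theorem isStarNormal_opResolvent (hA : IsSelfAdjoint A) : IsStarNormal (opResolvent A) := by
  have h := (opResolvent_sub_star hA).symm.trans (opResolvent_sub_star' hA)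
  exact ⟨smul_right_injective _ (by simp : (-2 * I : ℂ) ≠ 0) h⟩

theorem denseRange_opResolvent (hA : IsSelfAdjoint A) : DenseRange (opResolvent A) := by
  refine hA.dense_domain.mono fun x hx => ?_
  exact ⟨A ⟨x, hx⟩ + I • x, (isShiftedInverse_opResolvent hA).apply_add _ _ (A.mem_graph ⟨x, hx⟩)⟩

/-- The circle through `0` that is the image of the extended real line under `x ↦ (x + i)⁻¹`. -/
def resolventCircle : Set ℂ := {w | w - starRingEnd ℂ w = -2 * I * (starRingEnd ℂ w * w)}

/-- The identity R - R* = -2i R*R is an equality between two functions of the normal operator R,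
hence holds at every point of its spectrum. -/
theorem spectrum_opResolvent_subset (hA : IsSelfAdjoint A) : spectrum ℂ (opResolvent A) ⊆ resolventCircle := by
  have hn := isStarNormal_opResolvent hA
  have h1 : cfc (fun w : ℂ => w - star w) (opResolvent A) =
      cfc (fun w : ℂ => (-2 * I) • (star w * w)) (opResolvent A) := by
    rw [cfc_sub (fun w : ℂ => w) (fun w => star w) (opResolvent A), cfc_id' ℂ (opResolvent A),
      cfc_star_id (R := ℂ) (a := opResolvent A), cfc_smul (-2 * I) (fun w : ℂ => star w * w) (opResolvent A),
      cfc_mul (fun w : ℂ => star w) (fun w => w) (opResolvent A), cfc_id' ℂ (opResolvent A),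
      cfc_star_id (R := ℂ) (a := opResolvent A), opResolvent_sub_star hA]
  intro w hw
  have := eqOn_of_cfc_eq_cfc h1 (by fun_prop) (by fun_prop) hn hw
  simpa [resolventCircle, smul_eq_mul] using this

end Calculus

theorem inv_eq_of_mem_resolventCircle {w : ℂ} (hw : w ∈ resolventCircle) (h0 : w ≠ 0) :
    w⁻¹ = (w⁻¹).re + I := by
  have h : w - starRingEnd ℂ w = -2 * I * (starRingEnd ℂ w * w) := hw
  have hs : starRingEnd ℂ w ≠ 0 := by simpa using h0
  have h1 : (starRingEnd ℂ w)⁻¹ - w⁻¹ = -2 * I := by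
    field_simp
    linear_combination h
  rw [← map_inv₀] at h1
  have h2 := congrArg Complex.im h1
  simp only [sub_im, conj_im, neg_mul, neg_im, mul_im, re_ofNat, I_im, mul_one, im_ofNat, I_re,
    mul_zero, add_zero] at h2
  apply Complex.ext
  · simp
  · simp only [add_im, ofReal_im, I_im, zero_add]
    linarith

theorem ofReal_add_I_ne_zero (x : ℝ) : (x : ℂ) + I ≠ 0 := fun h => by
  simpa using congrArg Complex.im h

theorem inv_mem_resolventCircle (x : ℝ) : ((x : ℂ) + I)⁻¹ ∈ resolventCircle := by
  have h1 := ofReal_add_I_ne_zero x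
  have h2 : (x : ℂ) - I ≠ 0 := fun h => by simpa using congrArg Complex.im h
  change _ - _ = _
  rw [map_inv₀, map_add, conj_ofReal, conj_I, ← sub_eq_add_neg]
  field_simp
  ring

theorem zero_mem_resolventCircle : (0 : ℂ) ∈ resolventCircle := by simp [resolventCircle]

/-! ### Continuous functions vanishing at infinity -/

/-- Continuous functions on the line that vanish at infinity. -/
structure VanishAtInfty (g : ℝ → ℂ) : Prop where
  cont : Continuous g
  lim : Tendsto g (cocompact ℝ) (𝓝 0)

theorem VanishAtInfty.of_hasCompactSupport {g : ℝ → ℂ} (hg : Continuous g)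
    (hs : HasCompactSupport g) : VanishAtInfty g :=
  ⟨hg, hs.is_zero_at_infty⟩

theorem VanishAtInfty.mul_bdd {g f : ℝ → ℂ} (hg : VanishAtInfty g) (hf : Continuous f) {C : ℝ}
    (hC : ∀ x, ‖f x‖ ≤ C) : VanishAtInfty fun x => g x * f x := by
  refine ⟨hg.cont.mul hf, ?_⟩
  have h : Tendsto (fun x => ‖g x‖ * C) (cocompact ℝ) (𝓝 0) := by
    simpa using hg.lim.norm.mul_const C
  refine squeeze_zero_norm (fun x => ?_) h
  rw [norm_mul]
  gcongr
  exact hC x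

theorem VanishAtInfty.exists_bound {g : ℝ → ℂ} (hg : VanishAtInfty g) : ∃ C : ℝ, ∀ x, ‖g x‖ ≤ C := by
  have h1 : ∀ᶠ x in cocompact ℝ, ‖g x‖ ≤ 1 := by
    have := hg.lim.norm
    rw [norm_zero] at this
    exact (this.eventually_lt_const one_pos).mono fun x hx => hx.le
  obtain ⟨K, hK, hK'⟩ := mem_cocompact.1 h1
  obtain ⟨C, hC⟩ := hK.exists_bound_of_continuousOn hg.cont.continuousOn
  refine ⟨max C 1, fun x => ?_⟩
  by_cases hx : x ∈ K
  · exact (hC x hx).trans (le_max_left _ _)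
  · exact (show ‖g x‖ ≤ 1 from hK' hx).trans (le_max_right _ _)

theorem VanishAtInfty.mul {g f : ℝ → ℂ} (hg : VanishAtInfty g) (hf : VanishAtInfty f) :
    VanishAtInfty fun x => g x * f x := by
  obtain ⟨C, hC⟩ := hf.exists_bound
  exact hg.mul_bdd hf.cont hC

theorem VanishAtInfty.comp {g : ℝ → ℂ} (hg : VanishAtInfty g) {σ : ℝ → ℝ} (hσ : Continuous σ)
    (hσ' : Tendsto σ (cocompact ℝ) (cocompact ℝ)) : VanishAtInfty fun x => g (σ x) :=
  ⟨hg.cont.comp hσ, hg.lim.comp hσ'⟩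

theorem ofReal_sub_I_ne_zero (x : ℝ) : (x : ℂ) - I ≠ 0 := fun h => by
  simpa using congrArg Complex.im h

theorem vanishAtInfty_resolvent : VanishAtInfty fun x : ℝ => ((x : ℂ) + I)⁻¹ := by
  refine ⟨Continuous.inv₀ (by fun_prop) ofReal_add_I_ne_zero, ?_⟩
  have h : Tendsto (fun x : ℝ => ‖x‖⁻¹) (cocompact ℝ) (𝓝 0) :=
    tendsto_inv_atTop_zero.comp tendsto_norm_cocompact_atTop
  refine squeeze_zero_norm' ?_ h
  have h0 : ∀ᶠ x in cocompact ℝ, 0 < ‖x‖ := tendsto_norm_cocompact_atTop.eventually_gt_atTop 0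
  filter_upwards [h0] with x hx
  rw [norm_inv]
  refine inv_anti₀ hx ?_
  simpa using abs_re_le_norm ((x : ℂ) + I)

theorem vanishAtInfty_resolvent' : VanishAtInfty fun x : ℝ => ((x : ℂ) - I)⁻¹ := by
  have h : (fun x : ℝ => ((x : ℂ) - I)⁻¹) = fun x : ℝ => starRingEnd ℂ (((x : ℂ) + I)⁻¹) := by
    funext x
    simp [map_inv₀, sub_eq_add_neg]
  rw [h]
  refine ⟨Complex.continuous_conj.comp vanishAtInfty_resolvent.cont, ?_⟩
  have := (Complex.continuous_conj.tendsto 0).comp vanishAtInfty_resolvent.lim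
  simpa [Function.comp_def] using this

/-- The piecewise linear cutoff function, equal to `1` on `[-n, n]` and to `0` outside
`[-n-1, n+1]`. -/
def cutoff (n : ℕ) (x : ℝ) : ℂ := (max 0 (min 1 (n + 1 - |x|)) : ℝ)

theorem continuous_cutoff (n : ℕ) : Continuous (cutoff n) := by
  unfold cutoff
  fun_prop

theorem norm_cutoff_le (n : ℕ) (x : ℝ) : ‖cutoff n x‖ ≤ 1 := by
  rw [cutoff, norm_real, Real.norm_of_nonneg (le_max_left _ _)]
  exact max_le zero_le_one (min_le_left _ _)

theorem cutoff_eq_one {n : ℕ} {x : ℝ} (hx : |x| ≤ n) : cutoff n x = 1 := by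
  rw [cutoff, min_eq_left (by linarith), max_eq_right zero_le_one, ofReal_one]

theorem hasCompactSupport_cutoff (n : ℕ) : HasCompactSupport (cutoff n) := by
  refine HasCompactSupport.intro (isCompact_Icc (a := -((n : ℝ) + 1)) (b := n + 1)) fun x hx => ?_
  have : (n : ℝ) + 1 < |x| := by
    by_contra h
    exact hx (abs_le.1 (not_lt.1 h))
  rw [cutoff, max_eq_left ((min_le_right _ _).trans (by linarith)), ofReal_zero]

theorem vanishAtInfty_cutoff (n : ℕ) : VanishAtInfty (cutoff n) :=
  .of_hasCompactSupport (continuous_cutoff n) (hasCompactSupport_cutoff n)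

theorem VanishAtInfty.exists_cutoff {g : ℝ → ℂ} (hg : VanishAtInfty g) {ε : ℝ} (hε : 0 < ε) :
    ∃ N : ℕ, ∀ n ≥ N, ∀ x, ‖cutoff n x * g x - g x‖ ≤ ε := by
  have h1 : ∀ᶠ x in cocompact ℝ, ‖g x‖ ≤ ε / 2 := by
    have := hg.lim.norm
    rw [norm_zero] at this
    exact (this.eventually_lt_const (half_pos hε)).mono fun x hx => hx.le
  obtain ⟨K, hK, hK'⟩ := mem_cocompact.1 h1
  obtain ⟨R, hR⟩ := hK.isBounded.exists_norm_le
  obtain ⟨N, hN⟩ := exists_nat_ge R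
  refine ⟨N, fun n hn x => ?_⟩
  by_cases hx : x ∈ K
  · rw [cutoff_eq_one, one_mul, sub_self, norm_zero]
    · exact hε.le
    · have h2 := hR x hx
      rw [Real.norm_eq_abs] at h2
      exact h2.trans (hN.trans (by exact_mod_cast hn))
  · have h2 : ‖g x‖ ≤ ε / 2 := hK' hx
    refine (norm_sub_le _ _).trans ?_
    rw [norm_mul]
    have := mul_le_mul_of_nonneg_right (norm_cutoff_le n x) (norm_nonneg (g x))
    linarith

/-! ### The calculus for functions vanishing at infinity -/

open Classical in
/-- The function of the resolvent that corresponds to a function on the line. -/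
def onCircle (g : ℝ → ℂ) (w : ℂ) : ℂ := if w = 0 then 0 else g (w⁻¹).re

theorem onCircle_zero (g : ℝ → ℂ) : onCircle g 0 = 0 := if_pos rfl

theorem onCircle_of_ne (g : ℝ → ℂ) {w : ℂ} (hw : w ≠ 0) : onCircle g w = g (w⁻¹).re := if_neg hw

theorem ccCalc_eq (A : H →ₗ.[ℂ] H) (g : ℝ → ℂ) : ccCalc A g = cfc (onCircle g) (opResolvent A) := rfl

theorem tendsto_re_inv_resolventCircle :
    Tendsto (fun w : ℂ => (w⁻¹).re) (𝓝[resolventCircle \ {0}] 0) (cocompact ℝ) := by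
  rw [← Metric.cobounded_eq_cocompact, ← tendsto_norm_atTop_iff_cobounded]
  have h1 : Tendsto (fun w : ℂ => ‖w⁻¹‖ - 1) (𝓝[resolventCircle \ {0}] 0) atTop := by
    refine tendsto_atTop_add_const_right _ _ ?_
    exact (tendsto_norm_inv_nhdsNE_zero_atTop (α := ℂ)).mono_left (nhdsWithin_mono _ fun w hw => hw.2)
  refine tendsto_atTop_mono' _ ?_ h1
  filter_upwards [self_mem_nhdsWithin] with w hw
  have h2 := inv_eq_of_mem_resolventCircle hw.1 hw.2
  have h3 : ‖w⁻¹‖ ≤ ‖(((w⁻¹).re : ℝ) : ℂ)‖ + ‖I‖ := by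
    conv_lhs => rw [h2]
    exact norm_add_le _ _
  rw [norm_real, norm_I] at h3
  linarith

/-- The point w = 0 of the circle is the point at infinity of the line, so vanishing at infinity is
what makes the value 0 there a continuous extension. Without continuity on the spectrum `cfc` would
return its default value 0. -/
theorem VanishAtInfty.continuousOn_onCircle {g : ℝ → ℂ} (hg : VanishAtInfty g) :
    ContinuousOn (onCircle g) resolventCircle := by
  intro w hw
  by_cases h0 : w = 0
  · subst h0
    have h1 : ContinuousWithinAt (onCircle g) (resolventCircle \ {0}) 0 := by
      rw [ContinuousWithinAt, onCircle_zero]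
      refine (hg.lim.comp tendsto_re_inv_resolventCircle).congr' ?_
      filter_upwards [self_mem_nhdsWithin] with w hw
      exact (onCircle_of_ne g hw.2).symm
    exact continuousWithinAt_sdiff_self.1 h1
  · refine ContinuousAt.continuousWithinAt ?_
    have h1 : ContinuousAt (fun w : ℂ => g (w⁻¹).re) w :=
      hg.cont.continuousAt.comp (continuous_re.continuousAt.comp (continuousAt_inv₀ h0))
    refine h1.congr ?_
    filter_upwards [isOpen_ne.mem_nhds h0] with w hw
    exact (onCircle_of_ne g hw).symm

section Calculus

variable {A : H →ₗ.[ℂ] H}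

theorem VanishAtInfty.continuousOn_spectrum {g : ℝ → ℂ} (hg : VanishAtInfty g)
    (hA : IsSelfAdjoint A) : ContinuousOn (onCircle g) (spectrum ℂ (opResolvent A)) :=
  hg.continuousOn_onCircle.mono (spectrum_opResolvent_subset hA)

theorem ccCalc_congr (hA : IsSelfAdjoint A) {f : ℂ → ℂ} {g : ℝ → ℂ}
    (h : ∀ w ∈ resolventCircle, f w = onCircle g w) : ccCalc A g = cfc f (opResolvent A) :=
  cfc_congr fun w hw => (h w (spectrum_opResolvent_subset hA hw)).symm

theorem ccCalc_mul (hA : IsSelfAdjoint A) {g f : ℝ → ℂ} (hg : VanishAtInfty g)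
    (hf : VanishAtInfty f) : ccCalc A (fun x => g x * f x) = ccCalc A g * ccCalc A f := by
  have hn := isStarNormal_opResolvent hA
  rw [ccCalc_eq A g, ccCalc_eq A f, ← cfc_mul (onCircle g) (onCircle f) (opResolvent A)
    (hg.continuousOn_spectrum hA) (hf.continuousOn_spectrum hA)]
  refine ccCalc_congr hA fun w _ => ?_
  by_cases h0 : w = 0
  · simp [h0, onCircle_zero]
  · simp [onCircle_of_ne _ h0]

theorem ccCalc_sub (hA : IsSelfAdjoint A) {g f : ℝ → ℂ} (hg : VanishAtInfty g)
    (hf : VanishAtInfty f) : ccCalc A (fun x => g x - f x) = ccCalc A g - ccCalc A f := by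
  have hn := isStarNormal_opResolvent hA
  rw [ccCalc_eq A g, ccCalc_eq A f, ← cfc_sub (onCircle g) (onCircle f) (opResolvent A)
    (hg.continuousOn_spectrum hA) (hf.continuousOn_spectrum hA)]
  refine ccCalc_congr hA fun w _ => ?_
  by_cases h0 : w = 0
  · simp [h0, onCircle_zero]
  · simp [onCircle_of_ne _ h0]

theorem norm_ccCalc_le {g : ℝ → ℂ} {C : ℝ} (hC : 0 ≤ C) (h : ∀ x, ‖g x‖ ≤ C) :
    ‖ccCalc A g‖ ≤ C := by
  rw [ccCalc_eq]
  refine norm_cfc_le hC fun w _ => ?_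
  by_cases h0 : w = 0
  · simpa [h0, onCircle_zero] using hC
  · rw [onCircle_of_ne _ h0]
    exact h _

theorem onCircle_resolvent {w : ℂ} (hw : w ∈ resolventCircle) :
    onCircle (fun x : ℝ => ((x : ℂ) + I)⁻¹) w = w := by
  by_cases h0 : w = 0
  · simp [h0, onCircle_zero]
  · rw [onCircle_of_ne _ h0, ← inv_eq_of_mem_resolventCircle hw h0, inv_inv]

theorem ccCalc_resolvent (hA : IsSelfAdjoint A) :
    ccCalc A (fun x : ℝ => ((x : ℂ) + I)⁻¹) = opResolvent A := by
  have hn := isStarNormal_opResolvent hA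
  rw [ccCalc_congr hA (f := fun w => w) fun w hw => (onCircle_resolvent hw).symm]
  exact cfc_id' ℂ (opResolvent A)

theorem ccCalc_resolvent' (hA : IsSelfAdjoint A) :
    ccCalc A (fun x : ℝ => ((x : ℂ) - I)⁻¹) = star (opResolvent A) := by
  have hn := isStarNormal_opResolvent hA
  rw [ccCalc_congr hA (f := fun w => star w) fun w hw => ?_]
  · exact cfc_star_id (R := ℂ) (a := opResolvent A)
  · by_cases h0 : w = 0
    · simp [h0, onCircle_zero]
    · rw [onCircle_of_ne _ h0]
      have h1 := onCircle_resolvent hw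
      rw [onCircle_of_ne _ h0] at h1
      conv_lhs => rw [← h1]
      simp [sub_eq_add_neg]

omit [CompleteSpace H] in
theorem tendsto_of_tendsto_on_dense {T : ℕ → H →L[ℂ] H} {C : ℝ} (hT : ∀ n, ‖T n‖ ≤ C) {s : Set H}
    (hs : Dense s) (h : ∀ v ∈ s, Tendsto (fun n => T n v) atTop (𝓝 v)) (v : H) :
    Tendsto (fun n => T n v) atTop (𝓝 v) := by
  have hC : 0 ≤ C := (norm_nonneg _).trans (hT 0)
  rw [Metric.tendsto_atTop]
  intro ε hε
  -- The three errors T(v - u), Tu - u and v - u have total weight C + 1 + 1.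
  obtain ⟨u, hu, huv⟩ := Metric.mem_closure_iff.1 (hs v) (ε / (C + 2)) (by positivity)
  obtain ⟨N, hN⟩ := Metric.tendsto_atTop.1 (h u hu) (ε / (C + 2)) (by positivity)
  refine ⟨N, fun n hn => ?_⟩
  have h1 := hN n hn
  rw [dist_eq_norm] at huv h1 ⊢
  have h2 : T n v - v = T n (v - u) + (T n u - u) - (v - u) := by rw [map_sub]; abel
  rw [h2]
  have h3 : ‖T n (v - u)‖ ≤ C * ‖v - u‖ :=
    ((T n).le_opNorm _).trans (mul_le_mul_of_nonneg_right (hT n) (norm_nonneg _))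
  calc _ ≤ C * ‖v - u‖ + ‖T n u - u‖ + ‖v - u‖ :=
        (norm_sub_le _ _).trans (by gcongr; exact (norm_add_le _ _).trans (by gcongr))
    _ < C * (ε / (C + 2)) + ε / (C + 2) + ε / (C + 2) := by
        have := mul_le_mul_of_nonneg_left huv.le hC
        linarith
    _ = ε := by field_simp; ring

/-- On the range of the resolvent, χ_n(A)R - R is a function of A that is uniformly small because
1/(x + i) vanishes at infinity. That range contains the dense domain of A, and the cutoffs have norm
at most 1. -/
theorem tendsto_ccCalc_cutoff (hA : IsSelfAdjoint A) (v : H) :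
    Tendsto (fun n => ccCalc A (cutoff n) v) atTop (𝓝 v) := by
  refine tendsto_of_tendsto_on_dense (fun n => norm_ccCalc_le zero_le_one (norm_cutoff_le n))
    (denseRange_opResolvent hA) ?_ v
  rintro _ ⟨u, rfl⟩
  rw [Metric.tendsto_atTop]
  intro ε hε
  obtain ⟨N, hN⟩ := vanishAtInfty_resolvent.exists_cutoff
    (ε := ε / (‖u‖ + 1)) (by positivity)
  refine ⟨N, fun n hn => ?_⟩
  have h1 := ccCalc_mul hA (vanishAtInfty_cutoff n) vanishAtInfty_resolvent
  have h2 := ccCalc_sub hA ((vanishAtInfty_cutoff n).mul vanishAtInfty_resolvent)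
    vanishAtInfty_resolvent
  have h3 := norm_ccCalc_le (A := A) (by positivity) (hN n hn)
  rw [h2, h1, ccCalc_resolvent hA] at h3
  rw [dist_eq_norm]
  calc _ = ‖(ccCalc A (cutoff n) * opResolvent A - opResolvent A) u‖ := rfl
    _ ≤ ε / (‖u‖ + 1) * ‖u‖ := ((_ : H →L[ℂ] H).le_opNorm u).trans (by gcongr)
    _ < ε / (‖u‖ + 1) * (‖u‖ + 1) := by gcongr; linarith
    _ = ε := by field_simp

/-! ### The graph of a function of a self-adjoint operator -/

theorem mem_calcGraph {f : ℝ → ℂ} {v y : H} : (v, y) ∈ calcGraph A f ↔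
    ∀ g : ℝ → ℂ, Continuous g → HasCompactSupport g →
      ccCalc A g y = ccCalc A (fun x => g x * f x) v := Iff.rfl

/-- A pair (0, y) in the subspace satisfies χ_n(A)y = 0 for all cutoffs, hence y = 0. The subspace
is therefore single-valued and `toLinearPMap` does not lose anything. -/
theorem graph_opFun (hA : IsSelfAdjoint A) (f : ℝ → ℂ) : (opFun A f).graph = calcGraph A f := by
  refine Submodule.toLinearPMap_graph_eq _ ?_
  rintro ⟨v, y⟩ h (rfl : v = 0)
  have h1 : ∀ n, ccCalc A (cutoff n) y = 0 := fun n => by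
    rw [mem_calcGraph.1 h _ (continuous_cutoff n) (hasCompactSupport_cutoff n), map_zero]
  have h2 := tendsto_ccCalc_cutoff hA y
  simp only [h1] at h2
  exact tendsto_nhds_unique h2 tendsto_const_nhds

theorem isClosed_calcGraph (f : ℝ → ℂ) : IsClosed (calcGraph A f : Set (H × H)) := by
  have : (calcGraph A f : Set (H × H)) = ⋂ (g : ℝ → ℂ) (_ : Continuous g) (_ : HasCompactSupport g),
      {p | ccCalc A g p.2 = ccCalc A (fun x => g x * f x) p.1} := by
    ext p
    simp only [mem_iInter]
    rfl
  rw [this]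
  refine isClosed_iInter fun g => isClosed_iInter fun _ => isClosed_iInter fun _ => ?_
  exact isClosed_eq (by fun_prop) (by fun_prop)

theorem VanishAtInfty.of_mul {g f : ℝ → ℂ} (hg : Continuous g) (hs : HasCompactSupport g)
    (hf : Continuous f) : VanishAtInfty fun x => g x * f x :=
  .of_hasCompactSupport (hg.mul hf) hs.mul_right

/-- For h continuous, g h is again an admissible test function whenever g is; testing the first
membership with g h gives the product. -/
theorem calcGraph_comp {f h : ℝ → ℂ} (hh : Continuous h) {v y z : H} (h₁ : (v, y) ∈ calcGraph A f)
    (h₂ : (y, z) ∈ calcGraph A h) : (v, z) ∈ calcGraph A fun x => h x * f x := by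
  intro g hg hs
  have e1 := mem_calcGraph.1 h₂ g hg hs
  have e2 := mem_calcGraph.1 h₁ (fun x => g x * h x) (hg.mul hh) hs.mul_right
  simp only at e1 e2 ⊢
  rw [e1, e2]
  simp only [mul_assoc]

theorem calcGraph_of_comp {f h : ℝ → ℂ} (hh : Continuous h) {v y z : H}
    (h₁ : (v, y) ∈ calcGraph A f) (h₂ : (v, z) ∈ calcGraph A fun x => h x * f x) :
    (y, z) ∈ calcGraph A h := by
  intro g hg hs
  have e1 := mem_calcGraph.1 h₂ g hg hs
  have e2 := mem_calcGraph.1 h₁ (fun x => g x * h x) (hg.mul hh) hs.mul_right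
  simp only at e1 e2 ⊢
  rw [e1, e2]
  simp only [mul_assoc]

theorem ccCalc_mem_calcGraph (hA : IsSelfAdjoint A) {f g : ℝ → ℂ} (hf : Continuous f)
    (hg : VanishAtInfty g) (hgf : VanishAtInfty fun x => f x * g x) (v : H) :
    (ccCalc A g v, ccCalc A (fun x => f x * g x) v) ∈ calcGraph A f := by
  intro k hk hs
  have hk' := VanishAtInfty.of_hasCompactSupport hk hs
  change (ccCalc A k * ccCalc A (fun x => f x * g x)) v =
    (ccCalc A (fun x => k x * f x) * ccCalc A g) v
  rw [← ccCalc_mul hA hk' hgf, ← ccCalc_mul hA (.of_mul hk hs hf) hg]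
  simp only [mul_assoc]

theorem cutoff_mem_calcGraph (hA : IsSelfAdjoint A) {f : ℝ → ℂ} (hf : Continuous f) (n : ℕ) (v : H) :
    (ccCalc A (cutoff n) v, ccCalc A (fun x => f x * cutoff n x) v) ∈ calcGraph A f :=
  ccCalc_mem_calcGraph hA hf (vanishAtInfty_cutoff n)
    (.of_hasCompactSupport (hf.mul (continuous_cutoff n)) (hasCompactSupport_cutoff n).mul_left) v

theorem norm_le_of_mem_calcGraph (hA : IsSelfAdjoint A) {f : ℝ → ℂ} {C : ℝ} (hC : ∀ x, ‖f x‖ ≤ C)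
    {v y : H} (h : (v, y) ∈ calcGraph A f) : ‖y‖ ≤ C * ‖v‖ := by
  have hC0 : 0 ≤ C := (norm_nonneg _).trans (hC 0)
  refine le_of_tendsto (tendsto_ccCalc_cutoff hA y).norm (.of_forall fun n => ?_)
  rw [mem_calcGraph.1 h _ (continuous_cutoff n) (hasCompactSupport_cutoff n)]
  refine (ContinuousLinearMap.le_opNorm _ _).trans ?_
  gcongr
  refine norm_ccCalc_le hC0 fun x => ?_
  rw [norm_mul]
  exact (mul_le_mul (norm_cutoff_le n x) (hC x) (norm_nonneg _) zero_le_one).trans (one_mul C).le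

/-- The graph is closed, bounded by C, and contains the cutoff pairs, whose first components are
dense; hence it is the graph of an everywhere defined operator. -/
theorem exists_bounded_calc (hA : IsSelfAdjoint A) {f : ℝ → ℂ} (hf : Continuous f) {C : ℝ}
    (hC : ∀ x, ‖f x‖ ≤ C) : ∃ T : H →L[ℂ] H, ∀ v, (v, T v) ∈ calcGraph A f := by
  have hC0 : 0 ≤ C := (norm_nonneg _).trans (hC 0)
  obtain ⟨S, hS, -⟩ := exists_section_of_bounded_below (g := calcGraph A f) (isClosed_calcGraph f)
    (ContinuousLinearMap.fst ℂ H H) (K := ⟨max 1 C, zero_le_one.trans (le_max_left _ _)⟩)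
    (fun p hp => max_le
      (le_mul_of_one_le_left (norm_nonneg _) (le_max_left _ _))
      ((norm_le_of_mem_calcGraph hA hC hp).trans (mul_le_mul_of_nonneg_right (le_max_right _ _)
        (norm_nonneg _))))
    (fun v => mem_closure_of_tendsto (tendsto_ccCalc_cutoff hA v) (.of_forall fun n =>
      ⟨_, cutoff_mem_calcGraph hA hf n v, rfl⟩))
  refine ⟨(ContinuousLinearMap.snd ℂ H H).comp S, fun v => ?_⟩
  obtain ⟨h1, h2⟩ := hS v
  have h3 : S v = (v, (S v).2) := Prod.ext h2 rfl
  rw [h3] at h1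
  exact h1

open Classical in
/-- `f(A)` as a bounded operator, for a bounded continuous function `f`. -/
def boundedCalc (A : H →ₗ.[ℂ] H) (f : ℝ → ℂ) : H →L[ℂ] H :=
  if h : ∃ T : H →L[ℂ] H, ∀ v, (v, T v) ∈ calcGraph A f then h.choose else 0

/-- Bounded continuous functions on the line. -/
structure BddCont (f : ℝ → ℂ) : Prop where
  cont : Continuous f
  bdd : ∃ C : ℝ, ∀ x, ‖f x‖ ≤ C

theorem VanishAtInfty.bddCont {f : ℝ → ℂ} (hf : VanishAtInfty f) : BddCont f :=
  ⟨hf.cont, hf.exists_bound⟩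

theorem BddCont.mul {f g : ℝ → ℂ} (hf : BddCont f) (hg : BddCont g) :
    BddCont fun x => f x * g x := by
  obtain ⟨C, hC⟩ := hf.bdd
  obtain ⟨D, hD⟩ := hg.bdd
  exact ⟨hf.cont.mul hg.cont, C * D, fun x => by
    rw [norm_mul]
    exact mul_le_mul (hC x) (hD x) (norm_nonneg _) ((norm_nonneg _).trans (hC x))⟩

theorem bddCont_const (c : ℂ) : BddCont fun _ => c := ⟨continuous_const, ‖c‖, fun _ => le_rfl⟩

theorem bddCont_exp (s : ℝ) : BddCont fun x : ℝ => exp (I * s * x) :=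
  ⟨by fun_prop, 1, fun x => by
    rw [show I * s * x = (s * x : ℝ) * I by push_cast; ring, norm_exp_ofReal_mul_I]⟩

theorem boundedCalc_mem (hA : IsSelfAdjoint A) {f : ℝ → ℂ} (hf : BddCont f) (v : H) :
    (v, boundedCalc A f v) ∈ calcGraph A f := by
  obtain ⟨C, hC⟩ := hf.bdd
  have h := exists_bounded_calc hA hf.cont hC
  rw [boundedCalc, dif_pos h]
  exact h.choose_spec v

theorem calcGraph_unique (hA : IsSelfAdjoint A) {f : ℝ → ℂ} {v y z : H} (h : (v, y) ∈ calcGraph A f)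
    (h' : (v, z) ∈ calcGraph A f) : y = z := by
  rw [← graph_opFun hA] at h h'
  exact LinearPMap.mem_graph_snd_inj _ h h' rfl

theorem mem_calcGraph_iff (hA : IsSelfAdjoint A) {f : ℝ → ℂ} (hf : BddCont f) {v y : H} :
    (v, y) ∈ calcGraph A f ↔ y = boundedCalc A f v :=
  ⟨fun h => calcGraph_unique hA h (boundedCalc_mem hA hf v), fun h => h ▸ boundedCalc_mem hA hf v⟩

omit [CompleteSpace H] in
theorem mem_graph_ofBounded {T : H →L[ℂ] H} {v y : H} : (v, y) ∈ (ofBounded T).graph ↔ y = T v := by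
  rw [LinearPMap.mem_graph_iff]
  constructor
  · rintro ⟨u, rfl, rfl⟩
    rfl
  · rintro rfl
    exact ⟨⟨v, trivial⟩, rfl, rfl⟩

theorem opFun_eq_ofBounded (hA : IsSelfAdjoint A) {f : ℝ → ℂ} (hf : BddCont f) :
    opFun A f = ofBounded (boundedCalc A f) := by
  refine LinearPMap.eq_of_eq_graph (Submodule.ext ?_)
  rintro ⟨v, y⟩
  rw [graph_opFun hA, mem_calcGraph_iff hA hf, mem_graph_ofBounded]

theorem boundedCalc_mul (hA : IsSelfAdjoint A) {f g : ℝ → ℂ} (hf : BddCont f) (hg : BddCont g) :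
    boundedCalc A (fun x => f x * g x) = boundedCalc A f * boundedCalc A g := by
  ext v
  exact ((mem_calcGraph_iff hA (hf.mul hg)).1
    (calcGraph_comp hf.cont (boundedCalc_mem hA hg v) (boundedCalc_mem hA hf _))).symm

theorem boundedCalc_one (hA : IsSelfAdjoint A) : boundedCalc A (fun _ => 1) = 1 := by
  ext v
  refine ((mem_calcGraph_iff hA (bddCont_const 1)).1 ?_).symm
  intro g _ _
  simp

theorem boundedCalc_eq_ccCalc (hA : IsSelfAdjoint A) {g : ℝ → ℂ} (hg : VanishAtInfty g) :
    boundedCalc A g = ccCalc A g := by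
  ext v
  refine ((mem_calcGraph_iff hA hg.bddCont).1 ?_).symm
  intro k hk hs
  change (ccCalc A k * ccCalc A g) v = _
  rw [← ccCalc_mul hA (.of_hasCompactSupport hk hs) hg]

theorem norm_boundedCalc_apply_le (hA : IsSelfAdjoint A) {f : ℝ → ℂ} (hf : Continuous f) {C : ℝ}
    (hC : ∀ x, ‖f x‖ ≤ C) (v : H) : ‖boundedCalc A f v‖ ≤ C * ‖v‖ :=
  norm_le_of_mem_calcGraph hA hC (boundedCalc_mem hA ⟨hf, C, hC⟩ v)

end Calculus

/-! ### Intertwining operators -/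

theorem isCompact_resolventCircle : IsCompact resolventCircle := by
  refine Metric.isCompact_of_isClosed_isBounded (isClosed_eq (by fun_prop) (by fun_prop)) ?_
  refine (Metric.isBounded_closedBall (x := (0 : ℂ)) (r := 1)).subset fun w hw => ?_
  have h : w - starRingEnd ℂ w = -2 * I * (starRingEnd ℂ w * w) := hw
  rw [mem_closedBall_zero_iff]
  have h1 := congrArg norm h
  have h2 : ‖w - starRingEnd ℂ w‖ ≤ 2 * ‖w‖ := by
    refine (norm_sub_le _ _).trans (le_of_eq ?_)
    rw [RCLike.norm_conj]
    ring
  have h3 : ‖-2 * I * (starRingEnd ℂ w * w)‖ = 2 * ‖w‖ ^ 2 := by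
    rw [norm_mul, norm_mul, norm_mul, RCLike.norm_conj, norm_I, norm_neg]
    norm_num
    ring
  rw [h1, h3] at h2
  by_contra hlt
  push Not at hlt
  nlinarith

/-- The bounded operator `T` satisfies `T A = σ(A') T`, in terms of the functional calculus. -/
def Intertwines (A A' : H →ₗ.[ℂ] H) (σ : ℝ ≃ₜ ℝ) (T : H →L[ℂ] H) : Prop :=
  ∀ g : ℝ → ℂ, VanishAtInfty g → T * ccCalc A g = ccCalc A' (fun x => g (σ x)) * T

theorem VanishAtInfty.comp_homeomorph {g : ℝ → ℂ} (hg : VanishAtInfty g) (σ : ℝ ≃ₜ ℝ) :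
    VanishAtInfty fun x => g (σ x) :=
  hg.comp σ.continuous σ.isClosedEmbedding.tendsto_cocompact

theorem onCircle_resolvent_mem (σ : ℝ → ℝ) (w : ℂ) :
    onCircle (fun x => ((σ x : ℂ) + I)⁻¹) w ∈ resolventCircle := by
  by_cases h0 : w = 0
  · rw [h0, onCircle_zero]
    exact zero_mem_resolventCircle
  · rw [onCircle_of_ne _ h0]
    exact inv_mem_resolventCircle _

theorem onCircle_onCircle (g : ℝ → ℂ) (σ : ℝ → ℝ) (w : ℂ) :
    onCircle g (onCircle (fun x => ((σ x : ℂ) + I)⁻¹) w) = onCircle (fun x => g (σ x)) w := by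
  by_cases h0 : w = 0
  · simp [h0, onCircle_zero]
  · rw [onCircle_of_ne _ h0, onCircle_of_ne _ h0,
      onCircle_of_ne _ (inv_ne_zero (ofReal_add_I_ne_zero _)), inv_inv]
    simp

/-- Stone–Weierstrass on the compact circle: the functions u for which T intertwines form a closed
algebra containing the constants, the coordinate and its conjugate. Both hypotheses are required
because T need not be unitary, so the relation for R* is not the adjoint of the one for R. -/
theorem intertwines_of_resolvent {A A' : H →ₗ.[ℂ] H} (hA : IsSelfAdjoint A) (hA' : IsSelfAdjoint A')
    {σ : ℝ ≃ₜ ℝ} {T : H →L[ℂ] H}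
    (h₁ : T * opResolvent A = ccCalc A' (fun x => ((σ x : ℂ) + I)⁻¹) * T)
    (h₂ : T * star (opResolvent A) = ccCalc A' (fun x => ((σ x : ℂ) - I)⁻¹) * T) :
    Intertwines A A' σ T := by
  intro g hg
  have hn := isStarNormal_opResolvent hA
  have hn' := isStarNormal_opResolvent hA'
  have : CompactSpace resolventCircle := isCompact_iff_compactSpace.1 isCompact_resolventCircle
  have hσv := vanishAtInfty_resolvent.comp_homeomorph σ
  let ι : C(spectrum ℂ (opResolvent A), resolventCircle) :=
    ⟨fun w => ⟨w, spectrum_opResolvent_subset hA w.2⟩, by fun_prop⟩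
  -- This is σ transported to the circle: the point (x + i)⁻¹ goes to (σ(x) + i)⁻¹, and infinity is
  -- fixed.
  let ι' : C(spectrum ℂ (opResolvent A'), resolventCircle) :=
    ⟨fun w => ⟨onCircle (fun x => ((σ x : ℂ) + I)⁻¹) w, onCircle_resolvent_mem σ w⟩,
      Continuous.subtype_mk (continuousOn_iff_continuous_domRestrict.1
        (hσv.continuousOn_spectrum hA')) _⟩
  have e1 : ∀ u : C(resolventCircle, ℂ), ∀ f : ℂ → ℂ, ContinuousOn f (spectrum ℂ (opResolvent A)) →
      (∀ w : spectrum ℂ (opResolvent A), u (ι w) = f w) →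
      cfcHom hn (u.comp ι) = cfc f (opResolvent A) := by
    intro u f hf h
    rw [cfc_apply f (opResolvent A) hn hf]
    congr 1
    ext w
    exact h w
  have e2 : ∀ u : C(resolventCircle, ℂ), ∀ f : ℝ → ℂ, VanishAtInfty f →
      (∀ w : spectrum ℂ (opResolvent A'), u (ι' w) = onCircle f w) →
      cfcHom hn' (u.comp ι') = ccCalc A' f := by
    intro u f hf h
    rw [ccCalc_eq, cfc_apply (onCircle f) (opResolvent A') hn' (hf.continuousOn_spectrum hA')]
    congr 1
    ext w
    exact h w
  have key : ∀ u : C(resolventCircle, ℂ),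
      T * cfcHom hn (u.comp ι) = cfcHom hn' (u.comp ι') * T := by
    intro u
    induction u using ContinuousMap.induction_on_of_compact with
    | const r =>
      have e3 : cfcHom hn ((ContinuousMap.const resolventCircle r).comp ι) = algebraMap ℂ _ r :=
        AlgHomClass.commutes (cfcHom hn) r
      have e4 : cfcHom hn' ((ContinuousMap.const resolventCircle r).comp ι') = algebraMap ℂ _ r :=
        AlgHomClass.commutes (cfcHom hn') r
      rw [e3, e4]
      exact (Algebra.commutes r T).symm
    | id =>
      rw [e1 _ (fun w => w) (by fun_prop) fun w => rfl, e2 _ _ hσv fun w => rfl,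
        cfc_id' ℂ (opResolvent A)]
      exact h₁
    | star_id =>
      rw [e1 _ (fun w => star w) (by fun_prop) fun w => rfl,
        e2 _ _ (vanishAtInfty_resolvent'.comp_homeomorph σ) fun w => ?_,
        cfc_star_id (R := ℂ) (a := opResolvent A)]
      · exact h₂
      · change star (onCircle (fun x => ((σ x : ℂ) + I)⁻¹) w) = _
        by_cases h0 : (w : ℂ) = 0
        · simp [h0, onCircle_zero]
        · rw [onCircle_of_ne _ h0, onCircle_of_ne _ h0]
          simp [sub_eq_add_neg]
    | add f g hf hg =>
      have e3 : cfcHom hn ((f + g).comp ι) = cfcHom hn (f.comp ι) + cfcHom hn (g.comp ι) :=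
        map_add (cfcHom (R := ℂ) hn) (f.comp ι) (g.comp ι)
      have e4 : cfcHom hn' ((f + g).comp ι') = cfcHom hn' (f.comp ι') + cfcHom hn' (g.comp ι') :=
        map_add (cfcHom (R := ℂ) hn') (f.comp ι') (g.comp ι')
      rw [e3, e4, mul_add, add_mul, hf, hg]
    | mul f g hf hg =>
      have e3 : cfcHom hn ((f * g).comp ι) = cfcHom hn (f.comp ι) * cfcHom hn (g.comp ι) :=
        map_mul (cfcHom (R := ℂ) hn) (f.comp ι) (g.comp ι)
      have e4 : cfcHom hn' ((f * g).comp ι') = cfcHom hn' (f.comp ι') * cfcHom hn' (g.comp ι') :=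
        map_mul (cfcHom (R := ℂ) hn') (f.comp ι') (g.comp ι')
      rw [e3, e4, ← mul_assoc, hf, mul_assoc, hg, mul_assoc]
    | frequently f hf =>
      have hcl : IsClosed {u : C(resolventCircle, ℂ) |
          T * cfcHom hn (u.comp ι) = cfcHom hn' (u.comp ι') * T} := by
        refine isClosed_eq ?_ ?_
        · exact continuous_const.mul
            ((cfcHom_continuous hn).comp (ContinuousMap.continuous_precomp ι))
        · exact ((cfcHom_continuous hn').comp (ContinuousMap.continuous_precomp ι')).mul
            continuous_const
      exact hcl.mem_of_frequently_of_tendsto hf tendsto_id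
  have h := key ⟨resolventCircle.domRestrict (onCircle g),
    continuousOn_iff_continuous_domRestrict.1 hg.continuousOn_onCircle⟩
  rw [e1 _ (onCircle g) (hg.continuousOn_spectrum hA) fun w => rfl,
    e2 _ _ (hg.comp_homeomorph σ) fun w => onCircle_onCircle g σ w] at h
  exact h

/-- A test function g for A' is pulled back to g ∘ σ⁻¹, a test function for A since σ is a
homeomorphism. -/
theorem Intertwines.mem_calcGraph {A A' : H →ₗ.[ℂ] H} {σ : ℝ ≃ₜ ℝ} {T : H →L[ℂ] H}
    (hT : Intertwines A A' σ T) {f : ℝ → ℂ} (hf : Continuous f) {v y : H}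
    (h : (v, y) ∈ calcGraph A f) : (T v, T y) ∈ calcGraph A' fun x => f (σ x) := by
  intro g hg hs
  have hg' : Continuous fun x => g (σ.symm x) := hg.comp σ.symm.continuous
  have hs' : HasCompactSupport fun x => g (σ.symm x) := hs.comp_homeomorph σ.symm
  have e1 := QLiouville.mem_calcGraph.1 h _ hg' hs'
  have e2 := hT _ (.of_hasCompactSupport hg' hs')
  have e3 := hT _ (.of_mul hg' hs' hf)
  simp only [Homeomorph.symm_apply_apply] at e2 e3
  change (ccCalc A' g * T) y = (ccCalc A' (fun x => g x * f (σ x)) * T) v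
  rw [← e2, ← e3]
  exact congrArg T e1

theorem Intertwines.boundedCalc_eq {A A' : H →ₗ.[ℂ] H} (hA : IsSelfAdjoint A)
    (hA' : IsSelfAdjoint A') {σ : ℝ ≃ₜ ℝ} {T : H →L[ℂ] H} (hT : Intertwines A A' σ T) {f : ℝ → ℂ}
    (hf : BddCont f) : T * boundedCalc A f = boundedCalc A' (fun x => f (σ x)) * T := by
  ext v
  have hf' : BddCont fun x => f (σ x) :=
    ⟨hf.cont.comp σ.continuous, hf.bdd.imp fun C hC x => hC _⟩
  exact (mem_calcGraph_iff hA' hf').1 (hT.mem_calcGraph hf.cont (boundedCalc_mem hA hf v))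

/-! ### Fourier integrals in the functional calculus -/

/-- The unitary operator `e^{i t A}` as a bounded operator. -/
def expI (A : H →ₗ.[ℂ] H) (t : ℝ) : H →L[ℂ] H := boundedCalc A fun x => exp (I * t * x)

section Fourier

variable {A : H →ₗ.[ℂ] H}

theorem unitaryGroup_eq (hA : IsSelfAdjoint A) (t : ℝ) : unitaryGroup A t = ofBounded (expI A t) :=
  opFun_eq_ofBounded hA (bddCont_exp t)

theorem norm_exp_I_mul (t x : ℝ) : ‖exp (I * t * x)‖ = 1 := by
  rw [show I * t * x = (t * x : ℝ) * I by push_cast; ring, norm_exp_ofReal_mul_I]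

theorem norm_expI_apply_le (hA : IsSelfAdjoint A) (t : ℝ) (v : H) : ‖expI A t v‖ ≤ ‖v‖ := by
  have := norm_boundedCalc_apply_le hA (f := fun x : ℝ => exp (I * t * x)) (by fun_prop) (C := 1)
    (fun x => (norm_exp_I_mul t x).le) v
  rwa [one_mul] at this

/-- Joint continuity in (t, w) is what permits exchanging `cfc` with the integral over t. The
characters oscillate without limit as x → ∞, so continuity at w = 0 comes entirely from the damping
factor g. -/
theorem continuousOn_onCircle_exp {g a : ℝ → ℂ} (hg : VanishAtInfty g) (ha : Continuous a) :
    ContinuousOn (Function.uncurry fun t : ℝ => onCircle fun x => g x * (a t * exp (I * t * x)))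
      (univ ×ˢ resolventCircle) := by
  rintro ⟨t, w⟩ ⟨-, hw⟩
  by_cases h0 : w = 0
  · subst h0
    rw [ContinuousWithinAt, Function.uncurry_apply_pair, onCircle_zero]
    have h1 : Tendsto (fun p : ℝ × ℂ => ‖onCircle g p.2‖ * ‖a p.1‖)
        (𝓝[univ ×ˢ resolventCircle] (t, 0)) (𝓝 0) := by
      have h2 : ContinuousWithinAt (fun p : ℝ × ℂ => onCircle g p.2) (univ ×ˢ resolventCircle)
          (t, 0) :=
        ContinuousWithinAt.comp (g := onCircle g) (f := Prod.snd) (t := resolventCircle)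
          (hg.continuousOn_onCircle 0 hw) continuousWithinAt_snd fun p hp => hp.2
      have h3 : ContinuousWithinAt (fun p : ℝ × ℂ => a p.1) (univ ×ˢ resolventCircle) (t, 0) :=
        (ha.comp continuous_fst).continuousWithinAt
      have h4 : ContinuousWithinAt (fun p : ℝ × ℂ => ‖onCircle g p.2‖ * ‖a p.1‖) _ _ :=
        h2.norm.mul h3.norm
      rw [ContinuousWithinAt] at h4
      simpa only [Pi.mul_apply, onCircle_zero, norm_zero, zero_mul] using h4
    refine squeeze_zero_norm (fun p => ?_) h1
    obtain ⟨s, w⟩ := p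
    simp only [Function.uncurry_apply_pair]
    by_cases hw0 : w = 0
    · simp [hw0, onCircle_zero]
    · rw [onCircle_of_ne _ hw0, onCircle_of_ne _ hw0, norm_mul, norm_mul, norm_exp_I_mul, mul_one]
  · refine ContinuousAt.continuousWithinAt ?_
    have hre : ContinuousAt (fun p : ℝ × ℂ => (p.2⁻¹).re) (t, w) :=
      continuous_re.continuousAt.comp (continuousAt_snd.inv₀ h0)
    have h1 : ContinuousAt (fun p : ℝ × ℂ => g (p.2⁻¹).re *
        (a p.1 * exp (I * p.1 * (p.2⁻¹).re))) (t, w) := by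
      refine ContinuousAt.mul (hg.cont.continuousAt.comp hre) (ContinuousAt.mul
        (ha.continuousAt.comp continuousAt_fst) (ContinuousAt.cexp (ContinuousAt.mul ?_ ?_)))
      · exact continuousAt_const.mul (continuous_ofReal.continuousAt.comp continuousAt_fst)
      · exact continuous_ofReal.continuousAt.comp hre
    refine h1.congr ?_
    have : ∀ᶠ p : ℝ × ℂ in 𝓝 (t, w), p.2 ≠ 0 :=
      continuousAt_snd.eventually_ne h0
    filter_upwards [this] with p hp
    exact (onCircle_of_ne (fun x => g x * (a p.1 * exp (I * p.1 * x))) hp).symm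

theorem bound_onCircle_exp {g a : ℝ → ℂ} {C : ℝ} (hC : ∀ x, ‖g x‖ ≤ C) (t : ℝ) (w : ℂ) :
    ‖onCircle (fun x => g x * (a t * exp (I * t * x))) w‖ ≤ C * ‖a t‖ := by
  have hC0 : 0 ≤ C := (norm_nonneg _).trans (hC 0)
  by_cases hw0 : w = 0
  · rw [hw0, onCircle_zero, norm_zero]
    positivity
  · rw [onCircle_of_ne _ hw0, norm_mul, norm_mul, norm_exp_I_mul, mul_one]
    gcongr
    exact hC _

variable {μ : Measure ℝ} {a : ℝ → ℂ}

theorem integrable_ccCalc_exp (hA : IsSelfAdjoint A) {g : ℝ → ℂ} (hg : VanishAtInfty g)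
    (ha : Continuous a) (hi : Integrable a μ) :
    Integrable (fun t : ℝ => ccCalc A fun x => g x * (a t * exp (I * t * x))) μ := by
  have hn := isStarNormal_opResolvent hA
  obtain ⟨C, hC⟩ := hg.exists_bound
  exact integrable_cfc (fun t : ℝ => onCircle fun x => g x * (a t * exp (I * t * x)))
    (fun t => C * ‖a t‖) (opResolvent A)
    ((continuousOn_onCircle_exp hg ha).mono (prod_mono le_rfl (spectrum_opResolvent_subset hA)))
    (.of_forall fun t w _ => bound_onCircle_exp hC t w) (hi.norm.const_mul C).2

theorem integral_ccCalc_exp (hA : IsSelfAdjoint A) {g : ℝ → ℂ} (hg : VanishAtInfty g)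
    (ha : Continuous a) (hi : Integrable a μ) :
    ∫ t : ℝ, ccCalc A (fun x => g x * (a t * exp (I * t * x))) ∂μ =
      ccCalc A fun x => g x * ∫ t : ℝ, a t * exp (I * t * x) ∂μ := by
  have hn := isStarNormal_opResolvent hA
  obtain ⟨C, hC⟩ := hg.exists_bound
  rw [ccCalc_congr hA (f := fun w =>
    ∫ t : ℝ, onCircle (fun x => g x * (a t * exp (I * t * x))) w ∂μ) fun w _ => ?_]
  · exact (cfc_integral (fun t : ℝ => onCircle fun x => g x * (a t * exp (I * t * x)))
      (fun t => C * ‖a t‖) (opResolvent A)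
      ((continuousOn_onCircle_exp hg ha).mono (prod_mono le_rfl (spectrum_opResolvent_subset hA)))
      (.of_forall fun t w _ => bound_onCircle_exp hC t w) (hi.norm.const_mul C).2).symm
  · by_cases h0 : w = 0
    · simp [h0, onCircle_zero]
    · simp only [onCircle_of_ne _ h0]
      rw [integral_const_mul]

theorem ccCalc_expI (hA : IsSelfAdjoint A) {g : ℝ → ℂ} (hg : Continuous g)
    (hs : HasCompactSupport g) (t : ℝ) (v : H) :
    ccCalc A g (expI A t v) = ccCalc A (fun x => g x * exp (I * t * x)) v :=
  mem_calcGraph.1 (boundedCalc_mem hA (bddCont_exp t) v) g hg hs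

theorem ccCalc_const_mul (hA : IsSelfAdjoint A) {g : ℝ → ℂ} (hg : VanishAtInfty g) (c : ℂ) :
    ccCalc A (fun x => c * g x) = c • ccCalc A g := by
  have hn := isStarNormal_opResolvent hA
  rw [ccCalc_eq A g, ← cfc_smul c (onCircle g) (opResolvent A) (hg.continuousOn_spectrum hA)]
  refine ccCalc_congr hA fun w _ => ?_
  by_cases h0 : w = 0
  · simp [h0, onCircle_zero]
  · simp [onCircle_of_ne _ h0]

theorem ccCalc_smul_expI (hA : IsSelfAdjoint A) {g : ℝ → ℂ} (hg : Continuous g)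
    (hs : HasCompactSupport g) (c : ℂ) (t : ℝ) (v : H) :
    ccCalc A g (c • expI A t v) = ccCalc A (fun x => g x * (c * exp (I * t * x))) v := by
  have h : (fun x : ℝ => g x * (c * exp (I * t * x))) = fun x => c * (g x * exp (I * t * x)) := by
    funext x; ring
  rw [map_smul, ccCalc_expI hA hg hs, h, ccCalc_const_mul hA (.of_mul hg hs (by fun_prop))]
  rfl

/-- Measurability of t ↦ e^{itA}v is obtained as a pointwise limit of its cutoffs, which are
integrals in operator norm. The measure is arbitrary so that half-lines are covered as well as the
whole line. -/
theorem integrable_smul_expI (hA : IsSelfAdjoint A) (ha : Continuous a) (hi : Integrable a μ)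
    (v : H) : Integrable (fun t => a t • expI A t v) μ := by
  refine (hi.norm.mul_const ‖v‖).mono' ?_ (.of_forall fun t => ?_)
  · refine aestronglyMeasurable_of_tendsto_ae atTop (f := fun n t =>
      ccCalc A (fun x => cutoff n x * (a t * exp (I * t * x))) v) (fun n => ?_)
      (.of_forall fun t => ?_)
    · exact ((integrable_ccCalc_exp hA (vanishAtInfty_cutoff n) ha hi).apply_continuousLinearMap
        v).aestronglyMeasurable
    · simp_rw [← ccCalc_smul_expI hA (continuous_cutoff _) (hasCompactSupport_cutoff _)]
      exact tendsto_ccCalc_cutoff hA _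
  · rw [norm_smul]
    gcongr
    exact norm_expI_apply_le hA t v

theorem integral_mem_calcGraph (hA : IsSelfAdjoint A) (ha : Continuous a) (hi : Integrable a μ)
    (v : H) :
    (v, ∫ t, a t • expI A t v ∂μ) ∈ calcGraph A fun x => ∫ t, a t * exp (I * t * x) ∂μ := by
  intro g hg hs
  have hv := VanishAtInfty.of_hasCompactSupport hg hs
  change ccCalc A g (∫ t, a t • expI A t v ∂μ) = ccCalc A _ v
  rw [← ContinuousLinearMap.integral_comp_comm _ (integrable_smul_expI hA ha hi v),
    ← integral_ccCalc_exp hA hv ha hi,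
    ContinuousLinearMap.integral_apply (integrable_ccCalc_exp hA hv ha hi)]
  simp_rw [ccCalc_smul_expI hA hg hs]

theorem boundedCalc_eq_integral (hA : IsSelfAdjoint A) (ha : Continuous a) (hi : Integrable a μ)
    {f : ℝ → ℂ} (hf : BddCont f) (h : ∀ x : ℝ, f x = ∫ t, a t * exp (I * t * x) ∂μ) (v : H) :
    boundedCalc A f v = ∫ t, a t • expI A t v ∂μ := by
  have h1 := integral_mem_calcGraph hA ha hi v
  simp_rw [← h] at h1
  exact ((mem_calcGraph_iff hA hf).1 h1).symm

end Fourier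

/-! ### The Weyl relations -/

theorem resolvent_eq_laplace (x : ℝ) : ((x : ℂ) + I)⁻¹ =
    ∫ t : ℝ in Ioi 0, (-I * exp (-t)) * exp (I * t * x) := by
  have h1 : ∀ t : ℝ, (-I * exp (-t)) * exp (I * t * x) = -I * exp ((I * x - 1) * t) := fun t => by
    rw [mul_assoc, ← exp_add]
    ring_nf
  simp_rw [h1]
  rw [integral_const_mul, integral_exp_mul_complex_Ioi (by simp)]
  have h2 := ofReal_add_I_ne_zero x
  have h3 : I * x - 1 = I * (x + I) := by linear_combination -I_sq
  rw [h3]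
  simp only [ofReal_zero, mul_zero, exp_zero]
  field_simp

theorem resolvent_eq_laplace' (x : ℝ) : ((x : ℂ) - I)⁻¹ =
    ∫ t : ℝ in Iic 0, (I * exp t) * exp (I * t * x) := by
  have h1 : ∀ t : ℝ, (I * exp t) * exp (I * t * x) = I * exp ((I * x + 1) * t) := fun t => by
    rw [mul_assoc, ← exp_add]
    ring_nf
  simp_rw [h1]
  rw [integral_const_mul, integral_exp_mul_complex_Iic (by simp)]
  have h2 := ofReal_sub_I_ne_zero x
  have h3 : I * x + 1 = I * (x - I) := by linear_combination I_sq
  rw [h3]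
  simp only [ofReal_zero, mul_zero, exp_zero]
  field_simp

theorem integrableOn_laplace : IntegrableOn (fun t : ℝ => -I * exp (-t)) (Ioi 0) := by
  have := (integrableOn_exp_mul_complex_Ioi (a := -1) (by simp) 0).const_mul (-I)
  simpa [IntegrableOn] using this

theorem integrableOn_laplace' : IntegrableOn (fun t : ℝ => I * exp t) (Iic 0) := by
  have := (integrableOn_exp_mul_complex_Iic (a := 1) (by simp) 0).const_mul I
  simpa [IntegrableOn] using this

/-- T passes through every e^{itA} at the cost of e^{itκ}, and a(t) e^{itκ} is the density of the
translate f(· + κ). -/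
theorem mul_boundedCalc_of_weyl {A A' : H →ₗ.[ℂ] H} (hA : IsSelfAdjoint A) (hA' : IsSelfAdjoint A')
    {T : H →L[ℂ] H} {κ : ℝ} (h : ∀ s : ℝ, T * expI A s = exp (I * s * κ) • (expI A' s * T))
    {μ : Measure ℝ} {a : ℝ → ℂ} (ha : Continuous a) (hi : Integrable a μ) {f : ℝ → ℂ}
    (hf : BddCont f) (hfa : ∀ x : ℝ, f x = ∫ t, a t * exp (I * t * x) ∂μ) :
    T * boundedCalc A f = boundedCalc A' (fun x => f (x + κ)) * T := by
  ext v
  have ha' : Continuous fun t : ℝ => a t * exp (I * t * κ) := ha.mul (by fun_prop)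
  have hi' : Integrable (fun t : ℝ => a t * exp (I * t * κ)) μ :=
    hi.mul_bdd (c := 1) (Continuous.aestronglyMeasurable (by fun_prop))
      (.of_forall fun t => (norm_exp_I_mul t κ).le)
  have hf' : BddCont fun x => f (x + κ) :=
    ⟨hf.cont.comp (by fun_prop), hf.bdd.imp fun C hC x => hC _⟩
  change T (boundedCalc A f v) = boundedCalc A' (fun x => f (x + κ)) (T v)
  rw [boundedCalc_eq_integral hA ha hi hf hfa, boundedCalc_eq_integral hA' ha' hi' hf' fun x => ?_,
    ← ContinuousLinearMap.integral_comp_comm _ (integrable_smul_expI hA ha hi v)]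
  · refine integral_congr_ae (.of_forall fun t => ?_)
    have := congrArg (fun S : H →L[ℂ] H => S v) (h t)
    change T (expI A t v) = exp (I * t * κ) • expI A' t (T v) at this
    simp only [map_smul, this, smul_smul]
  · rw [hfa]
    refine integral_congr_ae (.of_forall fun t => ?_)
    simp only
    rw [mul_assoc (a t), ← exp_add]
    push_cast
    ring_nf

/-- The resolvents at i and -i are Laplace integrals of the unitary group over the two half-lines,
so a Weyl relation with T becomes a relation with both resolvents. -/
theorem intertwines_of_weyl {A A' : H →ₗ.[ℂ] H} (hA : IsSelfAdjoint A) (hA' : IsSelfAdjoint A')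
    {T : H →L[ℂ] H} {κ : ℝ} (h : ∀ s : ℝ, T * expI A s = exp (I * s * κ) • (expI A' s * T)) :
    Intertwines A A' (Homeomorph.addRight κ) T := by
  have h1 := mul_boundedCalc_of_weyl hA hA' h (by fun_prop) integrableOn_laplace
    vanishAtInfty_resolvent.bddCont resolvent_eq_laplace
  have h2 := mul_boundedCalc_of_weyl hA hA' h (by fun_prop) integrableOn_laplace'
    vanishAtInfty_resolvent'.bddCont resolvent_eq_laplace'
  have e1 : boundedCalc A' (fun x => (((x + κ : ℝ) : ℂ) + I)⁻¹) = _ := boundedCalc_eq_ccCalc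
    hA' (vanishAtInfty_resolvent.comp_homeomorph (Homeomorph.addRight κ))
  have e2 : boundedCalc A' (fun x => (((x + κ : ℝ) : ℂ) - I)⁻¹) = _ := boundedCalc_eq_ccCalc
    hA' (vanishAtInfty_resolvent'.comp_homeomorph (Homeomorph.addRight κ))
  rw [boundedCalc_eq_ccCalc hA vanishAtInfty_resolvent, ccCalc_resolvent hA, e1] at h1
  rw [boundedCalc_eq_ccCalc hA vanishAtInfty_resolvent', ccCalc_resolvent' hA, e2] at h2
  exact intertwines_of_resolvent hA hA' h1 h2

/-- Self-adjoint operators whose unitary groups commute have commuting functions. -/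
theorem boundedCalc_commute {A A' : H →ₗ.[ℂ] H} (hA : IsSelfAdjoint A) (hA' : IsSelfAdjoint A')
    (h : ∀ s t : ℝ, Commute (expI A s) (expI A' t)) {f f' : ℝ → ℂ} (hf : BddCont f)
    (hf' : BddCont f') : Commute (boundedCalc A f) (boundedCalc A' f') := by
  have h1 : ∀ t, Commute (expI A' t) (boundedCalc A f) := fun t => by
    have := (intertwines_of_weyl hA hA (T := expI A' t) (κ := 0) fun s => by
      simpa using ((h s t).eq).symm).boundedCalc_eq hA hA hf
    simpa [Commute, SemiconjBy] using this
  have := (intertwines_of_weyl hA' hA' (T := boundedCalc A f) (κ := 0) fun s => by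
    simpa using ((h1 s).eq).symm).boundedCalc_eq hA' hA' hf'
  simpa [Commute, SemiconjBy] using this

theorem calcGraph_const_mul {A : H →ₗ.[ℂ] H} (hA : IsSelfAdjoint A) {f : ℝ → ℂ}
    (hf : Continuous f) {v y : H} (h : (v, y) ∈ calcGraph A f) (c : ℂ) :
    (v, c • y) ∈ calcGraph A fun x => c * f x := by
  intro g hg hs
  have h1 := ccCalc_const_mul hA (.of_mul hg hs hf) c
  have h2 : (fun x => g x * (c * f x)) = fun x => c * (g x * f x) := by
    funext x
    ring
  change ccCalc A g (c • y) = ccCalc A (fun x => g x * (c * f x)) v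
  rw [map_smul, mem_calcGraph.1 h g hg hs, h2, h1]
  rfl

/-- If `T` shifts `A` by `κ`, then it maps the graph of `e^{aA}` to itself up to a factor. -/
theorem Intertwines.exp_mem {A : H →ₗ.[ℂ] H} (hA : IsSelfAdjoint A) {κ : ℝ} {T : H →L[ℂ] H}
    (hT : Intertwines A A (Homeomorph.addRight κ) T) (a : ℂ) {v y : H}
    (h : (v, y) ∈ calcGraph A fun x => exp (a * x)) :
    (T v, exp (-(a * κ)) • T y) ∈ calcGraph A fun x => exp (a * x) := by
  have h1 := hT.mem_calcGraph (f := fun x : ℝ => exp (a * x)) (by fun_prop) h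
  have h2 := calcGraph_const_mul hA (f := fun x : ℝ => exp (a * (x + κ : ℝ))) (by fun_prop) h1
    (exp (-(a * κ)))
  have h3 : (fun x : ℝ => exp (-(a * κ)) * exp (a * (x + κ : ℝ))) = fun x : ℝ => exp (a * x) := by
    funext x
    rw [← exp_add]
    push_cast
    ring_nf
  rwa [h3] at h2

end QLiouville

end

/-! ### Complex shifts in a Weyl pair and the convergence of Gaussian regularizations. -/

noncomputable section
namespace QLiouville

open MeasureTheory Filter Topology Set
open scoped InnerProductSpace FourierTransform

variable {H : Type*} [NormedAddCommGroup H] [InnerProductSpace ℂ H] [CompleteSpace H]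

/-! ### Functions of a Weyl pair -/

/-- The Weyl form of the commutation relation `[p, x] = i κ`. -/
def WeylPair (p x : H →ₗ.[ℂ] H) (κ : ℝ) : Prop :=
  ∀ s t : ℝ, expI x t * expI p s = exp (I * s * (t * κ : ℝ)) • (expI p s * expI x t)

/-- The density of a function with respect to the characters `e^{itx}`. -/
def fourierDensity (f : ℝ → ℂ) (t : ℝ) : ℂ := (2 * Real.pi : ℝ)⁻¹ * 𝓕 f (t / (2 * Real.pi))

theorem FourierNice.bddCont {f : ℝ → ℂ} (hf : FourierNice f) : BddCont f := ⟨hf.cont, hf.bdd⟩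

theorem FourierNice.continuous_density {f : ℝ → ℂ} (hf : FourierNice f) :
    Continuous (fourierDensity f) :=
  continuous_const.mul (hf.continuous_fourier.comp (by fun_prop))

theorem FourierNice.integrable_density {f : ℝ → ℂ} (hf : FourierNice f) :
    Integrable (fourierDensity f) :=
  (hf.int_fourier.comp_div (by positivity)).const_mul _

theorem FourierNice.eq_integral_density {f : ℝ → ℂ} (hf : FourierNice f) (x : ℝ) :
    f x = ∫ t : ℝ, fourierDensity f t * exp (I * t * x) := by
  have hpi : (2 * Real.pi : ℝ) ≠ 0 := by positivity
  have h1 := Measure.integral_comp_div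
    (fun ξ : ℝ => 𝓕 f ξ * exp (I * (2 * Real.pi * ξ : ℝ) * x)) (2 * Real.pi)
  rw [← hf.inversion x] at h1
  simp only [fourierDensity, mul_assoc]
  rw [integral_const_mul]
  have h2 : ∀ t : ℝ, 2 * Real.pi * (t / (2 * Real.pi)) = t := fun t => by field_simp
  simp only [h2, mul_assoc] at h1
  rw [h1, abs_of_pos (by positivity), real_smul, ← mul_assoc, ← ofReal_mul, inv_mul_cancel₀ hpi,
    ofReal_one, one_mul]

theorem ShiftPair.density_eq {c : ℂ} {f g : ℝ → ℂ} (h : ShiftPair c f g) (t : ℝ) :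
    fourierDensity g t = exp (-(c * t)) * fourierDensity f t := by
  have hpi : (Real.pi : ℂ) ≠ 0 := by exact_mod_cast Real.pi_ne_zero
  rw [fourierDensity, fourierDensity, h.fourier_eq, mul_left_comm]
  congr 3
  push_cast
  field_simp

theorem boundedCalc_eq_density {x : H →ₗ.[ℂ] H} (hx : IsSelfAdjoint x) {f : ℝ → ℂ}
    (hf : FourierNice f) (v : H) :
    boundedCalc x f v = ∫ t : ℝ, fourierDensity f t • expI x t v :=
  boundedCalc_eq_integral hx hf.continuous_density hf.integrable_density hf.bddCont
    hf.eq_integral_density v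

/-- If `[p, x] = i κ`, then `e^{ap} f(x) ⊇ f(x - i a κ) e^{ap}`, provided that `f(x - i a κ)` is
given by the analytic continuation of the Fourier integral of `f`. -/
theorem WeylPair.mem_of_shiftPair {p x : H →ₗ.[ℂ] H} (hp : IsSelfAdjoint p) (hx : IsSelfAdjoint x)
    {κ : ℝ} (h : WeylPair p x κ) {a c : ℂ} (hac : a * κ = c) {f g : ℝ → ℂ} (hfg : ShiftPair c f g)
    {v y : H} (hv : (v, y) ∈ calcGraph p fun s => exp (a * s)) :
    (boundedCalc x f v, boundedCalc x g y) ∈ calcGraph p fun s => exp (a * s) := by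
  intro k hk hs
  -- For each t, e^{itx} maps the graph of e^{ap} to itself up to the factor e^{-ct}. This is
  -- exactly the ratio of the densities of g and f, so the relation holds under the integral and no
  -- unbounded operator has to be moved through it.
  have h1 : ∀ t : ℝ, ccCalc p k (fourierDensity g t • expI x t y) =
      ccCalc p (fun s => k s * exp (a * s)) (fourierDensity f t • expI x t v) := fun t => by
    have h2 := (intertwines_of_weyl hp hp fun s => h s t).exp_mem hp a hv
    have h4 : a * (t * κ : ℝ) = c * t := by
      rw [← hac]
      push_cast
      ring
    rw [h4] at h2
    have h3 := mem_calcGraph.1 h2 k hk hs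
    rw [hfg.density_eq, mul_comm, mul_smul, map_smul, map_smul (ccCalc p _) (fourierDensity f t) (expI x t v), ← h3,
      map_smul]
  change ccCalc p k (boundedCalc x g y) = ccCalc p (fun s => k s * exp (a * s)) (boundedCalc x f v)
  rw [boundedCalc_eq_density hx hfg.left, boundedCalc_eq_density hx hfg.right,
    ← ContinuousLinearMap.integral_comp_comm _
      (integrable_smul_expI hx hfg.right.continuous_density hfg.right.integrable_density y),
    ← ContinuousLinearMap.integral_comp_comm _
      (integrable_smul_expI hx hfg.left.continuous_density hfg.left.integrable_density v)]
  exact integral_congr_ae (.of_forall h1)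

/-! ### Approximation by Gaussians -/

theorem norm_gauss_ofReal_le {s : ℝ} (hs : 0 < s) (x : ℝ) : ‖gauss s x‖ ≤ 1 := by
  rw [gauss, show -(s : ℂ) * (x : ℂ) ^ 2 = ((-(s * x ^ 2) : ℝ) : ℂ) by push_cast; ring, norm_exp,
    ofReal_re, Real.exp_le_one_iff]
  have := mul_nonneg hs.le (sq_nonneg x)
  linarith

theorem bddCont_gauss {s : ℝ} (hs : 0 < s) : BddCont fun x : ℝ => gauss s x :=
  ⟨by unfold gauss; fun_prop, 1, norm_gauss_ofReal_le hs⟩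

/-- For u ≥ 0 one has (1 - e^{-u})² ≤ u. With u = sx² this gives |1 - e^{-sx²}| ≤ √s |x|, and the
resolvent absorbs |x|. -/
theorem norm_gauss_sub_one_mul_le {s : ℝ} (hs : 0 < s) (x : ℝ) :
    ‖(gauss s x - 1) * ((x : ℂ) + I)⁻¹‖ ≤ √s := by
  have h0 : gauss s x - 1 = ((Real.exp (-(s * x ^ 2)) - 1 : ℝ) : ℂ) := by
    rw [gauss]
    push_cast
    ring_nf
  have h1 : ‖gauss s x - 1‖ ≤ √s * |x| := by
    have hu : 0 ≤ s * x ^ 2 := mul_nonneg hs.le (sq_nonneg x)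
    rw [h0, norm_real, Real.norm_eq_abs]
    refine abs_le_of_sq_le_sq ?_ (by positivity)
    rw [mul_pow, Real.sq_sqrt hs.le, sq_abs]
    have h2 := Real.add_one_le_exp (-(s * x ^ 2))
    have h3 : Real.exp (-(s * x ^ 2)) ≤ 1 := Real.exp_le_one_iff.2 (by linarith)
    have h4 := Real.exp_pos (-(s * x ^ 2))
    nlinarith
  have h2 : |x| ≤ ‖(x : ℂ) + I‖ := by simpa using abs_re_le_norm ((x : ℂ) + I)
  have h3 : 0 < ‖(x : ℂ) + I‖ := norm_pos_iff.2 (ofReal_add_I_ne_zero x)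
  rw [norm_mul, norm_inv, ← div_eq_mul_inv, div_le_iff₀ h3]
  exact h1.trans (by gcongr)

theorem tendsto_boundedCalc_gauss {x : H →ₗ.[ℂ] H} (hx : IsSelfAdjoint x) (v : H) :
    Tendsto (fun n : ℕ => boundedCalc x (fun y : ℝ => gauss (1 / (n + 1)) y) v) atTop (𝓝 v) := by
  have hs : ∀ n : ℕ, (0 : ℝ) < 1 / (n + 1) := fun n => by positivity
  refine tendsto_of_tendsto_on_dense (C := 1) (fun n => ?_) (denseRange_opResolvent hx) ?_ v
  · exact ContinuousLinearMap.opNorm_le_bound _ zero_le_one fun v =>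
      norm_boundedCalc_apply_le hx (bddCont_gauss (hs n)).cont (norm_gauss_ofReal_le (hs n)) v
  · rintro _ ⟨u, rfl⟩
    have h1 : Tendsto (fun n : ℕ => √(1 / ((n : ℝ) + 1)) * ‖u‖) atTop (𝓝 0) := by
      have := (Real.continuous_sqrt.tendsto 0).comp tendsto_one_div_add_atTop_nhds_zero_nat
      simpa using this.mul_const ‖u‖
    rw [tendsto_iff_norm_sub_tendsto_zero]
    refine squeeze_zero (fun _ => norm_nonneg _) (fun n => ?_) h1
    have hv := vanishAtInfty_resolvent
    have hg := bddCont_gauss (hs n)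
    have hgv : VanishAtInfty fun y : ℝ => gauss (1 / (n + 1)) y * ((y : ℂ) + I)⁻¹ := by
      simpa only [mul_comm] using hv.mul_bdd hg.cont (norm_gauss_ofReal_le (hs n))
    have h2 : boundedCalc x (fun y : ℝ => gauss (1 / (n + 1)) y) * opResolvent x =
        ccCalc x fun y : ℝ => gauss (1 / (n + 1)) y * ((y : ℂ) + I)⁻¹ := by
      rw [← boundedCalc_eq_ccCalc hx hgv, boundedCalc_mul hx hg hv.bddCont,
        boundedCalc_eq_ccCalc hx hv, ccCalc_resolvent hx]
    have h3 := ccCalc_sub hx hgv hv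
    rw [← h2, ccCalc_resolvent hx] at h3
    have h4 := norm_ccCalc_le (A := x) (Real.sqrt_nonneg _) fun y => by
      simpa only [sub_mul, one_mul] using norm_gauss_sub_one_mul_le (hs n) y
    rw [h3] at h4
    exact ((boundedCalc x (fun y : ℝ => gauss (1 / (n + 1)) y) * opResolvent x -
      opResolvent x).le_opNorm u).trans (by gcongr)

/-! ### Graphs of functions bounded after multiplication -/

theorem boundedCalc_apply_eq {x : H →ₗ.[ℂ] H} (hx : IsSelfAdjoint x) {f h : ℝ → ℂ} (hh : BddCont h)
    (hhf : BddCont fun s => h s * f s) {v y : H} (hv : (v, y) ∈ calcGraph x f) :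
    boundedCalc x h y = boundedCalc x (fun s => h s * f s) v :=
  (mem_calcGraph_iff hx hhf).1 (calcGraph_comp hh.cont hv (boundedCalc_mem hx hh y))

theorem boundedCalc_mul_mem {x : H →ₗ.[ℂ] H} (hx : IsSelfAdjoint x) {f h : ℝ → ℂ}
    (hf : Continuous f) (hh : BddCont h) (hhf : BddCont fun s => h s * f s) (v : H) :
    (boundedCalc x h v, boundedCalc x (fun s => h s * f s) v) ∈ calcGraph x f := by
  refine calcGraph_of_comp hf (boundedCalc_mem hx hh v) ?_
  simpa only [mul_comm] using boundedCalc_mem hx hhf v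

theorem mem_calcGraph_exp_neg {p : H →ₗ.[ℂ] H} (a : ℂ) {v y : H} :
    (v, y) ∈ calcGraph p (fun s => exp (-(a * s))) ↔ (y, v) ∈ calcGraph p fun s => exp (a * s) := by
  have h0 : (v, v) ∈ calcGraph p fun _ => 1 := by
    intro g _ _
    simp
  have h0' : (y, y) ∈ calcGraph p fun _ => 1 := by
    intro g _ _
    simp
  constructor
  · intro h
    refine calcGraph_of_comp (by fun_prop) h ?_
    simpa only [← exp_add, add_neg_cancel, exp_zero] using h0
  · intro h
    refine calcGraph_of_comp (by fun_prop) h ?_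
    simpa only [← exp_add, neg_add_cancel, exp_zero] using h0'

/-- The value w = f(A)v is recovered as c⁻¹(y - v); for c = 0 the left side would no longer restrict
v to the domain of f(A). -/
theorem mem_calcGraph_one_add {x : H →ₗ.[ℂ] H} (hx : IsSelfAdjoint x) {f : ℝ → ℂ}
    (hf : Continuous f) {c : ℂ} (hc : c ≠ 0) {v y : H} :
    (v, y) ∈ calcGraph x (fun s => 1 + c * f s) ↔ ∃ w, (v, w) ∈ calcGraph x f ∧ y = v + c • w := by
  have key : ∀ {F : ℝ → ℂ}, Continuous F → ∀ {w : H}, (v, w) ∈ calcGraph x F →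
      (v, w - v) ∈ calcGraph x fun s => F s - 1 := by
    intro F hF w hw g hg hs
    have h1 := ccCalc_sub hx (.of_mul hg hs hF) (.of_hasCompactSupport hg hs)
    have h2 : (fun s => g s * (F s - 1)) = fun s => g s * F s - g s := by
      funext s
      ring
    change ccCalc x g (w - v) = ccCalc x (fun s => g s * (F s - 1)) v
    rw [h2, h1, map_sub, mem_calcGraph.1 hw g hg hs]
    rfl
  constructor
  · intro h
    have h1 := calcGraph_const_mul hx (by fun_prop) (key (by fun_prop) h) c⁻¹
    refine ⟨c⁻¹ • (y - v), ?_, by rw [smul_inv_smul₀ hc]; abel⟩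
    simpa only [add_sub_cancel_left, inv_mul_cancel_left₀ hc] using h1
  · rintro ⟨w, hw, rfl⟩
    have h1 := calcGraph_const_mul hx (by fun_prop)
      (key (F := fun s => -(c * f s)) (by fun_prop) (w := -(c • w)) ?_) (-1)
    · convert h1 using 1
      · congr 1
        funext s
        ring
      · rw [neg_smul, one_smul, neg_sub, sub_neg_eq_add]
    · have := calcGraph_const_mul hx hf hw (-c)
      simpa only [neg_smul, neg_mul] using this

end QLiouville

end

/-! ### Graphs of unbounded products, closures, and the abstract regularization argument. -/

noncomputable section
namespace QLiouville

open MeasureTheory Filter Topology Set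
open scoped InnerProductSpace

variable {H : Type*} [NormedAddCommGroup H] [InnerProductSpace ℂ H]

/-! ### Graphs of products, sums and powers -/

/-- The natural domain of a product is encoded by composition of relations, which lets all later
domain questions be treated as statements about graphs. -/
theorem mem_graph_opMul {A B : H →ₗ.[ℂ] H} {v z : H} :
    (v, z) ∈ (opMul A B).graph ↔ ∃ y, (v, y) ∈ B.graph ∧ (y, z) ∈ A.graph := by
  set S := (A.domain.comap B.toFun).map B.domain.subtype with hS
  have hval : ∀ (x : (opMul A B).domain) (h : (x : H) ∈ B.domain) (h' : B ⟨x, h⟩ ∈ A.domain),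
      opMul A B x = A ⟨B ⟨x, h⟩, h'⟩ := by
    intro x h h'
    have e : B.domRestrict S x = B ⟨x, h⟩ := LinearPMap.domRestrict_apply rfl
    change A ⟨B.domRestrict S x, _⟩ = _
    simp only [e]
  constructor
  · intro h
    obtain ⟨x, hx, hz⟩ := (LinearPMap.mem_graph_iff _).1 h
    obtain ⟨⟨w, hw, hwx⟩, hxB⟩ := x.2
    have h' : B ⟨x, hxB⟩ ∈ A.domain := by
      have : (⟨x, hxB⟩ : B.domain) = w := Subtype.ext hwx.symm
      rw [this]
      exact hw
    simp only at hx hz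
    refine ⟨B ⟨x, hxB⟩, ?_, ?_⟩
    · rw [← hx]
      exact B.mem_graph ⟨x, hxB⟩
    · rw [← hz, hval x hxB h']
      exact A.mem_graph ⟨_, h'⟩
  · rintro ⟨y, hy, hz⟩
    obtain ⟨u, rfl, rfl⟩ := (LinearPMap.mem_graph_iff _).1 hy
    obtain ⟨w, hw, rfl⟩ := (LinearPMap.mem_graph_iff _).1 hz
    simp only at hw
    have h' : B u ∈ A.domain := hw ▸ w.2
    have hd : (u : H) ∈ (opMul A B).domain := ⟨⟨u, h', rfl⟩, u.2⟩
    refine (LinearPMap.mem_graph_iff _).2 ⟨⟨u, hd⟩, rfl, ?_⟩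
    rw [hval ⟨u, hd⟩ u.2 h']
    congr 1
    exact Subtype.ext hw.symm

theorem mem_graph_smul {A : H →ₗ.[ℂ] H} {c : ℂ} {v z : H} :
    (v, z) ∈ (c • A).graph ↔ ∃ y, (v, y) ∈ A.graph ∧ z = c • y := by
  constructor
  · intro h
    obtain ⟨x, rfl, rfl⟩ := (LinearPMap.mem_graph_iff _).1 h
    exact ⟨A x, A.mem_graph x, rfl⟩
  · rintro ⟨y, hy, rfl⟩
    obtain ⟨x, rfl, rfl⟩ := (LinearPMap.mem_graph_iff _).1 hy
    exact (LinearPMap.mem_graph_iff _).2 ⟨x, rfl, rfl⟩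

theorem mem_graph_oneAdd {A : H →ₗ.[ℂ] H} {c : ℂ} {v z : H} :
    (v, z) ∈ (oneAdd c A).graph ↔ ∃ y, (v, y) ∈ A.graph ∧ z = v + c • y := by
  constructor
  · intro h
    obtain ⟨x, rfl, rfl⟩ := (LinearPMap.mem_graph_iff _).1 h
    exact ⟨A ⟨x, x.2.2⟩, A.mem_graph ⟨x, x.2.2⟩, rfl⟩
  · rintro ⟨y, hy, rfl⟩
    obtain ⟨x, rfl, rfl⟩ := (LinearPMap.mem_graph_iff _).1 hy
    exact (LinearPMap.mem_graph_iff _).2 ⟨⟨x, trivial, x.2⟩, rfl, rfl⟩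

theorem opMul_ofBounded (S T : H →L[ℂ] H) :
    opMul (ofBounded S) (ofBounded T) = ofBounded (S * T) := by
  refine LinearPMap.eq_of_eq_graph (Submodule.ext ?_)
  rintro ⟨v, z⟩
  simp only [mem_graph_opMul, mem_graph_ofBounded, exists_eq_left]
  rfl

theorem inverse_ofBounded (T : H ≃L[ℂ] H) :
    (ofBounded (T : H →L[ℂ] H)).inverse = ofBounded ((T⁻¹ : H ≃L[ℂ] H) : H →L[ℂ] H) := by
  have hk : LinearMap.ker (ofBounded (T : H →L[ℂ] H)).toFun = ⊥ := by
    rw [LinearMap.ker_eq_bot']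
    intro x hx
    exact Subtype.ext (T.injective (by simpa using (show T x = 0 from hx)))
  refine LinearPMap.eq_of_eq_graph (Submodule.ext ?_)
  rintro ⟨v, z⟩
  rw [LinearPMap.inverse_graph hk, mem_graph_ofBounded]
  constructor
  · rintro ⟨⟨z', v'⟩, h, h'⟩
    obtain ⟨rfl, rfl⟩ := Prod.ext_iff.1 h'
    have := mem_graph_ofBounded.1 h
    simp only [LinearEquiv.coe_coe, LinearEquiv.prodComm_apply, Prod.fst_swap, Prod.snd_swap]
    rw [this]
    exact (T.symm_apply_apply z').symm
  · rintro rfl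
    exact ⟨(T⁻¹ v, v), mem_graph_ofBounded.2 (T.apply_symm_apply v).symm, rfl⟩

theorem opPow_ofBounded (T : H ≃L[ℂ] H) (n : ℕ) :
    opPow (ofBounded (T : H →L[ℂ] H)) n = ofBounded ((T ^ n : H ≃L[ℂ] H) : H →L[ℂ] H) := by
  induction n with
  | zero => rfl
  | succ n ih =>
    rw [opPow, ih, opMul_ofBounded, pow_succ']
    rfl

theorem opZPow_ofBounded (T : H ≃L[ℂ] H) (t : ℤ) :
    opZPow (ofBounded (T : H →L[ℂ] H)) t = ofBounded ((T ^ t : H ≃L[ℂ] H) : H →L[ℂ] H) := by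
  cases t with
  | ofNat n =>
    rw [opZPow, opPow_ofBounded]
    simp
  | negSucc n =>
    rw [opZPow, inverse_ofBounded, opPow_ofBounded, zpow_negSucc, inv_pow]

theorem foldr_opMul_ofBounded (l : List (H ≃L[ℂ] H)) :
    (l.map fun T : H ≃L[ℂ] H => ofBounded (T : H →L[ℂ] H)).foldr opMul opOne =
      ofBounded ((l.prod : H ≃L[ℂ] H) : H →L[ℂ] H) := by
  induction l with
  | nil => rfl
  | cons T l ih =>
    rw [List.map_cons, List.foldr_cons, ih, opMul_ofBounded, List.prod_cons]
    rfl

/-! ### Equality up to closure -/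

/-- An operator whose graph is, up to a similarity, a dense subset of the closed graph `F`. -/
structure IsCoreGraph (A : H →ₗ.[ℂ] H) (Λ : H ≃L[ℂ] H) (F : Submodule ℂ (H × H)) : Prop where
  subset : ∀ v z, (Λ v, Λ z) ∈ A.graph → (v, z) ∈ F
  dense : ∀ p ∈ F, p ∈ closure {p : H × H | (Λ p.1, Λ p.2) ∈ A.graph}

section Closure

variable {A B : H →ₗ.[ℂ] H} {Λ : H ≃L[ℂ] H} {F : Submodule ℂ (H × H)}

/-- The similarity Λ is a homeomorphism, so the closure of the graph is the image of F; since F does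
not involve the operator, two operators with the same F and Λ have the same closure. -/
theorem IsCoreGraph.topologicalClosure_graph (h : IsCoreGraph A Λ F)
    (hF : IsClosed (F : Set (H × H))) :
    A.graph.topologicalClosure =
      F.comap ((Λ.symm : H →ₗ[ℂ] H).prodMap (Λ.symm : H →ₗ[ℂ] H)) := by
  refine le_antisymm (Submodule.topologicalClosure_minimal _ ?_ ?_) ?_
  · rintro ⟨v, z⟩ hv
    refine h.subset _ _ ?_
    simpa using hv
  · exact hF.preimage (Continuous.prodMap Λ.symm.continuous Λ.symm.continuous)
  · rintro ⟨v, z⟩ hv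
    have h1 := h.dense _ hv
    have h2 := map_mem_closure (Continuous.prodMap Λ.continuous Λ.continuous) h1
      (t := (A.graph : Set (H × H))) fun p hp => hp
    rw [← SetLike.mem_coe, Submodule.topologicalClosure_coe]
    simpa using h2

theorem IsCoreGraph.isClosable (h : IsCoreGraph A Λ F) (hF : IsClosed (F : Set (H × H)))
    (h0 : ∀ y, ((0 : H), y) ∈ F → y = 0) : A.IsClosable := by
  refine ⟨A.graph.topologicalClosure.toLinearPMap, (Submodule.toLinearPMap_graph_eq _ ?_).symm⟩
  rintro ⟨v, y⟩ hv (rfl : v = 0)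
  rw [h.topologicalClosure_graph hF] at hv
  have := h0 (Λ.symm y) (by simpa using hv)
  simpa using this

theorem IsCoreGraph.dense_domain (h : IsCoreGraph A Λ F)
    (hd : ∀ v, v ∈ closure (Prod.fst '' (F : Set (H × H)))) : Dense (A.domain : Set H) := by
  intro v
  have h1 : Prod.fst '' (F : Set (H × H)) ⊆ closure (Λ.symm '' (A.domain : Set H)) := by
    rintro _ ⟨p, hp, rfl⟩
    refine map_mem_closure continuous_fst (h.dense p hp) fun q hq => ?_
    exact ⟨Λ q.1, LinearPMap.mem_domain_of_mem_graph hq, by simp⟩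
  have h2 := closure_minimal h1 isClosed_closure (hd (Λ.symm v))
  have h3 := map_mem_closure Λ.continuous h2 (t := (A.domain : Set H)) ?_
  · simpa using h3
  · rintro _ ⟨u, hu, rfl⟩
    simpa using hu

theorem eqClosure_of_isCoreGraph (hA : IsCoreGraph A Λ F) (hB : IsCoreGraph B Λ F)
    (hF : IsClosed (F : Set (H × H))) (h0 : ∀ y, ((0 : H), y) ∈ F → y = 0)
    (hd : ∀ v, v ∈ closure (Prod.fst '' (F : Set (H × H)))) : EqClosure A B := by
  have hAc := hA.isClosable hF h0
  have hBc := hB.isClosable hF h0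
  refine ⟨hA.dense_domain hd, hB.dense_domain hd, hAc, hBc, LinearPMap.eq_of_eq_graph ?_⟩
  rw [← hAc.graph_closure_eq_closure_graph, ← hBc.graph_closure_eq_closure_graph,
    hA.topologicalClosure_graph hF, hB.topologicalClosure_graph hF]

end Closure

/-! ### Regularization -/

/-- The operators `v ↦ L⁻¹ M v` defined by bounded regularizations: the pairs `(v, y)` with
`L k y = M k v` for all `k`. -/
def regGraph (L M : ℕ → H →L[ℂ] H) : Submodule ℂ (H × H) where
  carrier := {p | ∀ k, L k p.2 = M k p.1}
  zero_mem' := fun k => by simp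
  add_mem' := fun {p q} hp hq k => by
    simp only [Prod.snd_add, Prod.fst_add, map_add, hp k, hq k]
  smul_mem' := fun c p hp k => by
    simp only [Prod.smul_snd, Prod.smul_fst, map_smul, hp k]

/-- Bounded operators `L` converging to the identity, with `E L = K E` on the left, such that
`M = L X` for `X` with `(Q⁻¹ E Q) = X E`, where `E` is an operator given by its graph. -/
structure Regularization (E : Submodule ℂ (H × H)) (Q : H ≃L[ℂ] H) (K L M : ℕ → H →L[ℂ] H) :
    Prop where
  mem : ∀ k v y, (v, y) ∈ E → (K k v, L k y) ∈ E
  mul_mem : ∀ k v y, (v, y) ∈ E → (Q (K k v), Q (M k y)) ∈ E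
  comm_left : ∀ k v, Q (K k v) = K k (Q v)
  comm_right : ∀ k v, Q (L k v) = L k (Q v)
  tendsto : ∀ v, Tendsto (fun k => L k v) atTop (𝓝 v)

section Regularization

variable {E : Submodule ℂ (H × H)} {Q : H ≃L[ℂ] H} {K L M : ℕ → H →L[ℂ] H}

theorem isClosed_regGraph (L M : ℕ → H →L[ℂ] H) : IsClosed (regGraph L M : Set (H × H)) := by
  have : (regGraph L M : Set (H × H)) = ⋂ k, {p | L k p.2 = M k p.1} := by
    ext p
    simp only [mem_iInter]
    rfl
  rw [this]
  exact isClosed_iInter fun k => isClosed_eq (by fun_prop) (by fun_prop)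

theorem eq_zero_of_mem_regGraph (hL : ∀ v, Tendsto (fun k => L k v) atTop (𝓝 v)) (y : H)
    (h : ((0 : H), y) ∈ regGraph L M) : y = 0 := by
  refine tendsto_nhds_unique (hL y) ?_
  have h1 : ∀ k, L k y = 0 := fun k => (h k).trans (map_zero _)
  simp only [h1]
  exact tendsto_const_nhds

/-- A pair (v, y) of the regularized graph is the limit of (L_k v, L_k y), and its second component
equals M_k v. -/
theorem mem_closure_of_regGraph (hL : ∀ v, Tendsto (fun k => L k v) atTop (𝓝 v)) {S : Set (H × H)}
    (hS : ∀ k v, (L k v, M k v) ∈ closure S) : ∀ p ∈ regGraph L M, p ∈ closure S := by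
  rintro ⟨v, y⟩ h
  refine isClosed_closure.mem_of_tendsto ((hL v).prodMk_nhds (hL y)) (.of_forall fun k => ?_)
  rw [show L k y = M k v from h k]
  exact hS k v

theorem dense_fst_regGraph (hL : ∀ v, Tendsto (fun k => L k v) atTop (𝓝 v))
    (h : ∀ k v, (L k v, M k v) ∈ regGraph L M) (v : H) :
    v ∈ closure (Prod.fst '' (regGraph L M : Set (H × H))) :=
  mem_closure_of_tendsto (hL v) (.of_forall fun k => ⟨_, h k v, rfl⟩)

/-- The graph of the group commutator `Q⁻¹ E Q E⁻¹` on its natural domain. -/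
def commutatorGraph (E : Submodule ℂ (H × H)) (Q : H ≃L[ℂ] H) : Set (H × H) :=
  {p | ∃ u, (u, p.1) ∈ E ∧ (Q u, Q p.2) ∈ E}

/-- If E u = v and E Q u = Q z, regularizing before applying E gives E(K_k Q u) both as L_k Q z and
as Q M_k v. As E is single-valued and Q commutes with L_k, it follows that L_k z = M_k v. -/
theorem Regularization.commutatorGraph_subset (h : Regularization E Q K L M)
    (hE : ∀ v y z, (v, y) ∈ E → (v, z) ∈ E → y = z) {v z : H}
    (hv : (v, z) ∈ commutatorGraph E Q) : (v, z) ∈ regGraph L M := by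
  obtain ⟨u, h1, h2⟩ := hv
  intro k
  have h3 := h.mem k _ _ h2
  have h4 := h.mul_mem k _ _ h1
  rw [h.comm_left] at h4
  have h5 := hE _ _ _ h3 h4
  simp only at h5
  rw [← h.comm_right] at h5
  exact Q.injective h5

/-- For v in the range of E the pair lies in the commutator graph itself, with the regularized
preimage K_k u as witness; density of the range and continuity of L_k, M_k do the rest. -/
theorem Regularization.mem_closure (h : Regularization E Q K L M)
    (hd : ∀ v, v ∈ closure (Prod.snd '' (E : Set (H × H)))) (k : ℕ) (v : H) :
    (L k v, M k v) ∈ closure (commutatorGraph E Q) := by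
  refine map_mem_closure (f := fun v => (L k v, M k v)) (by fun_prop) (hd v) ?_
  rintro _ ⟨⟨u, w⟩, hu, rfl⟩
  exact ⟨K k u, h.mem k _ _ hu, h.mul_mem k _ _ hu⟩

end Regularization

/-! ### Intertwining by the shift and flip -/

variable [CompleteSpace H]

theorem dense_snd_calcGraph_exp {p : H →ₗ.[ℂ] H} (hp : IsSelfAdjoint p) (a : ℂ) (v : H) :
    v ∈ closure (Prod.snd '' (calcGraph p fun s => exp (a * s) : Set (H × H))) := by
  refine mem_closure_of_tendsto (tendsto_ccCalc_cutoff hp v) (.of_forall fun n => ?_)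
  exact ⟨_, (mem_calcGraph_exp_neg a).1 (cutoff_mem_calcGraph hp
    (f := fun s : ℝ => exp (-(a * s))) (by fun_prop) n v), rfl⟩

theorem Intertwines.symm {A A' : H →ₗ.[ℂ] H} {σ : ℝ ≃ₜ ℝ} {T : H ≃L[ℂ] H}
    (h : Intertwines A A' σ T) : Intertwines A' A σ.symm (T.symm : H →L[ℂ] H) := by
  intro g hg
  have h1 := h _ (hg.comp_homeomorph σ.symm)
  simp only [Homeomorph.symm_apply_apply] at h1
  ext v
  have h2 := congrArg (fun S : H →L[ℂ] H => T.symm (S (T.symm v))) h1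
  simpa using h2.symm

/-- Inclusion of graphs under T suffices: applied to the pairs (Rv, v - iRv), it gives the
intertwining of resolvents. -/
theorem intertwines_of_graph {A A' : H →ₗ.[ℂ] H} (hA : IsSelfAdjoint A) (hA' : IsSelfAdjoint A')
    {T : H →L[ℂ] H} (h : ∀ v y, (v, y) ∈ A.graph → (T v, T y) ∈ A'.graph) :
    Intertwines A A' (Homeomorph.refl ℝ) T := by
  refine intertwines_of_resolvent hA hA' ?_ ?_
  · change T * opResolvent A = ccCalc A' (fun x : ℝ => ((x : ℂ) + I)⁻¹) * T
    rw [ccCalc_resolvent hA']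
    ext v
    have h1 := (isShiftedInverse_opResolvent hA').apply_add _ _
      (h _ _ ((isShiftedInverse_opResolvent hA).mem v))
    simpa using h1.symm
  · change T * star (opResolvent A) = ccCalc A' (fun x : ℝ => ((x : ℂ) - I)⁻¹) * T
    rw [ccCalc_resolvent' hA']
    ext v
    have h1 := (isShiftedInverse_star_opResolvent hA').apply_add _ _
      (h _ _ ((isShiftedInverse_star_opResolvent hA).mem v))
    simpa using h1.symm

theorem ccCalc_neg {A : H →ₗ.[ℂ] H} (hA : IsSelfAdjoint A) {g : ℝ → ℂ} (hg : VanishAtInfty g) :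
    ccCalc A (fun x => -g x) = -ccCalc A g := by
  have := ccCalc_const_mul hA hg (-1)
  simpa using this

/-- From TA = -A'T one gets T(A + i)⁻¹ = -(A' - i)⁻¹T, so the sign change exchanges the two
resolvents. -/
theorem intertwines_of_graph_neg {A A' : H →ₗ.[ℂ] H} (hA : IsSelfAdjoint A)
    (hA' : IsSelfAdjoint A') {T : H →L[ℂ] H}
    (h : ∀ v y, (v, y) ∈ A.graph → (T v, -T y) ∈ A'.graph) :
    Intertwines A A' (Homeomorph.neg ℝ) T := by
  refine intertwines_of_resolvent hA hA' ?_ ?_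
  · have h0 : ∀ x : ℝ, (((Homeomorph.neg ℝ x : ℝ) : ℂ) + I)⁻¹ = -((x : ℂ) - I)⁻¹ := fun x => by
      rw [← inv_neg]
      simp [sub_eq_add_neg, add_comm]
    simp only [h0]
    rw [ccCalc_neg hA' vanishAtInfty_resolvent', ccCalc_resolvent' hA']
    ext v
    have h1 := (isShiftedInverse_star_opResolvent hA').apply_add _ _
      (h _ _ ((isShiftedInverse_opResolvent hA).mem v))
    rw [show -T (v - I • opResolvent A v) + -I • T (opResolvent A v) = -T v by
      rw [map_sub, map_smul]
      module] at h1
    simpa using h1.symm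
  · have h0 : ∀ x : ℝ, (((Homeomorph.neg ℝ x : ℝ) : ℂ) - I)⁻¹ = -((x : ℂ) + I)⁻¹ := fun x => by
      rw [← inv_neg]
      simp [sub_eq_add_neg, add_comm]
    simp only [h0]
    rw [ccCalc_neg hA' vanishAtInfty_resolvent, ccCalc_resolvent hA']
    ext v
    have h1 := (isShiftedInverse_opResolvent hA').apply_add _ _
      (h _ _ ((isShiftedInverse_star_opResolvent hA).mem v))
    simpa using h1.symm

end QLiouville

end

/-! ### The evolution operator, the fields, and the discrete Liouville equation. -/

noncomputable section
namespace QLiouville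

open MeasureTheory Filter Topology Set
open scoped InnerProductSpace

variable {H : Type*} [NormedAddCommGroup H] [InnerProductSpace ℂ H] [CompleteSpace H]

/-! ### The algebra of observables -/

section Observables

variable {N : ℕ} {r : ℤ → (H →ₗ.[ℂ] H)}

theorem IsObservableFamily.expI_mul (hr : IsObservableFamily N r) (m n : ℤ) (s t : ℝ) :
    expI (r m) s * expI (r n) t =
      exp ((I * s) * (I * t) * commValue N m n) • (expI (r n) t * expI (r m) s) := by
  have h := hr.weyl m n s t
  simp only [unitaryGroup_eq (hr.selfAdjoint _), opMul_ofBounded] at h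
  ext v
  have h1 : (v, (expI (r m) s * expI (r n) t) v) ∈ (ofBounded (expI (r m) s * expI (r n) t)).graph :=
    mem_graph_ofBounded.2 rfl
  rw [h] at h1
  obtain ⟨y, hy, hy'⟩ := mem_graph_smul.1 h1
  rw [hy', mem_graph_ofBounded.1 hy]
  rfl

theorem IsObservableFamily.commute_expI (hr : IsObservableFamily N r) {m n : ℤ}
    (h : commValue N m n = 0) (s t : ℝ) : Commute (expI (r m) s) (expI (r n) t) := by
  have h1 := hr.expI_mul m n s t
  rwa [h, mul_zero, exp_zero, one_smul] at h1

theorem IsObservableFamily.weylPair (hr : IsObservableFamily N r) {m n : ℤ} {κ : ℝ}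
    (h : commValue N m n = I * κ) : WeylPair (r m) (r n) κ := by
  intro s t
  rw [hr.expI_mul m n s t, smul_smul, ← exp_add, h]
  have h1 : I * (s : ℂ) * ((t * κ : ℝ) : ℂ) + I * s * (I * t) * (I * κ) = 0 := by
    push_cast
    linear_combination I * s * t * κ * I_sq
  rw [h1, exp_zero, one_smul]

theorem IsObservableFamily.eq_of_modEq (hr : IsObservableFamily N r) {i j : ℤ}
    (h : i ≡ j [ZMOD 2 * N]) : r i = r j := by
  obtain ⟨k, hk⟩ := h.dvd
  have h1 : ∀ k : ℕ, ∀ i : ℤ, r (i + 2 * N * k) = r i := by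
    intro k
    induction k with
    | zero => simp
    | succ k ih =>
      intro i
      rw [← ih i, ← hr.periodic (i + 2 * N * k)]
      congr 1
      push_cast
      ring
  obtain ⟨l, rfl | rfl⟩ := k.eq_nat_or_neg
  · rw [← h1 l i]
    congr 1
    linarith
  · rw [← h1 l j]
    congr 1
    linarith

theorem commValue_eq_zero_of_even {m n : ℤ} (hm : Even m) (hn : Even n) : commValue N m n = 0 := by
  rw [commValue, if_neg]
  obtain ⟨i, rfl⟩ := hm
  obtain ⟨j, rfl⟩ := hn
  rintro (h | h) <;>
  · obtain ⟨k, hk⟩ := h.dvd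
    rw [mul_assoc] at hk
    generalize (N : ℤ) * k = l at hk
    omega

/-- The sign of the commutator depends only on its first index, here the odd n + 1. Hence r_{n+1}
shifts both neighbours r_n and r_{n+2} in the same direction, and both quotients of dilogarithms
come out as 1 + q e^{2πbx}. -/
theorem commValue_of_even {n : ℤ} (hn : Even n) :
    commValue N (n + 1) n = I * ((onePlusDelta N / (2 * Real.pi) : ℝ) : ℂ) := by
  have hpi : (Real.pi : ℂ) ≠ 0 := by exact_mod_cast Real.pi_ne_zero
  rw [commValue, if_pos (.inr (by simp)), hn.add_one.neg_one_zpow, mul_inv, inv_I]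
  push_cast
  field_simp

theorem commValue_of_even' {n : ℤ} (hn : Even n) :
    commValue N (n + 1) (n + 2) = I * ((onePlusDelta N / (2 * Real.pi) : ℝ) : ℂ) := by
  have hpi : (Real.pi : ℂ) ≠ 0 := by exact_mod_cast Real.pi_ne_zero
  rw [commValue, if_pos (.inl (by rw [add_assoc]; rfl)), hn.add_one.neg_one_zpow, mul_inv, inv_I]
  push_cast
  field_simp

theorem commValue_eq_zero_of_not_modEq {n j : ℤ} (h : ¬ j ≡ n [ZMOD 2 * N])
    (h' : ¬ j ≡ n + 2 [ZMOD 2 * N]) : commValue N (n + 1) j = 0 := by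
  rw [commValue, if_neg]
  rintro (h1 | h1)
  · rw [add_assoc] at h1
    exact h' h1
  · rw [add_sub_cancel_right] at h1
    exact h h1

theorem exists_modEq_of_even (hN : 1 ≤ N) {j : ℤ} (hj : Even j) :
    ∃ k < N, 2 * ((k : ℤ) + 1) ≡ j [ZMOD 2 * N] := by
  obtain ⟨u, rfl⟩ := hj
  have hN' : (0 : ℤ) < N := by exact_mod_cast hN
  refine ⟨((u - 1) % N).toNat, ?_, ?_⟩
  · have := Int.emod_lt_of_pos (u - 1) hN'
    omega
  · rw [Int.toNat_of_nonneg (Int.emod_nonneg _ hN'.ne')]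
    refine (Int.modEq_iff_dvd).2 ⟨(u - 1) / N, ?_⟩
    have := Int.emod_add_mul_ediv (u - 1) N
    linarith

theorem eq_of_even_modEq {k l : ℕ} (hk : k < N) (hl : l < N)
    (h : 2 * ((k : ℤ) + 1) ≡ 2 * (l + 1) [ZMOD 2 * N]) : k = l := by
  obtain ⟨d, hd⟩ := h.dvd
  have h1 : (l : ℤ) - k = N * d := by linarith
  have h2 : ((l : ℤ) - k) = 0 := by
    refine Int.eq_zero_of_abs_lt_dvd ⟨d, h1⟩ ?_
    rw [abs_lt]
    omega
  omega

end Observables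

/-! ### The quantum dilogarithm of a self-adjoint operator -/

section Dilogarithm

variable {b : ℂ} {A : H →ₗ.[ℂ] H}

theorem bddCont_qdilog (hb : 0 < b.re) : BddCont fun x : ℝ => qdilog b x := by
  obtain ⟨C, hC⟩ := exists_norm_qdilog_ofReal_le hb
  exact ⟨continuous_qdilog_ofReal hb, C, fun x => (hC x).1⟩

theorem bddCont_qdilog_inv (hb : 0 < b.re) : BddCont fun x : ℝ => (qdilog b x)⁻¹ := by
  obtain ⟨C, hC⟩ := exists_norm_qdilog_ofReal_le hb
  exact ⟨(continuous_qdilog_ofReal hb).inv₀ fun x => qdilog_ne_zero hb x, C, fun x => (hC x).2⟩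

/-- The operator `1 / φ_b(A)`, as an invertible bounded operator. -/
def dilogEquiv (hb : 0 < b.re) (hA : IsSelfAdjoint A) : H ≃L[ℂ] H :=
  ContinuousLinearEquiv.equivOfInverse (boundedCalc A fun x => (qdilog b x)⁻¹)
    (boundedCalc A fun x => qdilog b x)
    (fun v => by
      have h := boundedCalc_mul hA (bddCont_qdilog hb) (bddCont_qdilog_inv hb)
      simp only [mul_inv_cancel₀ (qdilog_ne_zero hb _), boundedCalc_one hA] at h
      exact (congrArg (fun S : H →L[ℂ] H => S v) h).symm)
    (fun v => by
      have h := boundedCalc_mul hA (bddCont_qdilog_inv hb) (bddCont_qdilog hb)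
      simp only [inv_mul_cancel₀ (qdilog_ne_zero hb _), boundedCalc_one hA] at h
      exact (congrArg (fun S : H →L[ℂ] H => S v) h).symm)

end Dilogarithm

/-- The automorphism `P` commutes with the bounded operator `S`. -/
def EquivCommute (P : H ≃L[ℂ] H) (S : H →L[ℂ] H) : Prop := ∀ v, P (S v) = S (P v)

omit [CompleteSpace H] in
theorem EquivCommute.inv {P : H ≃L[ℂ] H} {S : H →L[ℂ] H} (h : EquivCommute P S) :
    EquivCommute P⁻¹ S := fun v => by
  have h1 := h (P⁻¹ v)
  have h2 : P (P⁻¹ v) = v := P.apply_symm_apply v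
  rw [h2] at h1
  rw [← h1]
  exact P.symm_apply_apply _

omit [CompleteSpace H] in
theorem equivCommute_noncommProd {ι : Type*} {s : Finset ι} {D : ι → H ≃L[ℂ] H} (hc)
    {S : H →L[ℂ] H} (h : ∀ i ∈ s, EquivCommute (D i) S) :
    EquivCommute (s.noncommProd D hc) S := by
  refine Finset.noncommProd_induction s D hc (fun P => EquivCommute P S) (fun P P' hP hP' v => ?_)
    (fun v => rfl) h
  exact (congrArg P (hP' v)).trans (hP _)

section Evolution

variable {b : ℂ} {N : ℕ} {r : ℤ → (H →ₗ.[ℂ] H)}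

/-- The product `φ̄_b(r_2) φ̄_b(r_4) ⋯ φ̄_b(r_{2N})`. -/
def dilogProd (hb : 0 < b.re) (hr : IsObservableFamily N r) : H ≃L[ℂ] H :=
  ((List.range N).map fun k : ℕ => dilogEquiv hb (hr.selfAdjoint (2 * (k + 1)))).prod

theorem evol_eq (hb : 0 < b.re) (hr : IsObservableFamily N r) (G : H ≃L[ℂ] H) :
    evol b N r G = ofBounded ((G * dilogProd hb hr : H ≃L[ℂ] H) : H →L[ℂ] H) := by
  have h : (fun k : ℕ => opFun (r (2 * (k + 1))) (fun x : ℝ => (qdilog b x)⁻¹)) =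
      (fun T : H ≃L[ℂ] H => ofBounded (T : H →L[ℂ] H)) ∘
        fun k : ℕ => dilogEquiv hb (hr.selfAdjoint (2 * (k + 1))) := by
    funext k
    exact opFun_eq_ofBounded (hr.selfAdjoint _) (bddCont_qdilog_inv hb)
  rw [evol, h, ← List.map_map, foldr_opMul_ofBounded, opMul_ofBounded]
  rfl

theorem IsObservableFamily.boundedCalc_commute_of_even (hr : IsObservableFamily N r) {m n : ℤ}
    (hm : Even m) (hn : Even n) {f g : ℝ → ℂ} (hf : BddCont f) (hg : BddCont g) :
    Commute (boundedCalc (r m) f) (boundedCalc (r n) g) :=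
  boundedCalc_commute (hr.selfAdjoint m) (hr.selfAdjoint n)
    (hr.commute_expI (commValue_eq_zero_of_even hm hn)) hf hg

theorem IsObservableFamily.equivCommute_dilogEquiv (hr : IsObservableFamily N r) (hb : 0 < b.re)
    {m n : ℤ} (h : commValue N n m = 0) {g : ℝ → ℂ} (hg : BddCont g) :
    EquivCommute (dilogEquiv hb (hr.selfAdjoint m)) (boundedCalc (r n) g) := fun v =>
  congrArg (fun S : H →L[ℂ] H => S v) (boundedCalc_commute (hr.selfAdjoint n) (hr.selfAdjoint m)
    (hr.commute_expI h) hg (bddCont_qdilog_inv hb)).symm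

theorem IsObservableFamily.dilogEquiv_comm (hr : IsObservableFamily N r) (hb : 0 < b.re) :
    ((Finset.range N : Finset ℕ) : Set ℕ).Pairwise
      (Function.onFun Commute fun k : ℕ => dilogEquiv hb (hr.selfAdjoint (2 * (k + 1)))) := by
  intro k _ l _ _
  refine ContinuousLinearEquiv.ext (funext fun v => ?_)
  exact hr.equivCommute_dilogEquiv hb (commValue_eq_zero_of_even (even_two_mul _) (even_two_mul _))
    (bddCont_qdilog_inv hb) v

theorem dilogProd_eq (hb : 0 < b.re) (hr : IsObservableFamily N r) :
    dilogProd hb hr = (Finset.range N).noncommProd _ (hr.dilogEquiv_comm hb) :=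
  (Multiset.noncommProd_coe _ _).symm

theorem equivCommute_dilogProd (hb : 0 < b.re) (hr : IsObservableFamily N r) {n : ℤ} (hn : Even n)
    {g : ℝ → ℂ} (hg : BddCont g) : EquivCommute (dilogProd hb hr) (boundedCalc (r n) g) := by
  rw [dilogProd_eq]
  exact equivCommute_noncommProd _ fun k _ =>
    hr.equivCommute_dilogEquiv hb (commValue_eq_zero_of_even hn (even_two_mul _)) hg

/-- The inverse of `dilogProd`, with the factors that do not commute with `r_{n+1}` singled out:
there are two of them if `N > 1`. -/
theorem exists_dilogProd_inv_eq_two (hb : 0 < b.re) (hr : IsObservableFamily N r) (hN : 1 < N)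
    {n : ℤ} (hn : Even n) : ∃ W : H ≃L[ℂ] H,
      (∀ v, (dilogProd hb hr)⁻¹ v = W (boundedCalc (r (n + 2)) (fun x => qdilog b x)
        (boundedCalc (r n) (fun x => qdilog b x) v))) ∧
      (∀ g, BddCont g → EquivCommute W (boundedCalc (r (n + 1)) g)) ∧
      ∀ j, Even j → ∀ g, BddCont g → EquivCommute W (boundedCalc (r j) g) := by
  obtain ⟨k₀, hk₀, e₀⟩ := exists_modEq_of_even hN.le hn
  obtain ⟨k₁, hk₁, e₁⟩ := exists_modEq_of_even hN.le (hn.add even_two)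
  -- Equal indices would give n ≡ n + 2 modulo 2N, hence N ∣ 1.
  have hne : k₁ ≠ k₀ := by
    rintro rfl
    obtain ⟨d, hd⟩ := (e₀.symm.trans e₁).dvd
    have h1 : (1 : ℤ) = N * d := by linarith
    have h2 : (N : ℤ) ∣ 1 := ⟨d, h1⟩
    have := Int.le_of_dvd one_pos h2
    omega
  have m₀ : k₀ ∈ Finset.range N := Finset.mem_range.2 hk₀
  have m₁ : k₁ ∈ (Finset.range N).erase k₀ := Finset.mem_erase.2 ⟨hne, Finset.mem_range.2 hk₁⟩
  have hc := hr.dilogEquiv_comm hb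
  have hc₀ := hc.mono (Finset.coe_subset.2 ((Finset.range N).erase_subset k₀))
  have hc₁ := hc₀.mono (Finset.coe_subset.2 (((Finset.range N).erase k₀).erase_subset k₁))
  refine ⟨((((Finset.range N).erase k₀).erase k₁).noncommProd _ hc₁)⁻¹, fun v => ?_,
    fun g hg => ?_, fun j hj g hg => ?_⟩
  · have h₀ := Finset.mul_noncommProd_erase (Finset.range N) m₀
      (fun k : ℕ => dilogEquiv hb (hr.selfAdjoint (2 * (k + 1)))) hc hc₀
    have h₁ := Finset.mul_noncommProd_erase ((Finset.range N).erase k₀) m₁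
      (fun k : ℕ => dilogEquiv hb (hr.selfAdjoint (2 * (k + 1)))) hc₀ hc₁
    rw [dilogProd_eq, ← h₀, ← h₁, mul_inv_rev, mul_inv_rev, ← hr.eq_of_modEq e₀,
      ← hr.eq_of_modEq e₁]
    rfl
  · refine (equivCommute_noncommProd _ fun k hk => ?_).inv
    obtain ⟨hk1, hk⟩ := Finset.mem_erase.1 hk
    obtain ⟨hk0, hk⟩ := Finset.mem_erase.1 hk
    have hkN := Finset.mem_range.1 hk
    refine hr.equivCommute_dilogEquiv hb (commValue_eq_zero_of_not_modEq
      (fun h => hk0 (eq_of_even_modEq hkN hk₀ (h.trans e₀.symm)))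
      (fun h => hk1 (eq_of_even_modEq hkN hk₁ (h.trans e₁.symm)))) hg
  · exact (equivCommute_noncommProd _ fun k _ => hr.equivCommute_dilogEquiv hb
      (commValue_eq_zero_of_even hj (even_two_mul _)) hg).inv

theorem dilogProd_inv_eq_one (hb : 0 < b.re) {r : ℤ → (H →ₗ.[ℂ] H)} (hr : IsObservableFamily 1 r)
    {n : ℤ} (hn : Even n) (v : H) :
    (dilogProd hb hr)⁻¹ v = boundedCalc (r n) (fun x => qdilog b x) v := by
  have e : r n = r (2 * ((0 : ℕ) + 1)) := by
    refine hr.eq_of_modEq ?_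
    obtain ⟨u, rfl⟩ := hn
    exact Int.modEq_iff_dvd.2 ⟨1 - u, by push_cast; ring⟩
  rw [e, dilogProd, List.range_one, List.map_singleton, List.prod_singleton]
  rfl

end Evolution

/-! ### Regularization of the commutator with the quantum dilogarithm -/

theorem mem_calcGraph_of_equivCommute {p : H →ₗ.[ℂ] H} (hp : IsSelfAdjoint p) {W : H ≃L[ℂ] H}
    (h : ∀ g, BddCont g → EquivCommute W (boundedCalc p g)) {f : ℝ → ℂ} (hf : Continuous f)
    {v y : H} (hv : (v, y) ∈ calcGraph p f) : (W v, W y) ∈ calcGraph p f := by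
  intro g hg hs
  have h1 := VanishAtInfty.of_hasCompactSupport hg hs
  have h2 := VanishAtInfty.of_mul hg hs hf
  have e1 := h _ h1.bddCont y
  have e2 := h _ h2.bddCont v
  rw [boundedCalc_eq_ccCalc hp h1] at e1
  rw [boundedCalc_eq_ccCalc hp h2] at e2
  change ccCalc p g (W y) = ccCalc p (fun x => g x * f x) (W v)
  rw [← e1, ← e2, mem_calcGraph.1 hv g hg hs]

theorem mem_calcGraph_iff_of_equivCommute {p : H →ₗ.[ℂ] H} (hp : IsSelfAdjoint p) {W : H ≃L[ℂ] H}
    (h : ∀ g, BddCont g → EquivCommute W (boundedCalc p g)) {f : ℝ → ℂ} (hf : Continuous f)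
    {v y : H} : (W v, W y) ∈ calcGraph p f ↔ (v, y) ∈ calcGraph p f := by
  refine ⟨fun hv => ?_, mem_calcGraph_of_equivCommute hp h hf⟩
  have h1 := mem_calcGraph_of_equivCommute hp (fun g hg => (h g hg).inv) hf hv
  have h2 : ∀ u, W⁻¹ (W u) = u := W.symm_apply_apply
  rwa [h2, h2] at h1

section ShiftedDilogarithm

variable {b : ℂ} {s : ℝ} {c : ℂ} {F : ℝ → ℂ}

/-- The right member of the shift pair is bounded and 1/φ_b is bounded on the line, so the Gaussian
tames F; no separate estimate is needed. -/
theorem bddCont_gauss_mul (hb : 0 < b.re)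
    (h : ShiftPair c (fun x => qdilog b x * gauss s (x - I * c))
      fun x => F x * qdilog b x * gauss s x) : BddCont fun x : ℝ => gauss s x * F x := by
  have h1 := h.right.bddCont.mul (bddCont_qdilog_inv hb)
  have h2 : (fun x : ℝ => gauss s x * F x) =
      fun x : ℝ => F x * qdilog b x * gauss s x * (qdilog b x)⁻¹ := by
    funext x
    have := qdilog_ne_zero hb x
    field_simp
  rwa [h2]

/-- The regularized form of e^{ap} φ_b(x) = φ_b(x) F(x) e^{ap}: the Gaussian centred at ic on the
input side becomes the Gaussian centred at 0 after the shift. -/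
theorem WeylPair.dilog_mem (hb : 0 < b.re) {p x : H →ₗ.[ℂ] H} (hp : IsSelfAdjoint p)
    (hx : IsSelfAdjoint x) {κ : ℝ} (hpx : WeylPair p x κ) {a : ℂ} (hac : a * κ = c)
    (hs : 0 < s) (hc : 0 ≤ c.re)
    (h : ShiftPair c (fun x => qdilog b x * gauss s (x - I * c))
      fun x => F x * qdilog b x * gauss s x) {v y : H}
    (hv : (v, y) ∈ calcGraph p fun t => exp (a * t)) :
    (boundedCalc x (fun t => qdilog b t) (boundedCalc x (fun t => gauss s (t - I * c)) v),
      boundedCalc x (fun t => qdilog b t) (boundedCalc x (fun t => gauss s t * F t) y)) ∈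
        calcGraph p fun t => exp (a * t) := by
  have h1 := hpx.mem_of_shiftPair hp hx hac h hv
  have hφ := bddCont_qdilog hb
  have e : (fun t : ℝ => F t * qdilog b t * gauss s t) =
      fun t : ℝ => qdilog b t * (gauss s t * F t) := by
    funext t
    ring
  rw [e, boundedCalc_mul hx hφ (bddCont_gauss_mul hb h),
    boundedCalc_mul hx hφ (shiftPair_gauss hs hc).left.bddCont] at h1
  exact h1

end ShiftedDilogarithm

section Regularization

variable {b : ℂ} {N : ℕ} {r : ℤ → (H →ₗ.[ℂ] H)} {n : ℤ}

/-- The inverse width of the regularizing Gaussians. -/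
def width (k : ℕ) : ℝ := 1 / (k + 1)

theorem width_pos (k : ℕ) : 0 < width k := by
  unfold width
  positivity

/-- The function `1 + c e^{2πbx}`. -/
def linFactor (b c : ℂ) (x : ℝ) : ℂ := 1 + c * exp (2 * Real.pi * b * x)

theorem continuous_linFactor (b c : ℂ) : Continuous (linFactor b c) := by
  unfold linFactor
  fun_prop

theorem bddCont_gauss_linFactor (hb : 0 < b.re) (k : ℕ) :
    BddCont fun x : ℝ => gauss (width k) x * linFactor b (qParam b) x :=
  bddCont_gauss_mul hb (shiftPair_qdilog_one hb (width_pos k))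

theorem bddCont_gauss_linFactor_two (hb : 0 < b.re) (k : ℕ) :
    BddCont fun x : ℝ =>
      gauss (width k) x * (linFactor b (qParam b) x * linFactor b (qParam b ^ 3) x) :=
  bddCont_gauss_mul hb (shiftPair_qdilog_two hb (width_pos k))

/-- The factor with q³ is a linear combination of 1 and the factor with q, whose damped version is
already known to be bounded. -/
theorem bddCont_gauss_linFactor_pow (hb : 0 < b.re) (k : ℕ) :
    BddCont fun x : ℝ => gauss (width k) x * linFactor b (qParam b ^ 3) x := by
  have hg := bddCont_gauss (width_pos k)
  obtain ⟨C, hC⟩ := (bddCont_gauss_linFactor hb k).bdd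
  refine ⟨hg.cont.mul (continuous_linFactor _ _), 1 + ‖qParam b ^ 2‖ * (C + 1), fun x => ?_⟩
  have e : gauss (width k) x * linFactor b (qParam b ^ 3) x = gauss (width k) x +
      qParam b ^ 2 * (gauss (width k) x * linFactor b (qParam b) x - gauss (width k) x) := by
    unfold linFactor
    ring
  have h1 := norm_gauss_ofReal_le (width_pos k) x
  rw [e]
  refine (norm_add_le _ _).trans (add_le_add h1 ?_)
  rw [norm_mul]
  gcongr
  exact (norm_sub_le _ _).trans (add_le_add (hC x) h1)

/-- A regularizing operator for two commuting variables. -/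
def pairCalc (x x' : H →ₗ.[ℂ] H) (f : ℕ → ℝ → ℂ) (k : ℕ) : H →L[ℂ] H :=
  boundedCalc x' (f k) * boundedCalc x (f k)

theorem tendsto_pairCalc_gauss {x x' : H →ₗ.[ℂ] H} (hx : IsSelfAdjoint x) (hx' : IsSelfAdjoint x')
    (v : H) : Tendsto (fun k => pairCalc x x' (fun k t => gauss (width k) t) k v) atTop (𝓝 v) := by
  have h1 := tendsto_boundedCalc_gauss hx v
  have h2 := tendsto_boundedCalc_gauss hx' v
  rw [tendsto_iff_norm_sub_tendsto_zero] at h1 h2 ⊢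
  have h0 := h1.add h2
  rw [add_zero] at h0
  refine squeeze_zero (fun _ => norm_nonneg _) (fun k => ?_) h0
  have h3 := norm_boundedCalc_apply_le hx' (bddCont_gauss (width_pos k)).cont
    (norm_gauss_ofReal_le (width_pos k)) (boundedCalc x (fun t => gauss (width k) t) v - v)
  have h4 : pairCalc x x' (fun k t => gauss (width k) t) k v - v =
      boundedCalc x' (fun t => gauss (width k) t) (boundedCalc x (fun t => gauss (width k) t) v - v) +
        (boundedCalc x' (fun t => gauss (width k) t) v - v) := by
    rw [map_sub]
    change boundedCalc x' _ (boundedCalc x _ v) - v = _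
    abel
  rw [h4]
  rw [one_mul] at h3
  exact (norm_add_le _ _).trans (add_le_add h3 le_rfl)

theorem two_pi_mul_inv (b : ℂ) (d : ℕ) : 2 * Real.pi * b * ((d / (2 * Real.pi) : ℝ) : ℂ) = d * b := by
  have hpi : (Real.pi : ℂ) ≠ 0 := by exact_mod_cast Real.pi_ne_zero
  push_cast
  field_simp

/-- Since r_n and r_{n+2} commute, e^{2πbp} is moved past one dilogarithm and then past the other,
each time with shift 2πb/(2π) = b. The remaining factors of P⁻¹ are collected in W, which commutes
with p. -/
theorem regularization_two (hb : 0 < b.re) (hr : IsObservableFamily N r) (hN : 1 < N)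
    (hn : Even n) :
    Regularization (calcGraph (r (n + 1)) fun t : ℝ => exp (2 * Real.pi * b * t))
      (dilogProd hb hr)⁻¹ (pairCalc (r n) (r (n + 2)) fun k t => gauss (width k) (t - I * b))
      (pairCalc (r n) (r (n + 2)) fun k t => gauss (width k) t)
      (pairCalc (r n) (r (n + 2)) fun k t => gauss (width k) t * linFactor b (qParam b) t) := by
  obtain ⟨W, hQ, hW, hW'⟩ := exists_dilogProd_inv_eq_two hb hr hN hn
  have hn2 : Even (n + 2) := hn.add even_two
  have hp := hr.selfAdjoint (n + 1)
  have hx := hr.selfAdjoint n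
  have hx' := hr.selfAdjoint (n + 2)
  have hpx := hr.weylPair (commValue_of_even (N := N) hn)
  have hpx' := hr.weylPair (commValue_of_even' (N := N) hn)
  have hd : onePlusDelta N = 1 := if_neg hN.ne'
  have hac : 2 * Real.pi * b * ((onePlusDelta N / (2 * Real.pi) : ℝ) : ℂ) = b := by
    rw [two_pi_mul_inv, hd, Nat.cast_one, one_mul]
  have hg := fun k => (shiftPair_gauss (width_pos k) hb.le).left.bddCont
  have hg' := fun k => bddCont_gauss (width_pos k)
  have hφ := bddCont_qdilog hb
  refine ⟨fun k v y hv => ?_, fun k v y hv => ?_, fun k v => ?_, fun k v => ?_,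
    tendsto_pairCalc_gauss hx hx'⟩
  · exact hpx'.mem_of_shiftPair hp hx' hac (shiftPair_gauss (width_pos k) hb.le)
      (hpx.mem_of_shiftPair hp hx hac (shiftPair_gauss (width_pos k) hb.le) hv)
  · have h1 := hpx.dilog_mem hb hp hx hac (width_pos k) hb.le
      (shiftPair_qdilog_one hb (width_pos k)) hv
    have h2 := hpx'.dilog_mem hb hp hx' hac (width_pos k) hb.le
      (shiftPair_qdilog_one hb (width_pos k)) h1
    have h3 := mem_calcGraph_of_equivCommute hp hW (by fun_prop) h2
    -- The two shifts yield φ_b g in r_{n+2} following φ_b g in r_n, whereas the claim has both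
    -- Gaussians applied before both dilogarithms.
    have e : ∀ {g : ℝ → ℂ}, BddCont g → ∀ u, boundedCalc (r n) (fun t => qdilog b t)
        (boundedCalc (r (n + 2)) g u) =
          boundedCalc (r (n + 2)) g (boundedCalc (r n) (fun t => qdilog b t) u) := fun hg u =>
      congrArg (fun S : H →L[ℂ] H => S u) (hr.boundedCalc_commute_of_even hn hn2 hφ hg)
    rw [hQ, hQ]
    change (W (boundedCalc _ _ (boundedCalc (r n) _ (boundedCalc (r (n + 2)) _ (boundedCalc (r n) _ v)))),
      W (boundedCalc _ _ (boundedCalc (r n) _ (boundedCalc (r (n + 2)) _ (boundedCalc (r n) _ y))))) ∈ _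
    rw [e (hg k), e (bddCont_gauss_linFactor hb k)]
    exact h3
  · have h1 := (equivCommute_dilogProd hb hr hn2 (hg k)).inv
    have h2 := (equivCommute_dilogProd hb hr hn (hg k)).inv
    exact (h1 _).trans (congrArg _ (h2 _))
  · have h1 := (equivCommute_dilogProd hb hr hn2 (hg' k)).inv
    have h2 := (equivCommute_dilogProd hb hr hn (hg' k)).inv
    exact (h1 _).trans (congrArg _ (h2 _))

theorem regularization_one (hb : 0 < b.re) {r : ℤ → (H →ₗ.[ℂ] H)} (hr : IsObservableFamily 1 r)
    (hn : Even n) :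
    Regularization (calcGraph (r (n + 1)) fun t : ℝ => exp (2 * Real.pi * b * t))
      (dilogProd hb hr)⁻¹ (fun k => boundedCalc (r n) fun t => gauss (width k) (t - I * (2 * b)))
      (fun k => boundedCalc (r n) fun t => gauss (width k) t)
      (fun k => boundedCalc (r n) fun t =>
        gauss (width k) t * (linFactor b (qParam b) t * linFactor b (qParam b ^ 3) t)) := by
  have hp := hr.selfAdjoint (n + 1)
  have hx := hr.selfAdjoint n
  have hpx := hr.weylPair (commValue_of_even (N := 1) hn)
  have hd : onePlusDelta 1 = 2 := if_pos rfl
  have hac : 2 * Real.pi * b * ((onePlusDelta 1 / (2 * Real.pi) : ℝ) : ℂ) = 2 * b := by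
    rw [two_pi_mul_inv, hd, Nat.cast_ofNat]
  have h2b : 0 ≤ (2 * b).re := by simpa using hb.le
  refine ⟨fun k v y hv => ?_, fun k v y hv => ?_, fun k v => ?_, fun k v => ?_,
    tendsto_boundedCalc_gauss hx⟩
  · exact hpx.mem_of_shiftPair hp hx hac (shiftPair_gauss (width_pos k) h2b) hv
  · rw [dilogProd_inv_eq_one hb hr hn, dilogProd_inv_eq_one hb hr hn]
    exact hpx.dilog_mem hb hp hx hac (width_pos k) h2b
      (shiftPair_qdilog_two hb (width_pos k)) hv
  · exact (equivCommute_dilogProd hb hr hn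
      (shiftPair_gauss (width_pos k) h2b).left.bddCont).inv v
  · exact (equivCommute_dilogProd hb hr hn (bddCont_gauss (width_pos k))).inv v

/-! ### The product of the linear factors -/

/-- The graph of `F'(x') F(x)` on its natural domain. -/
def productGraph (x x' : H →ₗ.[ℂ] H) (F F' : ℝ → ℂ) : Set (H × H) :=
  {p | ∃ y, (p.1, y) ∈ calcGraph x F ∧ (y, p.2) ∈ calcGraph x' F'}

/-- The first half regularizes each unbounded factor by its own Gaussian, and the second exhibits
the intermediate vector g(x') (gF)(x) v. Both rest on the commutation of bounded functions of x and
x'. -/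
theorem productGraph_two (hb : 0 < b.re) {x x' : H →ₗ.[ℂ] H} (hx : IsSelfAdjoint x)
    (hx' : IsSelfAdjoint x') (hxx' : ∀ {f g : ℝ → ℂ}, BddCont f → BddCont g →
      Commute (boundedCalc x f) (boundedCalc x' g)) :
    productGraph x x' (linFactor b (qParam b)) (linFactor b (qParam b)) ⊆
      regGraph (pairCalc x x' fun k t => gauss (width k) t)
        (pairCalc x x' fun k t => gauss (width k) t * linFactor b (qParam b) t) ∧
    ∀ k v, (pairCalc x x' (fun k t => gauss (width k) t) k v,
      pairCalc x x' (fun k t => gauss (width k) t * linFactor b (qParam b) t) k v) ∈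
        productGraph x x' (linFactor b (qParam b)) (linFactor b (qParam b)) := by
  have hF := continuous_linFactor b (qParam b)
  have hg := fun k => bddCont_gauss (width_pos k)
  have hgF := fun k => bddCont_gauss_linFactor hb k
  have comm : ∀ {f g : ℝ → ℂ}, BddCont f → BddCont g → ∀ u,
      boundedCalc x f (boundedCalc x' g u) = boundedCalc x' g (boundedCalc x f u) :=
    fun hf hg u => congrArg (fun S : H →L[ℂ] H => S u) (hxx' hf hg)
  constructor
  · rintro ⟨v, z⟩ ⟨y, h1, h2⟩ k
    change boundedCalc x' _ (boundedCalc x _ z) = boundedCalc x' _ (boundedCalc x _ v)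
    rw [← comm (hg k) (hg k), boundedCalc_apply_eq hx' (hg k) (hgF k) h2, comm (hg k) (hgF k),
      boundedCalc_apply_eq hx (hg k) (hgF k) h1]
  · intro k v
    refine ⟨boundedCalc x' (fun t => gauss (width k) t)
      (boundedCalc x (fun t => gauss (width k) t * linFactor b (qParam b) t) v), ?_, ?_⟩
    · change (boundedCalc x' _ (boundedCalc x _ v), _) ∈ _
      rw [← comm (hg k) (hg k), ← comm (hgF k) (hg k)]
      exact boundedCalc_mul_mem hx hF (hg k) (hgF k) _
    · exact boundedCalc_mul_mem hx' hF (hg k) (hgF k) _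

/-- Both factors are functions of the same operator, so a single Gaussian regularizes the product.
The converse needs it to dominate the q³ factor alone as well, for the intermediate vector. -/
theorem productGraph_one (hb : 0 < b.re) {x : H →ₗ.[ℂ] H} (hx : IsSelfAdjoint x) :
    productGraph x x (linFactor b (qParam b ^ 3)) (linFactor b (qParam b)) ⊆
      regGraph (fun k => boundedCalc x fun t => gauss (width k) t) (fun k => boundedCalc x fun t =>
        gauss (width k) t * (linFactor b (qParam b) t * linFactor b (qParam b ^ 3) t)) ∧
    ∀ k v, (boundedCalc x (fun t => gauss (width k) t) v, boundedCalc x (fun t =>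
      gauss (width k) t * (linFactor b (qParam b) t * linFactor b (qParam b ^ 3) t)) v) ∈
        productGraph x x (linFactor b (qParam b ^ 3)) (linFactor b (qParam b)) := by
  have hg := fun k => bddCont_gauss (width_pos k)
  have hgF := fun k => bddCont_gauss_linFactor_two hb k
  have hgF' := fun k => bddCont_gauss_linFactor_pow hb k
  constructor
  · rintro ⟨v, z⟩ ⟨y, h1, h2⟩ k
    exact boundedCalc_apply_eq hx (hg k) (hgF k) (calcGraph_comp (continuous_linFactor _ _) h1 h2)
  · intro k v
    refine ⟨_, boundedCalc_mul_mem hx (continuous_linFactor _ _) (hg k) (hgF' k) _, ?_⟩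
    have e : (fun t : ℝ => gauss (width k) t * (linFactor b (qParam b) t * linFactor b (qParam b ^ 3) t)) =
        fun t : ℝ => gauss (width k) t * linFactor b (qParam b ^ 3) t * linFactor b (qParam b) t := by
      funext t
      ring
    have h := hgF k
    rw [e] at h ⊢
    exact boundedCalc_mul_mem hx (continuous_linFactor _ _) (hgF' k) h _

end Regularization

/-! ### The fields in the interaction picture -/

theorem Intertwines.mem_calcGraph_iff {A A' : H →ₗ.[ℂ] H} {σ : ℝ ≃ₜ ℝ} {T : H ≃L[ℂ] H}
    (hT : Intertwines A A' σ (T : H →L[ℂ] H)) {f : ℝ → ℂ} (hf : Continuous f) {v y : H} :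
    (T v, T y) ∈ calcGraph A' (fun x => f (σ x)) ↔ (v, y) ∈ calcGraph A f := by
  refine ⟨fun h => ?_, hT.mem_calcGraph hf⟩
  have h1 := hT.symm.mem_calcGraph (f := fun x => f (σ x)) (hf.comp σ.continuous) h
  simpa using h1

section Shift

variable {r : ℤ → (H →ₗ.[ℂ] H)} {G : H ≃L[ℂ] H}

omit [CompleteSpace H] in
theorem IsShiftFlip.exists_mem_graph (hG : IsShiftFlip r G) (j : ℤ) {v y : H}
    (h : (v, y) ∈ (r j).graph) : ∃ w, (G v, w) ∈ (r (j - 1)).graph ∧ G y = (-1 : ℂ) ^ j • w := by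
  have h1 : (v, G y) ∈ (opMul (ofBounded (G : H →L[ℂ] H)) (r j)).graph :=
    mem_graph_opMul.2 ⟨y, h, mem_graph_ofBounded.2 rfl⟩
  rw [hG j] at h1
  obtain ⟨w, hw, e⟩ := mem_graph_smul.1 h1
  obtain ⟨u, hu, hw⟩ := mem_graph_opMul.1 hw
  rw [mem_graph_ofBounded.1 hu] at hw
  exact ⟨w, hw, e⟩

theorem IsShiftFlip.mem_calcGraph_even (hG : IsShiftFlip r G) (hr : ∀ j, IsSelfAdjoint (r j))
    {j : ℤ} (hj : Even j) {f : ℝ → ℂ} (hf : Continuous f) {v y : H} :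
    (G v, G y) ∈ calcGraph (r (j - 1)) f ↔ (v, y) ∈ calcGraph (r j) f := by
  have h : Intertwines (r j) (r (j - 1)) (Homeomorph.refl ℝ) (G : H →L[ℂ] H) := by
    refine intertwines_of_graph (hr _) (hr _) fun v y hv => ?_
    obtain ⟨w, hw, e⟩ := hG.exists_mem_graph j hv
    rw [hj.neg_one_zpow, one_smul] at e
    change (G v, G y) ∈ _
    rwa [e]
  exact h.mem_calcGraph_iff hf

theorem IsShiftFlip.mem_calcGraph_odd (hG : IsShiftFlip r G) (hr : ∀ j, IsSelfAdjoint (r j))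
    {j : ℤ} (hj : Odd j) {f : ℝ → ℂ} (hf : Continuous f) {v y : H} :
    (G v, G y) ∈ calcGraph (r (j - 1)) (fun x => f (-x)) ↔ (v, y) ∈ calcGraph (r j) f := by
  have h : Intertwines (r j) (r (j - 1)) (Homeomorph.neg ℝ) (G : H →L[ℂ] H) := by
    refine intertwines_of_graph_neg (hr _) (hr _) fun v y hv => ?_
    obtain ⟨w, hw, e⟩ := hG.exists_mem_graph j hv
    rw [hj.neg_one_zpow, neg_smul, one_smul] at e
    change (G v, -G y) ∈ _
    rwa [e, neg_neg]
  exact h.mem_calcGraph_iff hf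

end Shift

section Field

variable {b : ℂ} {N : ℕ} {r : ℤ → (H →ₗ.[ℂ] H)} {G T : H ≃L[ℂ] H}

omit [CompleteSpace H] in
theorem zpow_neg_apply_eq_iff (T : H ≃L[ℂ] H) (t : ℤ) {y z : H} :
    z = (T ^ t : H ≃L[ℂ] H) y ↔ (T ^ (-t) : H ≃L[ℂ] H) z = y := by
  rw [zpow_neg]
  constructor
  · rintro rfl
    exact (T ^ t).symm_apply_apply y
  · rintro rfl
    exact ((T ^ t).apply_symm_apply z).symm

theorem mem_graph_field (hr : ∀ j, IsSelfAdjoint (r j))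
    (hT : evol b N r G = ofBounded (T : H →L[ℂ] H)) (j t : ℤ) {v z : H} :
    (v, z) ∈ (field b N r G j t).graph ↔
      ((T ^ (-t) : H ≃L[ℂ] H) v, (T ^ (-t) : H ≃L[ℂ] H) z) ∈
        calcGraph (r (j + t)) fun x : ℝ => exp (2 * Real.pi * b * x) := by
  rw [field, hT, opZPow_ofBounded, opZPow_ofBounded]
  simp only [mem_graph_opMul, mem_graph_ofBounded, graph_opFun (hr _), exists_eq_left]
  constructor
  · rintro ⟨y, hy, hz⟩
    rw [(zpow_neg_apply_eq_iff T t).1 hz]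
    exact hy
  · intro h
    exact ⟨_, h, (zpow_neg_apply_eq_iff T t).2 rfl⟩

omit [CompleteSpace H] in
theorem zpow_apply_zpow_apply (T : H ≃L[ℂ] H) {s t u : ℤ} (h : s + t = u) (v : H) :
    (T ^ s : H ≃L[ℂ] H) ((T ^ t : H ≃L[ℂ] H) v) = (T ^ u : H ≃L[ℂ] H) v := by
  rw [← h, zpow_add]
  rfl

/-- U^{-t} Λ = G, and G carries r_n to r_{n-1} for even n; so conjugation by Λ turns a field on the
time slice t into an exponential of r_n. -/
theorem mem_graph_oneAdd_field (hr : ∀ j, IsSelfAdjoint (r j)) (hG : IsShiftFlip r G)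
    (hT : evol b N r G = ofBounded (T : H →L[ℂ] H)) {j t n : ℤ} (hn : Even n) (hj : j + t = n - 1)
    {c : ℂ} (hc : c ≠ 0) {v z : H} :
    ((T ^ t * G : H ≃L[ℂ] H) v, (T ^ t * G : H ≃L[ℂ] H) z) ∈
      (oneAdd c (field b N r G j t)).graph ↔ (v, z) ∈ calcGraph (r n) (linFactor b c) := by
  have h1 : ∀ v z : H, ((T ^ t * G : H ≃L[ℂ] H) v, (T ^ t * G : H ≃L[ℂ] H) z) ∈
      (field b N r G j t).graph ↔ (v, z) ∈ calcGraph (r n) fun x : ℝ => exp (2 * Real.pi * b * x) := by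
    intro v z
    rw [mem_graph_field hr hT, hj]
    have e : ∀ u, (T ^ (-t) : H ≃L[ℂ] H) ((T ^ t * G : H ≃L[ℂ] H) u) = G u := fun u =>
      zpow_apply_zpow_apply T (neg_add_cancel t) (G u)
    rw [e, e]
    exact hG.mem_calcGraph_even hr hn (by fun_prop)
  unfold linFactor
  rw [mem_graph_oneAdd, mem_calcGraph_one_add (hr n) (by fun_prop) hc]
  constructor
  · rintro ⟨w, hw, e⟩
    obtain ⟨w, rfl⟩ := (T ^ t * G : H ≃L[ℂ] H).surjective w
    refine ⟨w, (h1 _ _).1 hw, (T ^ t * G : H ≃L[ℂ] H).injective ?_⟩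
    rw [e, map_add, map_smul]
  · rintro ⟨w, hw, rfl⟩
    exact ⟨_, (h1 _ _).2 hw, by rw [map_add, map_smul]⟩

theorem mem_graph_product_iff (hr : ∀ j, IsSelfAdjoint (r j)) (hG : IsShiftFlip r G)
    (hT : evol b N r G = ofBounded (T : H →L[ℂ] H)) {m t : ℤ} (hn : Even (m + t))
    {c c' : ℂ} (hc : c ≠ 0) (hc' : c' ≠ 0) :
    {p : H × H | ((T ^ t * G : H ≃L[ℂ] H) p.1, (T ^ t * G : H ≃L[ℂ] H) p.2) ∈
      (opMul (oneAdd c' (field b N r G (m + 1) t)) (oneAdd c (field b N r G (m - 1) t))).graph} =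
      productGraph (r (m + t)) (r (m + t + 2)) (linFactor b c) (linFactor b c') := by
  have h1 : m - 1 + t = (m + t) - 1 := by ring
  have h2 : m + 1 + t = (m + t + 2) - 1 := by ring
  ext ⟨v, z⟩
  rw [mem_ofPred_eq, mem_graph_opMul]
  constructor
  · rintro ⟨y, hy, hz⟩
    obtain ⟨y, rfl⟩ := (T ^ t * G : H ≃L[ℂ] H).surjective y
    exact ⟨y, (mem_graph_oneAdd_field hr hG hT hn h1 hc).1 hy,
      (mem_graph_oneAdd_field hr hG hT (hn.add even_two) h2 hc').1 hz⟩
  · rintro ⟨y, hy, hz⟩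
    exact ⟨_, (mem_graph_oneAdd_field hr hG hT hn h1 hc).2 hy,
      (mem_graph_oneAdd_field hr hG hT (hn.add even_two) h2 hc').2 hz⟩

/-- For the later field U^{-(t+1)}Λ = P⁻¹, which leaves the conjugate of e^{2πbp} by P. For the
earlier one U^{-(t-1)}Λ = G P G: the outer G turns r_{n-1} into r_n, P commutes with r_n, and the
inner G turns r_n into -p. The exponential is thus inverted, and its graph is that of e^{2πbp} with
the components exchanged. -/
theorem mem_graph_commutator_iff (hr : ∀ j, IsSelfAdjoint (r j)) (hG : IsShiftFlip r G)
    {P : H ≃L[ℂ] H} (hT : evol b N r G = ofBounded ((G * P : H ≃L[ℂ] H) : H →L[ℂ] H)) {m t : ℤ}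
    (hn : Even (m + t)) (hP : ∀ g, BddCont g → EquivCommute P (boundedCalc (r (m + t)) g)) :
    {p : H × H | (((G * P) ^ t * G : H ≃L[ℂ] H) p.1, ((G * P) ^ t * G : H ≃L[ℂ] H) p.2) ∈
      (opMul (field b N r G m (t + 1)) (field b N r G m (t - 1))).graph} =
      commutatorGraph (calcGraph (r (m + t + 1)) fun x : ℝ => exp (2 * Real.pi * b * x)) P⁻¹ := by
  have e1 : ∀ u, ((G * P) ^ (-(t - 1)) : H ≃L[ℂ] H) (((G * P) ^ t * G : H ≃L[ℂ] H) u) =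
      G (P (G u)) := fun u => by
    have := zpow_apply_zpow_apply (G * P) (show -(t - 1) + t = 1 by ring) (G u)
    rw [zpow_one] at this
    exact this
  have e2 : ∀ u, ((G * P) ^ (-(t + 1)) : H ≃L[ℂ] H) (((G * P) ^ t * G : H ≃L[ℂ] H) u) =
      P⁻¹ u := fun u => by
    have := zpow_apply_zpow_apply (G * P) (show -(t + 1) + t = -1 by ring) (G u)
    rw [zpow_neg_one, mul_inv_rev] at this
    exact this.trans (congrArg _ (G.symm_apply_apply u))
  have h1 : ∀ v y : H, (((G * P) ^ t * G : H ≃L[ℂ] H) v, ((G * P) ^ t * G : H ≃L[ℂ] H) y) ∈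
      (field b N r G m (t - 1)).graph ↔
        (y, v) ∈ calcGraph (r (m + t + 1)) fun x : ℝ => exp (2 * Real.pi * b * x) := by
    intro v y
    have hj : Odd (m + t + 1) := hn.add_one
    have h2 := hG.mem_calcGraph_odd hr hj (f := fun x : ℝ => exp (-(2 * Real.pi * b * x)))
      (by fun_prop) (v := v) (y := y)
    simp only [ofReal_neg, mul_neg, neg_neg, add_sub_cancel_right] at h2
    rw [mem_graph_field hr hT, e1, e1, show m + (t - 1) = m + t - 1 by ring,
      hG.mem_calcGraph_even hr hn (by fun_prop),
      mem_calcGraph_iff_of_equivCommute (hr _) hP (by fun_prop), h2, mem_calcGraph_exp_neg]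
  have h2 : ∀ y z : H, (((G * P) ^ t * G : H ≃L[ℂ] H) y, ((G * P) ^ t * G : H ≃L[ℂ] H) z) ∈
      (field b N r G m (t + 1)).graph ↔
        (P⁻¹ y, P⁻¹ z) ∈ calcGraph (r (m + t + 1)) fun x : ℝ => exp (2 * Real.pi * b * x) := by
    intro y z
    rw [mem_graph_field hr hT, e2, e2, add_assoc m t 1]
  ext ⟨v, z⟩
  rw [mem_ofPred_eq, mem_graph_opMul]
  constructor
  · rintro ⟨y, hy, hz⟩
    obtain ⟨y, rfl⟩ := ((G * P) ^ t * G : H ≃L[ℂ] H).surjective y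
    exact ⟨y, (h1 _ _).1 hy, (h2 _ _).1 hz⟩
  · rintro ⟨y, hy, hz⟩
    exact ⟨_, (h1 _ _).2 hy, (h2 _ _).2 hz⟩

omit [CompleteSpace H] in
/-- The criterion for the discrete Liouville equation in terms of a regularization. -/
theorem eqClosure_of_regularization {E : Submodule ℂ (H × H)} {Q Λ : H ≃L[ℂ] H}
    {K L M : ℕ → H →L[ℂ] H} (h : Regularization E Q K L M)
    (hE : ∀ v y z, (v, y) ∈ E → (v, z) ∈ E → y = z)
    (hd : ∀ v, v ∈ closure (Prod.snd '' (E : Set (H × H)))) {S : Set (H × H)}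
    (hS : S ⊆ regGraph L M) (hS' : ∀ k v, (L k v, M k v) ∈ S) {A B : H →ₗ.[ℂ] H}
    (hA : {p : H × H | (Λ p.1, Λ p.2) ∈ A.graph} = commutatorGraph E Q)
    (hB : {p : H × H | (Λ p.1, Λ p.2) ∈ B.graph} = S) : EqClosure A B := by
  refine eqClosure_of_isCoreGraph (Λ := Λ) (F := regGraph L M) ⟨fun v z hv => ?_, ?_⟩
    ⟨fun v z hv => ?_, ?_⟩ (isClosed_regGraph L M) (eq_zero_of_mem_regGraph h.tendsto)
    (dense_fst_regGraph h.tendsto fun k v => hS (hS' k v))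
  · exact h.commutatorGraph_subset hE (hA.subset hv)
  · rw [hA]
    exact mem_closure_of_regGraph h.tendsto (h.mem_closure hd)
  · exact hS (hB.subset hv)
  · rw [hB]
    exact mem_closure_of_regGraph h.tendsto fun k v => subset_closure (hS' k v)

end Field

end QLiouville

end

theorem mainTheorem5 {H : Type*} [NormedAddCommGroup H] [InnerProductSpace ℂ H] [CompleteSpace H]
    (b : ℂ) (hb : 0 < b.re) (hb' : 0 ≤ b.im) (N : ℕ) (hN : 1 ≤ N)
    (r : ℤ → (H →ₗ.[ℂ] H)) (hr : QLiouville.IsObservableFamily N r)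
    (G : H ≃L[ℂ] H) (hG : QLiouville.IsShiftFlip r G) :
    (∃ T : H ≃L[ℂ] H, QLiouville.evol b N r G = QLiouville.ofBounded (T : H →L[ℂ] H)) ∧
    (∀ m t : ℤ, Odd (m + t) →
      QLiouville.field b N r G (m + 2 * N) t = QLiouville.field b N r G m t) ∧
    (∀ m t : ℤ, Even (m + t) →
      QLiouville.EqClosure
        (QLiouville.opMul (QLiouville.field b N r G m (t + 1))
          (QLiouville.field b N r G m (t - 1)))
        (QLiouville.opMul
          (QLiouville.oneAdd (QLiouville.qParam b) (QLiouville.field b N r G (m + 1) t))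
          (QLiouville.oneAdd (QLiouville.qParam b ^ (1 + 2 * if N = 1 then 1 else 0))
            (QLiouville.field b N r G (m - 1) t)))) := by
  have hT := QLiouville.evol_eq hb hr G
  refine ⟨⟨_, hT⟩, fun m t _ => ?_, fun m t hn => ?_⟩
  · have h : m + 2 * N + t = m + t + 2 * N := by ring
    rw [QLiouville.field, QLiouville.field, h, hr.periodic]
  · have hq : QLiouville.qParam b ≠ 0 := exp_ne_zero _
    have hsa := hr.selfAdjoint
    have hA := QLiouville.mem_graph_commutator_iff hsa hG hT hn
      fun g hg => QLiouville.equivCommute_dilogProd hb hr hn hg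
    have hE := fun v y z => QLiouville.calcGraph_unique (hsa (m + t + 1))
      (f := fun x : ℝ => exp (2 * Real.pi * b * x)) (v := v) (y := y) (z := z)
    have hd := QLiouville.dense_snd_calcGraph_exp (hsa (m + t + 1)) (2 * Real.pi * b)
    obtain rfl | hN := hN.eq_or_lt
    -- For N = 1 the two neighbours of r_{n+1} are the same operator; the exponent 1 + 2δ is 3 on
    -- the factor applied first.
    · have e : r (m + t + 2) = r (m + t) := by simpa using hr.periodic (m + t)
      have hB := QLiouville.mem_graph_product_iff hsa hG hT hn (pow_ne_zero 3 hq) hq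
      rw [e] at hB
      obtain ⟨h1, h2⟩ := QLiouville.productGraph_one hb (hsa (m + t))
      exact QLiouville.eqClosure_of_regularization (QLiouville.regularization_one hb hr hn) hE hd
        h1 h2 hA hB
    · have hB := QLiouville.mem_graph_product_iff hsa hG hT hn hq hq
      obtain ⟨h1, h2⟩ := QLiouville.productGraph_two hb (hsa (m + t)) (hsa (m + t + 2))
        fun hf hg => hr.boundedCalc_commute_of_even hn (hn.add even_two) hf hg
      rw [if_neg hN.ne', mul_zero, add_zero, pow_one]
      exact QLiouville.eqClosure_of_regularization (QLiouville.regularization_two hb hr hN hn) hE hd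
        h1 h2 hA hB
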